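/- **Setting.** Let $W=(W^1,W^2)$ be a standard planar Brownian motion (two independent real Brownian motions), regarded as $\mathbb{C}$-valued and extended by $W(t)=0$ for $t\le 0$, and let $$f(p,\tau)=\mathbb{E}_{Z_\tau}W(p-Z_\tau),\qquad Z_\tau\sim N(0,\tau),\quad \tau>0,$$ where the expectation is over $Z_\tau$ only, for a fixed realisation of $W$. A *singularity* of a curve $\gamma:\mathbb{R}\to\mathbb{C}$ is a point $t_0$ with $\gamma'(t_0)=0$. It is a *cusp singularity* if $\gamma$ is analytic near $t_0$ and there is $c\in\mathbb{C}$, $|c|=1$, such that, for $t$ near $t_0$, $c(\gamma(t)-\gamma(t_0))$ has real part $\sum_{i\ge2}a_i(t-t_0)^i$ and imaginary part $\sum_{i\ge3}b_i(t-t_0)^i$ with $a_2\ne0$, $b_3\neq0$; the coordinates given by $z\mapsto c(z-\gamma(t_0))$ are then called *natural coordinates* at $t_0$. Let $\mathcal{M}$ be the set of continuous curves $g:[a,b]\to\mathbb{C}$, $a<b$, with the metric $d(g,h)=\inf\{\|\lambda_1-\lambda_2\|_\infty+\|g\circ\lambda_1-h\circ\lambda_2\|_\infty\}$ over homeomorphisms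 $\lambda_1,\lambda_2$ of $[0,1]$ onto the domains of $g$ and $h$ respectively. A *loop* of $\gamma$ is a restriction $\gamma|_{[a,b]}$, $a<b$, with $\gamma(a)=\gamma(b)$ and $\gamma$ injective on $[a,b)$; it is a loop *in* an interval $I$ if $[a,b]\subseteq I$. A *loop evolution* of $f$ on $[T_1,T_2)$ is a continuous map $L:[T_1,T_2)\to\mathcal{M}$ such that $L(\tau)=f(\cdot,\tau)|_{[a_\tau,b_\tau]}$ is a loop for every $\tau$. If $L$ is a loop evolution on $[T_1,T)$, its initial loop *dies at* $(p,T)$ if $T$ is the supremum of all $T_2>T_1$ for which there is a loop evolution of $f$ on $[T_1,T_2)$ starting from $L(T_1)$, and $a_\tau\to p$, $b_\tau-a_\tau\to0$ as $\tau\uparrow T$. **Theorem.** There is a constant $M>0$ such that, with probability one, the following holds for all $p_0>0$, $\tau_0>0$ such that $p_0$ is a singularity of $f(\cdot,\tau_0)$. The point $p_0$ is a cusp singularity of $f(\cdot,\tau_0)$, and there is $\delta\in(0,\tau_0)$ such that: 1. For every $\tau\in[\tau_0-\delta,\tau_0)$ there is a compact interval $I_\tau\subset(0,\infty)$ with $p_0$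 in its interior in which $f(\cdot,\tau)$ has a unique loop $L(\tau)=f(\cdot,\tau)|_{[a_\tau,b_\tau]}$. The intervals $I_\tau$ are decreasing in $\tau$ and both their end points tend to $p_0$ as $\tau\uparrow\tau_0$. The map $L:[\tau_0-\delta,\tau_0)\to\mathcal{M}$ is a loop evolution of $f$ (starting from $L(\tau_0-\delta)$), and the loop $L(\tau_0-\delta)$ dies at $(p_0,\tau_0)$. 2. In any natural coordinates of $f(\cdot,\tau_0)$ at $p_0$, with constant $c$ and coefficients $a_i,b_i$, write $c\,(f(p_0+q,\tau)-f(p_0,\tau_0))=f^1(q,\tau)+\mathrm{i}f^2(q,\tau)$. For every $s\in(0,\delta]$ the curve $$\hat f_s(P)=\left(s^{-1}f^1(\sqrt{s}P,\tau_0-s),\ s^{-3/2}f^2(\sqrt{s}P,\tau_0-s)\right)$$ has a unique loop $\hat L_s$ in $[-M,M]$, and as $s\downarrow0$, $\hat L_s$ converges in $(\mathcal{M},d)$ to $\hat L_0=\hat g|_{[-\sqrt3,\sqrt3]}$, which is the unique loop of the curve $\hat g(P)=(a_2(P^2-1),\,b_3(P^3-3P))$ on $\mathbb{R}$. -/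

import Mathlib

open MeasureTheory ProbabilityTheory Set Filter
open scoped NNReal Topology unitInterval

noncomputable section

namespace CongaLoop

/-! ### The particle-path curves -/

/-- The planar path with coordinates `w₁`, `w₂`, extended by `0` to nonpositive times. -/
def extendedPath (w₁ w₂ : ℝ≥0 → ℝ) (t : ℝ) : ℂ :=
  if 0 < t then ⟨w₁ t.toNNReal, w₂ t.toNNReal⟩ else 0

/-- The heat extension `f(p, τ) = E W(p - Z)`, with `Z` a centred normal variable of variance `τ`
and the path `W = (w₁, w₂)` held fixed. -/
def heatExtension (w₁ w₂ : ℝ≥0 → ℝ) (p τ : ℝ) : ℂ :=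
  ∫ z, extendedPath w₁ w₂ (p - z) ∂(gaussianReal 0 τ.toNNReal)

/-! ### Singularities and natural coordinates -/

/-- The curve `γ` has zero velocity at `t₀`. -/
def IsSingularity (γ : ℝ → ℂ) (t₀ : ℝ) : Prop := HasDerivAt γ 0 t₀

/-- The rigid motion `z ↦ c * (z - γ t₀)`, with `|c| = 1`, is a natural coordinate frame of `γ` based
at `t₀`: in it the two coordinates of `γ` are, near `t₀`, the sums of the power series
`∑_{i ≥ 2} a i * (t - t₀) ^ i` and `∑_{i ≥ 3} b i * (t - t₀) ^ i`, with `a 2 ≠ 0` and `b 3 ≠ 0`. -/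
structure IsNaturalFrame (γ : ℝ → ℂ) (t₀ : ℝ) (c : ℂ) (a b : ℕ → ℝ) : Prop where
  norm_eq_one : ‖c‖ = 1
  a_low : ∀ i < 2, a i = 0
  b_low : ∀ i < 3, b i = 0
  a_two : a 2 ≠ 0
  b_three : b 3 ≠ 0
  expansion : ∃ r > 0, ∀ t, |t - t₀| ≤ r →
    HasSum (fun i => a i * (t - t₀) ^ i) (c * (γ t - γ t₀)).re ∧
    HasSum (fun i => b i * (t - t₀) ^ i) (c * (γ t - γ t₀)).im

/-- A cusp singularity: the curve is analytic near `t₀` and has a natural coordinate frame there. -/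
structure IsCuspSingularity (γ : ℝ → ℂ) (t₀ : ℝ) : Prop where
  isSingularity : IsSingularity γ t₀
  analyticAt : AnalyticAt ℝ γ t₀
  exists_frame : ∃ c a b, IsNaturalFrame γ t₀ c a b

/-! ### The metric space of curves on compact intervals -/

/-- A continuous curve `[left, right] → ℂ` on a nondegenerate compact interval. -/
structure Curve where
  left : ℝ
  right : ℝ
  left_lt_right : left < right
  toFun : C(Icc left right, ℂ)

namespace Curve

/-- A homeomorphism `[0, 1] → [a, b]`, as a real-valued function. -/
def param {a b : ℝ} (l : I ≃ₜ Icc a b) : C(I, ℝ) := ⟨fun t => (l t : ℝ), by fun_prop⟩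

/-- The curve `L` reparametrised by a homeomorphism of `[0, 1]` with its interval. -/
def reparam (L : Curve) (l : I ≃ₜ Icc L.left L.right) : C(I, ℂ) :=
  ⟨fun t => L.toFun (l t), by fun_prop⟩

/-- `‖λ₁ - λ₂‖ + ‖K ∘ λ₁ - L ∘ λ₂‖`, in sup norms on `[0, 1]`. -/
def cost (K L : Curve) (l : (I ≃ₜ Icc K.left K.right) × (I ≃ₜ Icc L.left L.right)) : ℝ :=
  ‖param l.1 - param l.2‖ + ‖K.reparam l.1 - L.reparam l.2‖

/-- The distance `d(K, L)`: the infimum of the cost over all pairs of homeomorphisms. -/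
def d (K L : Curve) : ℝ := ⨅ l, cost K L l

lemma cost_nonneg (K L : Curve) (l) : 0 ≤ cost K L l := by unfold cost; positivity

lemma d_le (K L : Curve) (l) : d K L ≤ cost K L l :=
  ciInf_le ⟨0, by rintro _ ⟨l, rfl⟩; exact cost_nonneg K L l⟩ l

instance (L : Curve) : Nonempty (I ≃ₜ Icc L.left L.right) :=
  ⟨(iccHomeoI L.left L.right L.left_lt_right).symm⟩

lemma d_nonneg (K L : Curve) : 0 ≤ d K L := le_ciInf (cost_nonneg K L)

lemma d_self (L : Curve) : d L L = 0 := by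
  obtain ⟨l⟩ : Nonempty (I ≃ₜ Icc L.left L.right) := inferInstance
  exact le_antisymm ((d_le L L (l, l)).trans (by simp [cost])) (d_nonneg L L)

lemma d_comm_le (K L : Curve) : d K L ≤ d L K := by
  refine le_ciInf fun l => (d_le K L (l.2, l.1)).trans (le_of_eq ?_)
  simp only [cost]
  rw [norm_sub_rev, norm_sub_rev (K.reparam l.2)]

lemma norm_comp_le {E : Type*} [NormedAddCommGroup E] (g : C(I, E)) (h : C(I, I)) :
    ‖g.comp h‖ ≤ ‖g‖ :=
  (ContinuousMap.norm_le _ (norm_nonneg _)).2 fun t => g.norm_coe_le_norm (h t)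

lemma cost_comp_le (K L : Curve) (l : (I ≃ₜ Icc K.left K.right) × (I ≃ₜ Icc L.left L.right))
    (h : I ≃ₜ I) : cost K L (h.trans l.1, h.trans l.2) ≤ cost K L l :=
  add_le_add (norm_comp_le (param l.1 - param l.2) ⟨h, h.continuous⟩)
    (norm_comp_le (K.reparam l.1 - L.reparam l.2) ⟨h, h.continuous⟩)

lemma d_triangle (J K L : Curve) : d J L ≤ d J K + d K L := by
  refine le_ciInf_add_ciInf fun l m => ?_
  have h₁ := cost_comp_le K L m (l.2.trans m.1.symm)
  have e : (l.2.trans m.1.symm).trans m.1 = l.2 := by ext t; simp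
  rw [e] at h₁
  refine (d_le J L (l.1, (l.2.trans m.1.symm).trans m.2)).trans
    (le_trans ?_ (add_le_add le_rfl h₁))
  simp only [cost]
  have t₁ := norm_sub_le_norm_sub_add_norm_sub (param l.1) (param l.2)
    (param ((l.2.trans m.1.symm).trans m.2))
  have t₂ := norm_sub_le_norm_sub_add_norm_sub (J.reparam l.1) (K.reparam l.2)
    (L.reparam ((l.2.trans m.1.symm).trans m.2))
  linarith

instance : PseudoMetricSpace Curve where
  dist := d
  dist_self := d_self
  dist_comm K L := le_antisymm (d_comm_le K L) (d_comm_le L K)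
  dist_triangle := d_triangle

end Curve

/-! ### Loops and their evolution -/

/-- `L` is a loop of `γ`: the restriction of `γ` to `[L.left, L.right]`, with equal values at the two
end points and injective on `[L.left, L.right)`. -/
structure IsLoopOf (γ : ℝ → ℂ) (L : Curve) : Prop where
  restriction : ∀ x, L.toFun x = γ x
  closed : γ L.left = γ L.right
  injOn : InjOn γ (Ico L.left L.right)

/-- `L` is a loop of `γ` in the set `S`, and the only one. -/
structure IsUniqueLoopIn (γ : ℝ → ℂ) (S : Set ℝ) (L : Curve) : Prop where
  isLoop : IsLoopOf γ L
  subset : Icc L.left L.right ⊆ S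
  unique : ∀ L', IsLoopOf γ L' → Icc L'.left L'.right ⊆ S → L' = L

/-- `L` is a loop evolution of `f` on `[T₁, T₂)`. -/
structure IsLoopEvolution (f : ℝ → ℝ → ℂ) (T₁ T₂ : ℝ) (L : ℝ → Curve) : Prop where
  continuousOn : ContinuousOn L (Ico T₁ T₂)
  isLoop : ∀ t ∈ Ico T₁ T₂, IsLoopOf (fun p => f p t) (L t)

/-- The loop `L₀`, present at time `T₁`, vanishes after time `T`. -/
def VanishesAfter (f : ℝ → ℝ → ℂ) (T₁ : ℝ) (L₀ : Curve) (T : ℝ) : Prop :=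
  IsLUB {T₂ | T₁ < T₂ ∧ ∃ L, IsLoopEvolution f T₁ T₂ L ∧ L T₁ = L₀} T

/-- `L` is a loop evolution of `f` on `[T₁, T)`, and its initial loop dies at `(p, T)`. -/
structure DiesAt (f : ℝ → ℝ → ℂ) (T₁ : ℝ) (L : ℝ → Curve) (p T : ℝ) : Prop where
  evolution : IsLoopEvolution f T₁ T L
  vanishes : VanishesAfter f T₁ (L T₁) T
  left_tendsto : Tendsto (fun t => (L t).left) (𝓝[<] T) (𝓝 p)
  length_tendsto : Tendsto (fun t => (L t).right - (L t).left) (𝓝[<] T) (𝓝 0)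

/-! ### The rescaling and the limiting loop -/

/-- The rescaled curve `P ↦ (s⁻¹ f¹(√s P, τ₀ - s), s^(-3/2) f²(√s P, τ₀ - s))`, where `f¹`, `f²` are
the coordinates of `f` after the rigid motion `z ↦ c * (z - f p₀ τ₀)` and the space variable is
measured from `p₀`. -/
def rescaled (f : ℝ → ℝ → ℂ) (c : ℂ) (p₀ τ₀ s P : ℝ) : ℂ :=
  let z := c * (f (p₀ + √s * P) (τ₀ - s) - f p₀ τ₀)
  ⟨s⁻¹ * z.re, s ^ (-(3 / 2) : ℝ) * z.im⟩

/-- The curve `P ↦ (a (P² - 1), b (P³ - 3 P))`. -/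
def limitCurve (a b P : ℝ) : ℂ := ⟨a * (P ^ 2 - 1), b * (P ^ 3 - 3 * P)⟩

lemma continuous_limitCurve (a b : ℝ) : Continuous (limitCurve a b) :=
  Complex.equivRealProdCLM.symm.continuous.comp
    (f := fun P : ℝ => (a * (P ^ 2 - 1), b * (P ^ 3 - 3 * P))) (by fun_prop)

/-- The restriction of `limitCurve a b` to `[-√3, √3]`. -/
def limitLoop (a b : ℝ) : Curve where
  left := -√3
  right := √3
  left_lt_right := neg_lt_self (by positivity)
  toFun := ⟨fun P => limitCurve a b P, (continuous_limitCurve a b).comp continuous_subtype_val⟩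

end CongaLoop

end

/-! The two coordinates of `f` are heat extensions of fixed paths, so for τ > 0 they are analytic in
p and solve ∂_τ = ½ ∂_p². The theorem splits into a deterministic statement about such flows and an
almost sure nondegeneracy statement.

Deterministic part (`IsHeatFlow.cusp_formation`). Let f' = 0 at (p₀, τ₀), with f'' and f''' linearly
independent over ℝ. A rotation c makes c f'' real, so the coordinates u, v of c f satisfy u' = 0,
u'' ≠ 0, v' = v'' = 0, v''' ≠ 0. At p₀ + √s P and time τ₀ - s, Taylor's formula and the heat
equation produce heat polynomials: u changes by ½ u'' s (P² - 1) + o(s), and v by v''' s^(3/2) (P³ -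
3P)/6 + o(s^(3/2)). The limiting curve has exactly one double point, at P = ±√3. The approximation
also controls derivatives in P, and a Lipschitz-small perturbation of the limiting curve still has
exactly one double point in [-2, 2] (`NearModel.exists_double`, `NearModel.eq_of_double`). This
yields the loops, whose width is of order √s. Their continuity and rescaled limit follow by
compactness (`ConvergesTo.tendsto_double`). Local uniqueness forces every other evolution with the
same initial loop to follow the shrinking one, so none survives τ₀ (`vanishesAfter_of_unique`).

Probabilistic part (`ae_not_isDegenerate`). Each path is a remainder plus three linear ramps
weighted by its increments over [0, 1], [1, 2], [2, 3]. The weights have a law absolutely continuous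
on ℝ³ and are independent of the remainder. At every (p, τ) the weights are determined by the first
three derivatives, because the matrix of ramp derivatives is invertible (`det_rampMatrix_ne_zero`).
A degenerate singularity has five free parameters: p, τ, and a 2 × 2 matrix of rank at most one. So
for fixed remainders the bad weights lie in differentiable images of a hyperplane of ℝ⁶, hence form
a null set, and Fubini concludes. -/

namespace CongaLoop

/-! ### Gaussian moments and the jets of the heat extension -/

/-- The unnormalised heat kernel times a monomial. -/
noncomputable def momentKernel (n : ℕ) (p τ t : ℝ) : ℝ :=
  (p - t) ^ n * Real.exp (-(p - t) ^ 2 / (2 * τ))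

/-- The integral of a path against `momentKernel`. -/
noncomputable def moment (w : ℝ → ℝ) (n : ℕ) (p τ : ℝ) : ℝ := ∫ t, momentKernel n p τ t * w t

/-- Paths that are integrable against `exp (-|t|)`. -/
def Tempered (w : ℝ → ℝ) : Prop := Integrable fun t => Real.exp (-|t|) * w t

lemma continuous_momentKernel (n : ℕ) (p τ : ℝ) : Continuous (momentKernel n p τ) := by
  unfold momentKernel; fun_prop

/-- The Gaussian beats any exponential. The bound is uniform for p, τ in a bounded range, which is
what domination under the integral sign requires. -/
lemma abs_momentKernel_le (n : ℕ) {p τ R T : ℝ} (hp : |p| ≤ R) (hτ : 0 < τ) (hT : τ ≤ T) (t : ℝ) :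
    |momentKernel n p τ t| ≤ n.factorial * Real.exp (R + 2 * T) * Real.exp (-|t|) := by
  unfold momentKernel
  rw [abs_mul, abs_pow, Real.abs_exp]
  have h1 : |p - t| ^ n ≤ n.factorial * Real.exp |p - t| := by
    have := Real.pow_div_factorial_le_exp |p - t| (abs_nonneg _) n
    rwa [div_le_iff₀ (by positivity), mul_comm] at this
  have h2 : |p - t| + -(p - t) ^ 2 / (2 * τ) ≤ R + 2 * T + -|t| := by
    -- AM-GM: 2x ≤ x²/(2T) + 2T. One copy of x = |p - t| absorbs the monomial, the other supplies
    -- the decay in |t|.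
    have h3 : 2 * |p - t| - 2 * T ≤ (p - t) ^ 2 / (2 * τ) := by
      rw [le_div_iff₀ (by positivity)]
      rcases le_or_gt (2 * |p - t| - 2 * T) 0 with h | h
      · nlinarith [sq_nonneg (p - t)]
      · have : (2 * |p - t| - 2 * T) * (2 * τ) ≤ (2 * |p - t| - 2 * T) * (2 * T) := by nlinarith
        nlinarith [sq_nonneg (|p - t| - 2 * T), sq_abs (p - t)]
    have h4 : |t| ≤ |p| + |p - t| := by
      have := abs_sub_abs_le_abs_sub t p
      rw [abs_sub_comm] at this; linarith
    rw [neg_div]; linarith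
  calc |p - t| ^ n * Real.exp (-(p - t) ^ 2 / (2 * τ))
      ≤ n.factorial * Real.exp |p - t| * Real.exp (-(p - t) ^ 2 / (2 * τ)) := by gcongr
    _ = n.factorial * Real.exp (|p - t| + -(p - t) ^ 2 / (2 * τ)) := by rw [Real.exp_add]; ring
    _ ≤ n.factorial * Real.exp (R + 2 * T + -|t|) := by gcongr
    _ = _ := by rw [Real.exp_add (R + 2 * T)]; ring

lemma Tempered.aestronglyMeasurable {w : ℝ → ℝ} (hw : Tempered w) :
    AEStronglyMeasurable w volume := by
  have h : w = fun t => Real.exp |t| * (Real.exp (-|t|) * w t) := by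
    ext t; rw [← mul_assoc, ← Real.exp_add]; simp
  rw [h]
  exact (by fun_prop : Continuous fun t : ℝ => Real.exp |t|).aestronglyMeasurable.mul hw.1

lemma Tempered.integrable_of_le {w : ℝ → ℝ} (hw : Tempered w) {k : ℝ → ℝ} (hk : Continuous k)
    {C : ℝ} (hC : ∀ t, |k t| ≤ C * Real.exp (-|t|)) : Integrable fun t => k t * w t := by
  refine (hw.norm.const_mul C).mono' (hk.aestronglyMeasurable.mul hw.aestronglyMeasurable) ?_
  filter_upwards with t
  rw [norm_mul, norm_mul, Real.norm_eq_abs, Real.norm_eq_abs (Real.exp _), Real.abs_exp, ← mul_assoc]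
  gcongr
  exact hC t

lemma Tempered.integrable_moment {w : ℝ → ℝ} (hw : Tempered w) (n : ℕ) (p : ℝ) {τ : ℝ}
    (hτ : 0 < τ) : Integrable fun t => momentKernel n p τ t * w t :=
  hw.integrable_of_le (continuous_momentKernel n p τ)
    (abs_momentKernel_le n le_rfl hτ le_rfl)

lemma Tempered.add {v w : ℝ → ℝ} (hv : Tempered v) (hw : Tempered w) :
    Tempered fun t => v t + w t := by
  simp only [Tempered, mul_add]
  exact Integrable.add hv hw

lemma Tempered.const_mul {w : ℝ → ℝ} (hw : Tempered w) (c : ℝ) :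
    Tempered fun t => c * w t := by
  simpa [Tempered, mul_left_comm] using Integrable.const_mul hw c

lemma moment_add {v w : ℝ → ℝ} (hv : Tempered v) (hw : Tempered w) (n : ℕ) (p : ℝ) {τ : ℝ}
    (hτ : 0 < τ) : moment (fun t => v t + w t) n p τ = moment v n p τ + moment w n p τ := by
  simp only [moment, mul_add]
  exact integral_add (hv.integrable_moment n p hτ) (hw.integrable_moment n p hτ)

lemma moment_const_mul (w : ℝ → ℝ) (c : ℝ) (n : ℕ) (p τ : ℝ) :
    moment (fun t => c * w t) n p τ = c * moment w n p τ := by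
  simp only [moment, mul_left_comm _ c]
  exact integral_const_mul _ _

/-- For n = 0 the truncated index `n - 1` is harmless because of its factor n. -/
lemma hasFDerivAt_momentKernel (n : ℕ) (p t : ℝ) {τ : ℝ} (hτ : 0 < τ) :
    HasFDerivAt (fun x : ℝ × ℝ => momentKernel n x.1 x.2 t)
      ((n * momentKernel (n - 1) p τ t - τ⁻¹ * momentKernel (n + 1) p τ t) •
          ContinuousLinearMap.fst ℝ ℝ ℝ +
        ((2 * τ ^ 2)⁻¹ * momentKernel (n + 2) p τ t) • ContinuousLinearMap.snd ℝ ℝ ℝ) (p, τ) := by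
  unfold momentKernel
  have h1 : HasFDerivAt (fun x : ℝ × ℝ => x.1 - t) (ContinuousLinearMap.fst ℝ ℝ ℝ) (p, τ) :=
    hasFDerivAt_fst.sub_const t
  have h2 : HasFDerivAt (fun x : ℝ × ℝ => 2 * x.2) ((2 : ℝ) • ContinuousLinearMap.snd ℝ ℝ ℝ)
    (p, τ) := hasFDerivAt_snd.const_mul 2
  have h3 : HasFDerivAt (fun x : ℝ × ℝ => (2 * x.2)⁻¹) _ (p, τ) :=
    (hasDerivAt_inv (by positivity : (2 * τ) ≠ 0)).comp_hasFDerivAt (p, τ) h2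
  have h4 := (h1.pow n).mul (((h1.pow 2).neg.mul h3).exp)
  refine h4.congr_fderiv ?_
  ext
  · rcases n with _ | n
    · simp; field_simp
    · simp; field_simp; ring
  · simp; field_simp; ring

/-- Differentiation under the integral, jointly in space and time: the later expansions move along
(p + εP, τ - ε²), so separate partial derivatives would not suffice. -/
lemma hasFDerivAt_moment {w : ℝ → ℝ} (hw : Tempered w) (n : ℕ) (p : ℝ) {τ : ℝ} (hτ : 0 < τ) :
    HasFDerivAt (fun x : ℝ × ℝ => moment w n x.1 x.2)
      ((n * moment w (n - 1) p τ - τ⁻¹ * moment w (n + 1) p τ) • ContinuousLinearMap.fst ℝ ℝ ℝ +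
        ((2 * τ ^ 2)⁻¹ * moment w (n + 2) p τ) • ContinuousLinearMap.snd ℝ ℝ ℝ) (p, τ) := by
  set α : ℝ × ℝ → ℝ → ℝ := fun x t =>
    n * momentKernel (n - 1) x.1 x.2 t - x.2⁻¹ * momentKernel (n + 1) x.1 x.2 t with hα
  set β : ℝ × ℝ → ℝ → ℝ := fun x t => (2 * x.2 ^ 2)⁻¹ * momentKernel (n + 2) x.1 x.2 t with hβ
  have hαc (x) : Continuous (α x) := by
    have := continuous_momentKernel; simp only [hα]; fun_prop
  have hβc (x) : Continuous (β x) := by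
    have := continuous_momentKernel; simp only [hβ]; fun_prop
  set s : Set (ℝ × ℝ) := Ioo (p - 1) (p + 1) ×ˢ Ioo (τ / 2) (2 * τ) with hs
  have hsn : s ∈ 𝓝 (p, τ) := prod_mem_nhds (Ioo_mem_nhds (by linarith) (by linarith))
    (Ioo_mem_nhds (by linarith) (by linarith))
  set E := Real.exp (|p| + 1 + 2 * (2 * τ))
  have hx (x) (hx : x ∈ s) : |x.1| ≤ |p| + 1 ∧ 0 < x.2 ∧ x.2 ≤ 2 * τ ∧ τ / 2 ≤ x.2 := by
    obtain ⟨⟨h1, h2⟩, h3, h4⟩ := hx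
    refine ⟨?_, by linarith, h4.le, h3.le⟩
    have : |x.1 - p| ≤ 1 := abs_le.2 ⟨by linarith, by linarith⟩
    have := abs_sub_abs_le_abs_sub x.1 p; linarith
  set A : ℝ := n * ((n - 1).factorial * E) + (τ / 2)⁻¹ * ((n + 1).factorial * E)
  set B : ℝ := (2 * (τ / 2) ^ 2)⁻¹ * ((n + 2).factorial * E)
  have hαb (x) (hxs : x ∈ s) (t) : |α x t| ≤ A * Real.exp (-|t|) := by
    obtain ⟨h1, h2, h3, h4⟩ := hx x hxs
    have i1 := abs_momentKernel_le (n - 1) h1 h2 h3 t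
    have i2 := abs_momentKernel_le (n + 1) h1 h2 h3 t
    have i3 : x.2⁻¹ ≤ (τ / 2)⁻¹ := by gcongr
    simp only [hα, A, add_mul]
    refine (abs_sub _ _).trans (add_le_add ?_ ?_)
    · rw [abs_mul, Nat.abs_cast, mul_assoc]; gcongr
    · rw [abs_mul, abs_inv, abs_of_pos h2, mul_assoc]; gcongr
  have hβb (x) (hxs : x ∈ s) (t) : |β x t| ≤ B * Real.exp (-|t|) := by
    obtain ⟨h1, h2, h3, h4⟩ := hx x hxs
    have i2 := abs_momentKernel_le (n + 2) h1 h2 h3 t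
    simp only [hβ, B]
    rw [abs_mul, abs_inv, abs_of_pos (by positivity : 0 < 2 * x.2 ^ 2), mul_assoc]; gcongr
  have hps : (p, τ) ∈ s := mem_of_mem_nhds hsn
  have key := hasFDerivAt_integral_of_dominated_of_fderiv_le (𝕜 := ℝ) (μ := volume)
    (F := fun (x : ℝ × ℝ) t => momentKernel n x.1 x.2 t * w t)
    (F' := fun x t => (α x t * w t) • ContinuousLinearMap.fst ℝ ℝ ℝ +
      (β x t * w t) • ContinuousLinearMap.snd ℝ ℝ ℝ) (x₀ := (p, τ))
    (bound := fun t => (A + B) * (Real.exp (-|t|) * |w t|)) hsn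
    ?_ (hw.integrable_moment n p hτ) ?_ ?_ ?_ ?_
  · refine key.congr_fderiv ?_
    have j1 : Integrable fun t => α (p, τ) t * w t := hw.integrable_of_le (hαc _) (hαb _ hps)
    have j2 : Integrable fun t => β (p, τ) t * w t := hw.integrable_of_le (hβc _) (hβb _ hps)
    rw [integral_add (j1.smul_const _) (j2.smul_const _), integral_smul_const, integral_smul_const]
    congr 2
    · simp only [hα, sub_mul, moment]
      rw [integral_sub, ← integral_const_mul, ← integral_const_mul]
      · simp only [mul_assoc]
      · simpa only [mul_assoc] using (hw.integrable_moment (n - 1) p hτ).const_mul _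
      · simpa only [mul_assoc] using (hw.integrable_moment (n + 1) p hτ).const_mul _
    · simp only [hβ, moment, mul_assoc]
      rw [integral_const_mul]
  · filter_upwards with x
    exact (continuous_momentKernel _ _ _).aestronglyMeasurable.mul hw.aestronglyMeasurable
  · exact (((hαc _).aestronglyMeasurable.mul hw.aestronglyMeasurable).smul_const _).add
      (((hβc _).aestronglyMeasurable.mul hw.aestronglyMeasurable).smul_const _)
  · filter_upwards with t x hxs
    have e1 : ‖ContinuousLinearMap.fst ℝ ℝ ℝ‖ ≤ 1 := ContinuousLinearMap.norm_fst_le ..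
    have e2 : ‖ContinuousLinearMap.snd ℝ ℝ ℝ‖ ≤ 1 := ContinuousLinearMap.norm_snd_le ..
    have e3 := hαb x hxs t
    have e4 := hβb x hxs t
    refine (norm_add_le _ _).trans ?_
    rw [add_mul, norm_smul, norm_smul, Real.norm_eq_abs, Real.norm_eq_abs, abs_mul, abs_mul]
    refine add_le_add ?_ ?_
    · calc _ ≤ A * Real.exp (-|t|) * |w t| * 1 := by gcongr
        _ = _ := by ring
    · calc _ ≤ B * Real.exp (-|t|) * |w t| * 1 := by gcongr
        _ = _ := by ring
  · exact (hw.norm.const_mul (A + B)).congr (by filter_upwards with t; simp)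
  · filter_upwards with t x hxs
    have := (hasFDerivAt_momentKernel n x.1 t (hx x hxs).2.1).mul_const (w t)
    refine this.congr_fderiv ?_
    simp only [hα, hβ, smul_add, smul_smul, mul_comm (w t)]

/-- The normalisation of the heat kernel. -/
noncomputable def heatNorm (τ : ℝ) : ℝ := (√(2 * Real.pi * τ))⁻¹

/-- The first derivatives in `p` of the heat extension of a real path. -/
noncomputable def jet (w : ℝ → ℝ) : ℕ → ℝ → ℝ → ℝ
  | 0, p, τ => heatNorm τ * moment w 0 p τ
  | 1, p, τ => heatNorm τ * (-τ⁻¹ * moment w 1 p τ)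
  | 2, p, τ => heatNorm τ * (τ⁻¹ ^ 2 * moment w 2 p τ - τ⁻¹ * moment w 0 p τ)
  | 3, p, τ => heatNorm τ * (-τ⁻¹ ^ 3 * moment w 3 p τ + 3 * τ⁻¹ ^ 2 * moment w 1 p τ)
  | 4, p, τ => heatNorm τ *
      (τ⁻¹ ^ 4 * moment w 4 p τ - 6 * τ⁻¹ ^ 3 * moment w 2 p τ + 3 * τ⁻¹ ^ 2 * moment w 0 p τ)
  -- Junk value. Order 4 is the last one needed: it occurs only in the time derivative of order 2.
  | _, _, _ => 0

lemma hasFDerivAt_heatNorm (p : ℝ) {τ : ℝ} (hτ : 0 < τ) :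
    HasFDerivAt (fun x : ℝ × ℝ => heatNorm x.2)
      ((-(heatNorm τ * (2 * τ)⁻¹)) • ContinuousLinearMap.snd ℝ ℝ ℝ) (p, τ) := by
  have hpos : 0 < 2 * Real.pi * τ := by positivity
  have h1 : HasDerivAt (fun τ : ℝ => 2 * Real.pi * τ) (2 * Real.pi * 1) τ :=
    (hasDerivAt_id τ).const_mul _
  have h2 : HasDerivAt heatNorm _ τ := (h1.sqrt hpos.ne').inv (Real.sqrt_pos.2 hpos).ne'
  refine (h2.comp_hasFDerivAt (f := Prod.snd) (p, τ) hasFDerivAt_snd).congr_fderiv ?_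
  congr 1
  have h3 : √(2 * Real.pi * τ) ≠ 0 := (Real.sqrt_pos.2 hpos).ne'
  unfold heatNorm
  rw [Real.sq_sqrt hpos.le]
  field_simp

lemma hasFDerivAt_inv_snd (p : ℝ) {τ : ℝ} (hτ : 0 < τ) :
    HasFDerivAt (fun x : ℝ × ℝ => x.2⁻¹) ((-(τ ^ 2)⁻¹) • ContinuousLinearMap.snd ℝ ℝ ℝ) (p, τ) :=
  (hasDerivAt_inv hτ.ne').comp_hasFDerivAt (p, τ) hasFDerivAt_snd

/-- The time component is the heat equation ∂_τ = ½ ∂_p² applied to each jet; the bound on j keeps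
`j + 2` inside the table of jets. -/
lemma hasFDerivAt_jet {w : ℝ → ℝ} (hw : Tempered w) {j : ℕ} (hj : j < 3) (p : ℝ) {τ : ℝ}
    (hτ : 0 < τ) : HasFDerivAt (fun x : ℝ × ℝ => jet w j x.1 x.2)
      (jet w (j + 1) p τ • ContinuousLinearMap.fst ℝ ℝ ℝ +
        (2⁻¹ * jet w (j + 2) p τ) • ContinuousLinearMap.snd ℝ ℝ ℝ) (p, τ) := by
  have hN := hasFDerivAt_heatNorm p hτ
  have hi := hasFDerivAt_inv_snd p hτ
  have hm (n) := hasFDerivAt_moment hw n p hτ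
  interval_cases j
  · refine (hN.mul (hm 0)).congr_fderiv ?_
    ext
    · simp [jet]
    · simp [jet]; field_simp; ring
  · refine (hN.mul (hi.neg.mul (hm 1))).congr_fderiv ?_
    ext <;> simp [jet] <;> field_simp <;> ring
  · refine (hN.mul (((hi.pow 2).mul (hm 2)).sub (hi.mul (hm 0)))).congr_fderiv ?_
    ext <;> simp [jet] <;> field_simp <;> ring

/-- At order 3 the value of the derivative is never used. Differentiability serves the null-set
argument and continuity the compactness argument. -/
lemma differentiableAt_jet_three {w : ℝ → ℝ} (hw : Tempered w) (p : ℝ) {τ : ℝ} (hτ : 0 < τ) :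
    DifferentiableAt ℝ (fun x : ℝ × ℝ => jet w 3 x.1 x.2) (p, τ) := by
  have hN := (hasFDerivAt_heatNorm p hτ).differentiableAt
  have hi := (hasFDerivAt_inv_snd p hτ).differentiableAt
  have hm (n) := (hasFDerivAt_moment hw n p hτ).differentiableAt
  exact hN.mul (((hi.pow 3).neg.mul (hm 3)).add (((hi.pow 2).const_mul 3).mul (hm 1)))

lemma differentiableAt_jet {w : ℝ → ℝ} (hw : Tempered w) {j : ℕ} (hj : j ≤ 3) (p : ℝ) {τ : ℝ}
    (hτ : 0 < τ) : DifferentiableAt ℝ (fun x : ℝ × ℝ => jet w j x.1 x.2) (p, τ) := by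
  rcases hj.lt_or_eq with h | rfl
  · exact (hasFDerivAt_jet hw h p hτ).differentiableAt
  · exact differentiableAt_jet_three hw p hτ

lemma jet_add {v w : ℝ → ℝ} (hv : Tempered v) (hw : Tempered w) (j : ℕ) (p : ℝ) {τ : ℝ}
    (hτ : 0 < τ) : jet (fun t => v t + w t) j p τ = jet v j p τ + jet w j p τ := by
  match j with
  | 0 | 1 | 2 | 3 | 4 => simp only [jet, moment_add hv hw _ _ hτ]; ring
  | _ + 5 => simp [jet]

lemma jet_const_mul (w : ℝ → ℝ) (c : ℝ) (j : ℕ) (p τ : ℝ) :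
    jet (fun t => c * w t) j p τ = c * jet w j p τ := by
  match j with
  | 0 | 1 | 2 | 3 | 4 => simp only [jet, moment_const_mul]; ring
  | _ + 5 => simp [jet]

end CongaLoop

namespace CongaLoop

/-! ### The heat extension in terms of jets; analyticity -/

/-- A real path, extended by `0` to nonpositive times. -/
noncomputable def realPath (w : ℝ≥0 → ℝ) (t : ℝ) : ℝ := if 0 < t then w t.toNNReal else 0

/-- Substituting t = p - z moves p from the rough path into the smooth kernel. -/
lemma heatExtension_eq {w₁ w₂ : ℝ≥0 → ℝ} (h₁ : Tempered (realPath w₁))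
    (h₂ : Tempered (realPath w₂)) (p : ℝ) {τ : ℝ} (hτ : 0 < τ) :
    heatExtension w₁ w₂ p τ = ⟨jet (realPath w₁) 0 p τ, jet (realPath w₂) 0 p τ⟩ := by
  have hv : τ.toNNReal ≠ 0 := by simpa using hτ
  have hpath (t : ℝ) : extendedPath w₁ w₂ t = ⟨realPath w₁ t, realPath w₂ t⟩ := by
    unfold extendedPath realPath; split_ifs <;> rfl
  have hpdf (t : ℝ) : gaussianPDFReal 0 τ.toNNReal (p - t) = heatNorm τ * momentKernel 0 p τ t := by
    simp [gaussianPDFReal, heatNorm, momentKernel, hτ.le]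
  set F : ℝ → ℂ := fun t => (heatNorm τ * momentKernel 0 p τ t) •
    (⟨realPath w₁ t, realPath w₂ t⟩ : ℂ) with hF
  have h0 : heatExtension w₁ w₂ p τ = ∫ t, F t := by
    rw [heatExtension, integral_gaussianReal_eq_integral_smul hv,
      ← integral_sub_left_eq_self F volume p]
    congr 1; ext1 z
    simp only [hF, ← hpdf, hpath, sub_sub_cancel]
  have i₁ := (h₁.integrable_moment 0 p hτ).const_mul (heatNorm τ)
  have i₂ := (h₂.integrable_moment 0 p hτ).const_mul (heatNorm τ)
  have hF' : F = fun t => ((heatNorm τ * (momentKernel 0 p τ t * realPath w₁ t) : ℝ) : ℂ) +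
      ((heatNorm τ * (momentKernel 0 p τ t * realPath w₂ t) : ℝ) : ℂ) * Complex.I := by
    ext t; apply Complex.ext <;> simp [hF, mul_assoc]
  rw [h0, hF', integral_add i₁.ofReal (i₂.ofReal.mul_const _), integral_mul_const,
    integral_complex_ofReal, integral_complex_ofReal, integral_const_mul, integral_const_mul]
  apply Complex.ext <;> simp [jet, moment]

/-- Analyticity in p comes from an entire extension: for z = x + iy the complex kernel has modulus
exp(y²/(2τ)) times the real kernel at x, so the real bounds dominate locally uniformly in z. -/
lemma differentiable_complexMoment {w : ℝ → ℝ} (hw : Tempered w) {τ : ℝ} (hτ : 0 < τ) :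
    Differentiable ℂ fun z : ℂ => ∫ t : ℝ, Complex.exp (-(z - t) ^ 2 / (2 * τ)) * (w t : ℂ) := by
  intro z₀
  have hnorm (z : ℂ) (t : ℝ) : ‖Complex.exp (-(z - t) ^ 2 / (2 * τ))‖ =
      Real.exp (z.im ^ 2 / (2 * τ)) * |momentKernel 0 z.re τ t| := by
    rw [Complex.norm_exp, momentKernel, pow_zero, one_mul, Real.abs_exp, ← Real.exp_add]
    congr 1
    have : (2 * (τ : ℂ)) = ((2 * τ : ℝ) : ℂ) := by push_cast; rfl
    rw [this, Complex.div_ofReal_re]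
    simp [pow_two]; field_simp; ring
  have hcont (z : ℂ) : Continuous fun t : ℝ => Complex.exp (-(z - t) ^ 2 / (2 * τ)) := by fun_prop
  have hmeas : AEStronglyMeasurable (fun t => (w t : ℂ)) volume :=
    Complex.continuous_ofReal.comp_aestronglyMeasurable hw.aestronglyMeasurable
  set R : ℝ := ‖z₀‖ + 1
  set C : ℝ := Real.exp (R ^ 2 / (2 * τ)) * (τ⁻¹ * ((1 + R) * (2 * Real.exp (R + 2 * τ))))
  have hR : 0 ≤ R := by positivity
  have hz (z) (h : z ∈ Metric.ball z₀ 1) : ‖z‖ ≤ R := by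
    have := norm_sub_norm_le z z₀
    rw [Metric.mem_ball, dist_eq_norm] at h; linarith
  refine (hasDerivAt_integral_of_dominated_loc_of_deriv_le (𝕜 := ℂ) (μ := volume)
    (F := fun (z : ℂ) (t : ℝ) => Complex.exp (-(z - t) ^ 2 / (2 * τ)) * (w t : ℂ))
    (F' := fun (z : ℂ) (t : ℝ) =>
      (Complex.exp (-(z - t) ^ 2 / (2 * τ)) * (-(z - t) / τ)) * (w t : ℂ))
    (bound := fun t => C * (Real.exp (-|t|) * |w t|)) (Metric.ball_mem_nhds z₀ one_pos)
    ?_ ?_ ?_ ?_ ?_ ?_).2.differentiableAt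
  · filter_upwards with z
    exact (hcont z).aestronglyMeasurable.mul hmeas
  · have h := (hw.integrable_moment 0 z₀.re hτ).norm.const_mul (Real.exp (z₀.im ^ 2 / (2 * τ)))
    refine h.mono' ((hcont _).aestronglyMeasurable.mul hmeas) ?_
    filter_upwards with t
    rw [norm_mul, hnorm]; simp [mul_assoc]
  · refine AEStronglyMeasurable.mul (Continuous.aestronglyMeasurable ?_) hmeas
    fun_prop
  · filter_upwards with t z hzb
    have hzR := hz z hzb
    have h1 : |z.re| ≤ R := (Complex.abs_re_le_norm z).trans hzR
    have h2 : |z.im| ≤ R := (Complex.abs_im_le_norm z).trans hzR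
    have h3 : z.im ^ 2 ≤ R ^ 2 := sq_le_sq' (by linarith [neg_abs_le z.im]) (by linarith [le_abs_self z.im])
    have h4 := abs_momentKernel_le 0 h1 hτ le_rfl t
    have h5 := abs_momentKernel_le 1 h1 hτ le_rfl t
    have h6 : ‖-(z - t) / (τ : ℂ)‖ ≤ τ⁻¹ * (|z.re - t| + R) := by
      rw [norm_div, norm_neg, Complex.norm_real, Real.norm_of_nonneg hτ.le, div_eq_inv_mul]
      gcongr
      refine (Complex.norm_le_abs_re_add_abs_im _).trans ?_
      simp; linarith
    have h7 : |momentKernel 0 z.re τ t| * |z.re - t| = |momentKernel 1 z.re τ t| := by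
      rw [← abs_mul]; congr 1; simp [momentKernel]; ring
    simp only [Nat.factorial_zero, Nat.factorial_one, Nat.cast_one, one_mul] at h4 h5
    rw [norm_mul, norm_mul, hnorm, Complex.norm_real, Real.norm_eq_abs, ← mul_assoc]
    refine mul_le_mul_of_nonneg_right ?_ (abs_nonneg _)
    calc Real.exp (z.im ^ 2 / (2 * τ)) * |momentKernel 0 z.re τ t| * ‖-(z - t) / (τ : ℂ)‖
        ≤ Real.exp (R ^ 2 / (2 * τ)) * |momentKernel 0 z.re τ t| * (τ⁻¹ * (|z.re - t| + R)) := by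
          gcongr
      _ = Real.exp (R ^ 2 / (2 * τ)) * (τ⁻¹ * (|momentKernel 1 z.re τ t| +
            R * |momentKernel 0 z.re τ t|)) := by rw [← h7]; ring
      _ ≤ Real.exp (R ^ 2 / (2 * τ)) * (τ⁻¹ * (Real.exp (R + 2 * τ) * Real.exp (-|t|) +
            R * (Real.exp (R + 2 * τ) * Real.exp (-|t|)))) := by gcongr
      -- The factor 2 is slack, matching the choice of `C`.
      _ ≤ Real.exp (R ^ 2 / (2 * τ)) * (τ⁻¹ * (2 * (Real.exp (R + 2 * τ) * Real.exp (-|t|) +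
            R * (Real.exp (R + 2 * τ) * Real.exp (-|t|))))) := by
          gcongr
          refine le_mul_of_one_le_left (by positivity) (by norm_num)
      _ = _ := by simp only [C]; ring
  · exact (hw.norm.const_mul C).congr (by filter_upwards with t; simp)
  · filter_upwards with t z _
    have h1 : HasDerivAt (fun z : ℂ => -(z - t) ^ 2 / (2 * τ)) (-(z - t) / τ) z := by
      have := ((((hasDerivAt_id z).sub_const (t : ℂ)).pow 2).neg).div_const (2 * (τ : ℂ))
      have hτ' : (τ : ℂ) ≠ 0 := by exact_mod_cast hτ.ne'
      refine this.congr_deriv ?_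
      simp only [id_eq]
      push_cast
      field_simp
    exact h1.cexp.mul_const _

lemma analyticAt_jet_zero {w : ℝ → ℝ} (hw : Tempered w) {τ : ℝ} (hτ : 0 < τ) (p : ℝ) :
    AnalyticAt ℝ (fun p => jet w 0 p τ) p := by
  have h1 := ((differentiable_complexMoment hw hτ).analyticAt (p : ℂ)).re_ofReal
  have h2 : (fun p => jet w 0 p τ) = fun p : ℝ => heatNorm τ *
      (∫ t : ℝ, Complex.exp (-((p : ℂ) - t) ^ 2 / (2 * τ)) * (w t : ℂ)).re := by
    ext p
    have : (∫ t : ℝ, Complex.exp (-((p : ℂ) - t) ^ 2 / (2 * τ)) * (w t : ℂ)) =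
        ((moment w 0 p τ : ℝ) : ℂ) := by
      rw [moment, ← integral_complex_ofReal]
      congr 1; ext t; simp [momentKernel]
    rw [this, Complex.ofReal_re, jet]
  rw [h2]
  exact analyticAt_const.mul h1

end CongaLoop

namespace CongaLoop

/-! ### Arcs, double points and loops -/

/-- The restriction of `γ` to `[a, b]`, as a `Curve` (a junk value unless `a < b` and `γ` is
continuous on `[a, b]`). -/
noncomputable def arc (γ : ℝ → ℂ) (a b : ℝ) : Curve :=
  open Classical in
  if h : a < b ∧ ContinuousOn γ (Icc a b) then ⟨a, b, h.1, ⟨_, h.2.domRestrict⟩⟩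
  else ⟨0, 1, one_pos, 0⟩

section arc

variable {γ : ℝ → ℂ} {a b : ℝ}

lemma arc_left (h : a < b) (hγ : ContinuousOn γ (Icc a b)) : (arc γ a b).left = a := by
  simp [arc, h, hγ]

lemma arc_right (h : a < b) (hγ : ContinuousOn γ (Icc a b)) : (arc γ a b).right = b := by
  simp [arc, h, hγ]

lemma arc_toFun (h : a < b) (hγ : ContinuousOn γ (Icc a b)) (x) : (arc γ a b).toFun x = γ x := by
  have hab := And.intro h hγ
  generalize hK : arc γ a b = K at x
  rw [arc, dif_pos hab] at hK
  subst hK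
  rfl

end arc

lemma Curve.ext_of_restriction {K L : Curve} {γ : ℝ → ℂ} (hl : K.left = L.left)
    (hr : K.right = L.right) (hK : ∀ x, K.toFun x = γ x) (hL : ∀ x, L.toFun x = γ x) : K = L := by
  obtain ⟨a, b, h, f⟩ := K
  obtain ⟨a', b', h', g⟩ := L
  obtain rfl : a = a' := hl
  obtain rfl : b = b' := hr
  obtain rfl : f = g := by ext x; rw [hK, hL]
  rfl

/-- `(a, b)` is, up to order, the only double point of `γ` with parameters in `S`. -/
structure IsUniqueDouble (γ : ℝ → ℂ) (S : Set ℝ) (a b : ℝ) : Prop where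
  lt : a < b
  eq : γ a = γ b
  subset : Icc a b ⊆ S
  unique : ∀ a' b', a' < b' → Icc a' b' ⊆ S → γ a' = γ b' → a' = a ∧ b' = b

/-- Loops correspond to double points: a failure of injectivity on [a, b) would be a second double
point in S, and the end points of any loop in S form a double point. -/
lemma IsUniqueDouble.isUniqueLoopIn {γ : ℝ → ℂ} {S : Set ℝ} {a b : ℝ} (h : IsUniqueDouble γ S a b)
    {L : Curve} (hl : L.left = a) (hr : L.right = b) (hL : ∀ x, L.toFun x = γ x) :
    IsUniqueLoopIn γ S L := by
  refine ⟨⟨hL, by rw [hl, hr, h.eq], ?_⟩, by rw [hl, hr]; exact h.subset, fun L' h' hS => ?_⟩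
  · rw [hl, hr]
    have key (x) (hx : x ∈ Ico a b) (y) (hy : y ∈ Ico a b) (hxy : x < y) : γ x ≠ γ y := by
      intro he
      have := h.unique x y hxy ((Icc_subset_Icc hx.1 hy.2.le).trans h.subset) he
      exact hy.2.ne this.2
    intro x hx y hy he
    rcases lt_trichotomy x y with hlt | rfl | hlt
    · exact absurd he (key x hx y hy hlt)
    · rfl
    · exact absurd he.symm (key y hy x hx hlt)
  · obtain ⟨h1, h2⟩ := h.unique _ _ L'.left_lt_right hS h'.closed
    exact Curve.ext_of_restriction (h1.trans hl.symm) (h2.trans hr.symm) h'.restriction hL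

lemma IsUniqueDouble.isUniqueLoopIn_arc {γ : ℝ → ℂ} {S : Set ℝ} {a b : ℝ}
    (h : IsUniqueDouble γ S a b) (hγ : ContinuousOn γ (Icc a b)) :
    IsUniqueLoopIn γ S (arc γ a b) :=
  h.isUniqueLoopIn (arc_left h.lt hγ) (arc_right h.lt hγ) (arc_toFun h.lt hγ)

/-- The first coordinate is injective in P², so the parameters of a double point are ±y with y > 0;
the second, being odd, then gives y³ = 3y. -/
lemma isUniqueDouble_limitCurve {a b : ℝ} (ha : a ≠ 0) (hb : b ≠ 0) :
    IsUniqueDouble (limitCurve a b) univ (-√3) √3 := by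
  have h3 : √3 ^ 2 = (3 : ℝ) := Real.sq_sqrt (by norm_num)
  have h0 : (0 : ℝ) < √3 := by positivity
  refine ⟨by linarith, ?_, subset_univ _, fun x y hxy _ he => ?_⟩
  · apply Complex.ext
    · simp [limitCurve]
    · simp only [limitCurve]
      have : √3 ^ 3 = 3 * √3 := by rw [pow_succ, h3]
      rw [neg_pow √3 3, this]; ring
  · have e1 := congrArg Complex.re he
    have e2 := congrArg Complex.im he
    simp only [limitCurve] at e1 e2
    have e3 := mul_left_cancel₀ ha e1
    have e4 := mul_left_cancel₀ hb e2
    have e5 : x = -y := by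
      have : (x - y) * (x + y) = 0 := by linarith [e3]
      rcases mul_eq_zero.1 this with h | h <;> linarith
    subst e5
    have hy : 0 < y := by linarith
    have e6 : y ^ 2 = 3 := by
      have : y * (y ^ 2 - 3) = 0 := by linarith [e4]
      rcases mul_eq_zero.1 this with h | h <;> linarith
    have : y = √3 := by rw [← e6, Real.sqrt_sq hy.le]
    exact ⟨by rw [this], this⟩

/-! ### The distance on curves and end points -/

/-- Reparametrisations may reverse orientation, so the test parameter is the preimage of an end
point of K rather than 0 or 1; the other homeomorphism cannot leave its interval there. -/
lemma Curve.abs_left_sub_left_le (K L : Curve) : |K.left - L.left| ≤ dist K L ∧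
    |K.right - L.right| ≤ dist K L := by
  have key (K L : Curve) (l : (I ≃ₜ Icc K.left K.right) × (I ≃ₜ Icc L.left L.right)) :
      L.left - K.left ≤ cost K L l ∧ K.right - L.right ≤ cost K L l := by
    have hc (t : I) : |(l.1 t : ℝ) - l.2 t| ≤ cost K L l :=
      ((param l.1 - param l.2).norm_coe_le_norm t).trans (le_add_of_nonneg_right (norm_nonneg _))
    constructor
    · have h := hc (l.1.symm ⟨K.left, left_mem_Icc.2 K.left_lt_right.le⟩)
      rw [l.1.apply_symm_apply] at h
      have h2 := (l.2 (l.1.symm ⟨K.left, left_mem_Icc.2 K.left_lt_right.le⟩)).2.1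
      have h3 := (abs_le.1 h).1
      simp only at h3; linarith
    · have h := hc (l.1.symm ⟨K.right, right_mem_Icc.2 K.left_lt_right.le⟩)
      rw [l.1.apply_symm_apply] at h
      have h2 := (l.2 (l.1.symm ⟨K.right, right_mem_Icc.2 K.left_lt_right.le⟩)).2.2
      have h3 := (abs_le.1 h).2
      simp only at h3; linarith
  have key2 (K L : Curve) : L.left - K.left ≤ dist K L ∧ K.right - L.right ≤ dist K L :=
    ⟨le_ciInf fun l => (key K L l).1, le_ciInf fun l => (key K L l).2⟩
  have h1 := key2 K L
  have h2 := key2 L K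
  rw [dist_comm L K] at h2
  exact ⟨abs_le.2 ⟨by linarith, by linarith⟩, abs_le.2 ⟨by linarith, by linarith⟩⟩

lemma Curve.continuous_left : Continuous Curve.left :=
  continuous_iff_continuousAt.2 fun K => tendsto_iff_dist_tendsto_zero.2 <|
    squeeze_zero (fun _ => dist_nonneg) (fun L => (abs_left_sub_left_le L K).1)
      (tendsto_iff_dist_tendsto_zero.1 tendsto_id)

lemma Curve.continuous_right : Continuous Curve.right :=
  continuous_iff_continuousAt.2 fun K => tendsto_iff_dist_tendsto_zero.2 <|
    squeeze_zero (fun _ => dist_nonneg) (fun L => (abs_left_sub_left_le L K).2)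
      (tendsto_iff_dist_tendsto_zero.1 tendsto_id)

/-! ### Continuous convergence of curves, their double points and loops -/

/-- The curves `γ i` converge continuously to the continuous curve `γ₀` along `l`. -/
structure ConvergesTo {ι : Type*} (γ : ι → ℝ → ℂ) (l : Filter ι) (γ₀ : ℝ → ℂ) : Prop where
  continuous : Continuous γ₀
  tendsto : ∀ x, Tendsto (fun z : ι × ℝ => γ z.1 z.2) (l ×ˢ 𝓝 x) (𝓝 (γ₀ x))

lemma ConvergesTo.comp {ι : Type*} {γ : ι → ℝ → ℂ} {l : Filter ι} {γ₀ : ℝ → ℂ}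
    (h : ConvergesTo γ l γ₀) {κ : Type*} {m : Filter κ} {u : κ → ι} (hu : Tendsto u m l)
    {v : κ → ℝ} {x : ℝ} (hv : Tendsto v m (𝓝 x)) :
    Tendsto (fun k => γ (u k) (v k)) m (𝓝 (γ₀ x)) :=
  (h.tendsto x).comp (hu.prodMk hv)

/-- Every cluster point of the double points is a double point of the limit in K, hence is `x₀`, and
compactness of K does the rest. In applications K avoids the diagonal, since trivial pairs would
violate `hx₀`. -/
lemma ConvergesTo.tendsto_double {ι : Type*} {γ : ι → ℝ → ℂ} {l : Filter ι} {γ₀ : ℝ → ℂ}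
    (h : ConvergesTo γ l γ₀) {K : Set (ℝ × ℝ)} (hK : IsCompact K) {x : ι → ℝ × ℝ}
    (hx : ∀ᶠ i in l, x i ∈ K ∧ γ i (x i).1 = γ i (x i).2) {x₀ : ℝ × ℝ}
    (hx₀ : ∀ y ∈ K, γ₀ y.1 = γ₀ y.2 → y = x₀) : Tendsto x l (𝓝 x₀) := by
  refine hK.tendsto_nhds_of_unique_mapClusterPt (hx.mono fun _ => And.left) fun y hy hc => ?_
  obtain ⟨U, hU, hUy⟩ := mapClusterPt_iff_ultrafilter.1 hc
  refine hx₀ y hy ?_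
  have h1 := h.comp hU ((continuous_fst.tendsto y).comp hUy)
  have h2 := h.comp hU ((continuous_snd.tendsto y).comp hUy)
  refine tendsto_nhds_unique (h1.congr' ?_) h2
  filter_upwards [hU hx] with i hi using hi.2

/-- Affine parametrisations bound the distance; on the compact unit interval continuous convergence
is uniform convergence. -/
lemma ConvergesTo.tendsto_curve {ι : Type*} {γ : ι → ℝ → ℂ} {l : Filter ι} {γ₀ : ℝ → ℂ}
    (h : ConvergesTo γ l γ₀) {L : ι → Curve} {L₀ : Curve}
    (hL : ∀ᶠ i in l, ∀ x, (L i).toFun x = γ i x) (hL₀ : ∀ x, L₀.toFun x = γ₀ x)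
    (hl : Tendsto (fun i => (L i).left) l (𝓝 L₀.left))
    (hr : Tendsto (fun i => (L i).right) l (𝓝 L₀.right)) : Tendsto L l (𝓝 L₀) := by
  set e : (K : Curve) → (I ≃ₜ Icc K.left K.right) := fun K =>
    (iccHomeoI K.left K.right K.left_lt_right).symm with he
  have hval (K : Curve) (t : I) : (e K t : ℝ) = (K.right - K.left) * t + K.left := by
    simp [he]
  have hpar (t : I) : Tendsto (fun z : ι × I => (e (L z.1) z.2 : ℝ)) (l ×ˢ 𝓝 t) (𝓝 (e L₀ t)) := by
    simp only [hval]
    have h1 := hl.comp (tendsto_fst (f := l) (g := 𝓝 t))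
    have h2 := hr.comp (tendsto_fst (f := l) (g := 𝓝 t))
    have h3 : Tendsto (fun z : ι × I => (z.2 : ℝ)) (l ×ˢ 𝓝 t) (𝓝 t) :=
      (continuous_subtype_val.tendsto t).comp tendsto_snd
    exact ((h2.sub h1).mul h3).add h1
  have hpar₀ (t : I) : Tendsto (fun z : ι × I => (e L₀ z.2 : ℝ)) (l ×ˢ 𝓝 t) (𝓝 (e L₀ t)) :=
    ((continuous_subtype_val.comp (e L₀).continuous).tendsto t).comp tendsto_snd
  have t1 : Tendsto (fun i => Curve.param (e (L i))) l (𝓝 (Curve.param (e L₀))) := by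
    rw [ContinuousMap.tendsto_iff_tendstoLocallyUniformly,
      tendstoLocallyUniformly_iff_forall_tendsto]
    exact fun t => (((hpar₀ t).prodMk_nhds (hpar t)).mono_right (nhds_le_uniformity _))
  have t2 : Tendsto (fun i => (L i).reparam (e (L i))) l (𝓝 (L₀.reparam (e L₀))) := by
    rw [ContinuousMap.tendsto_iff_tendstoLocallyUniformly,
      tendstoLocallyUniformly_iff_forall_tendsto]
    intro t
    have h1 : Tendsto (fun z : ι × I => γ z.1 (e (L z.1) z.2)) (l ×ˢ 𝓝 t) (𝓝 (γ₀ (e L₀ t))) :=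
      h.comp tendsto_fst (hpar t)
    have h2 : Tendsto (fun z : ι × I => γ₀ (e L₀ z.2)) (l ×ˢ 𝓝 t) (𝓝 (γ₀ (e L₀ t))) :=
      (h.continuous.tendsto _).comp (hpar₀ t)
    refine ((h2.prodMk_nhds h1).mono_right (nhds_le_uniformity _)).congr' ?_
    filter_upwards [tendsto_fst.eventually hL] with z hz
    simp [Curve.reparam, hz, hL₀]
  rw [tendsto_iff_dist_tendsto_zero]
  refine squeeze_zero (fun _ => dist_nonneg) (fun i => Curve.d_le (L i) L₀ (e (L i), e L₀)) ?_
  have s1 := tendsto_iff_norm_sub_tendsto_zero.1 t1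
  have s2 := tendsto_iff_norm_sub_tendsto_zero.1 t2
  simpa [Curve.cost] using s1.add s2

end CongaLoop

namespace CongaLoop

/-! ### Perturbations of the curve `P ↦ (P² / 2, (P³ - 3 P) / 6)` -/

/-- On `[-2, 2]`, the curve `(x, y)` is Lipschitz close to `P ↦ (P² / 2, (P³ - 3 P) / 6)`, up to
translation. -/
structure NearModel (x y : ℝ → ℝ) : Prop where
  fst : ∀ a b, -2 ≤ a → a ≤ b → b ≤ 2 → |x b - x a - (b ^ 2 - a ^ 2) / 2| ≤ (b - a) / 100
  snd : ∀ a b, -2 ≤ a → a ≤ b → b ≤ 2 →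
    |y b - y a - ((b ^ 3 - 3 * b) - (a ^ 3 - 3 * a)) / 6| ≤ (b - a) / 100

namespace NearModel

variable {x y : ℝ → ℝ}

/-- Dividing both coordinate identities by b - a leaves |a + b| ≤ 1/50 and |a² + ab + b² - 3| ≤
0.06. With s = a + b the quadratic form is s² - sb + b², so b is close to √3 and a to -√3. -/
lemma localization (h : NearModel x y) {a b : ℝ} (ha : -2 ≤ a) (hab : a < b) (hb : b ≤ 2)
    (hx : x a = x b) (hy : y a = y b) : a ∈ Icc (-1.8) (-1.6) ∧ b ∈ Icc 1.6 1.8 := by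
  have h1 := abs_le.1 (h.fst a b ha hab.le hb)
  have h2 := abs_le.1 (h.snd a b ha hab.le hb)
  rw [hx, sub_self, zero_sub] at h1
  rw [hy, sub_self, zero_sub] at h2
  have hd : 0 < b - a := by linarith
  obtain ⟨s, rfl⟩ : ∃ s, a = s - b := ⟨a + b, by ring⟩
  have s1 : s ≤ 1 / 50 := by
    by_contra hc; push Not at hc
    nlinarith [mul_pos hd (sub_pos.2 hc)]
  have s2 : -(1 / 50) ≤ s := by
    by_contra hc; push Not at hc
    nlinarith [mul_pos hd (sub_pos.2 hc)]
  have q1 : s ^ 2 - s * b + b ^ 2 ≤ 3 + 0.06 := by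
    by_contra hc; push Not at hc
    nlinarith [mul_pos hd (sub_pos.2 hc)]
  have q2 : 3 - 0.06 ≤ s ^ 2 - s * b + b ^ 2 := by
    by_contra hc; push Not at hc
    nlinarith [mul_pos hd (sub_pos.2 hc)]
  have b0 : -0.01 < b := by linarith
  have b1 : 1.7 ≤ b := by nlinarith
  have b2 : b ≤ 1.78 := by nlinarith
  exact ⟨⟨by linarith, by linarith⟩, by linarith, by linarith⟩

lemma fst_lt_right (h : NearModel x y) {a b : ℝ} (ha : 1.5 ≤ a) (hab : a < b) (hb : b ≤ 2) :
    x a < x b := by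
  have h1 := abs_le.1 (h.fst a b (by linarith) hab.le hb)
  nlinarith

lemma fst_lt_left (h : NearModel x y) {a b : ℝ} (ha : -2 ≤ a) (hab : a < b) (hb : b ≤ -1.5) :
    x b < x a := by
  have h1 := abs_le.1 (h.fst a b ha hab.le (by linarith))
  nlinarith

/-- The model's second coordinate has difference quotient (a² + ab + b² - 3)/6 ≥ 1/6, well above the
error 1/100. -/
lemma snd_lt (h : NearModel x y) {a b : ℝ} (ha : -2 ≤ a) (hab : a < b) (hb : b ≤ 2)
    (hq : 4 ≤ a ^ 2 + a * b + b ^ 2) : y a < y b := by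
  have h1 := abs_le.1 (h.snd a b ha hab.le hb)
  nlinarith [mul_le_mul_of_nonneg_left hq (sub_pos.2 hab).le]

lemma snd_lt_right (h : NearModel x y) {a b : ℝ} (ha : 1.5 ≤ a) (hab : a < b) (hb : b ≤ 2) :
    y a < y b :=
  h.snd_lt (by linarith) hab hb (by nlinarith)

lemma snd_lt_left (h : NearModel x y) {a b : ℝ} (ha : -2 ≤ a) (hab : a < b) (hb : b ≤ -1.5) :
    y a < y b :=
  h.snd_lt ha hab (by linarith) (by nlinarith)

/-- Along the right arm x and y both increase; along the left arm x decreases while y increases.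
Moving b to the right raises both coordinates of the common point, and a cannot follow. -/
lemma eq_of_double (h : NearModel x y) {a b a' b' : ℝ} (ha : -2 ≤ a) (hab : a < b) (hb : b ≤ 2)
    (hx : x a = x b) (hy : y a = y b) (ha' : -2 ≤ a') (hab' : a' < b') (hb' : b' ≤ 2)
    (hx' : x a' = x b') (hy' : y a' = y b') : a' = a ∧ b' = b := by
  wlog hle : b ≤ b' generalizing a b a' b'
  · obtain ⟨h1, h2⟩ := this ha' hab' hb' hx' hy' ha hab hb hx hy (by linarith)
    exact ⟨h1.symm, h2.symm⟩
  obtain ⟨⟨l1, l2⟩, l3, l4⟩ := h.localization ha hab hb hx hy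
  obtain ⟨⟨l1', l2'⟩, l3', l4'⟩ := h.localization ha' hab' hb' hx' hy'
  rcases hle.lt_or_eq with hlt | rfl
  · have i1 := h.fst_lt_right (by linarith) hlt (by linarith)
    have i2 := h.snd_lt_right (by linarith) hlt (by linarith)
    rcases lt_trichotomy a a' with hc | rfl | hc
    · have := h.fst_lt_left (by linarith) hc (by linarith); linarith
    · linarith
    · have := h.snd_lt_left (by linarith) hc (by linarith); linarith
  · refine ⟨?_, rfl⟩
    rcases lt_trichotomy a a' with hc | rfl | hc
    · have := h.fst_lt_left (by linarith) hc (by linarith); linarith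
    · rfl
    · have := h.fst_lt_left (by linarith) hc (by linarith); linarith

lemma continuousOn (h : NearModel x y) : ContinuousOn x (Icc (-2) 2) ∧
    ContinuousOn y (Icc (-2) 2) := by
  have key (z : ℝ → ℝ) (hz : ∀ a b, -2 ≤ a → a ≤ b → b ≤ 2 → |z b - z a| ≤ 4 * (b - a)) :
      ContinuousOn z (Icc (-2) 2) := by
    refine (LipschitzOnWith.of_dist_le_mul (K := 4) fun a ha b hb => ?_).continuousOn
    rw [Real.dist_eq, Real.dist_eq]
    rcases le_total a b with hab | hab
    · rw [abs_sub_comm, abs_sub_comm a b, abs_of_nonneg (sub_nonneg.2 hab)]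
      exact hz a b ha.1 hab hb.2
    · rw [abs_of_nonneg (sub_nonneg.2 hab)]
      exact hz b a hb.1 hab ha.2
  constructor <;> refine key _ fun a b ha hab hb => ?_
  · have h1 := abs_le.1 (h.fst a b ha hab hb)
    have e : (b ^ 2 - a ^ 2) / 2 = (b - a) * ((a + b) / 2) := by ring
    rw [e] at h1
    have : (b - a) * ((a + b) / 2) ≤ (b - a) * 2 := by
      apply mul_le_mul_of_nonneg_left <;> linarith
    have : (b - a) * (-2) ≤ (b - a) * ((a + b) / 2) := by
      apply mul_le_mul_of_nonneg_left <;> linarith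
    exact abs_le.2 ⟨by linarith, by linarith⟩
  · have h1 := abs_le.1 (h.snd a b ha hab hb)
    have e : ((b ^ 3 - 3 * b) - (a ^ 3 - 3 * a)) / 6 =
      (b - a) * ((a ^ 2 + a * b + b ^ 2 - 3) / 6) := by ring
    rw [e] at h1
    have : (b - a) * ((a ^ 2 + a * b + b ^ 2 - 3) / 6) ≤ (b - a) * 2 := by
      apply mul_le_mul_of_nonneg_left <;> nlinarith
    have : (b - a) * (-2) ≤ (b - a) * ((a ^ 2 + a * b + b ^ 2 - 3) / 6) := by
      apply mul_le_mul_of_nonneg_left <;> nlinarith [sq_nonneg (a + b), sq_nonneg a, sq_nonneg b]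
    exact abs_le.2 ⟨by linarith, by linarith⟩

/-- Two applications of the intermediate value theorem: `ρ b` is the point of the left arm at the
same x as b, and then y(b) - y(ρ b) changes sign, since 1.6 < √3 < 1.9. -/
lemma exists_double (h : NearModel x y) : ∃ a b, a ∈ Icc (-1.8 : ℝ) (-1.6) ∧ b ∈ Icc (1.6 : ℝ) 1.8 ∧
    x a = x b ∧ y a = y b := by
  have hpart (b : ℝ) (hb : b ∈ Icc (1.6 : ℝ) 1.9) : ∃ a ∈ Icc (-1.95 : ℝ) (-1.55), x a = x b := by
    have h1 := abs_le.1 (h.fst (-1.95) b (by norm_num) (by linarith [hb.1]) (by linarith [hb.2]))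
    have h2 := abs_le.1 (h.fst (-1.55) b (by norm_num) (by linarith [hb.1]) (by linarith [hb.2]))
    refine intermediate_value_Icc' (by norm_num) (h.continuousOn.1.mono
      (Icc_subset_Icc (by norm_num) (by norm_num))) ⟨?_, ?_⟩
    · nlinarith [hb.1, hb.2]
    · nlinarith [hb.1, hb.2]
  choose! ρ hρ hxρ using hpart
  -- On the right arm the slope of x is at most 1.91, on the left at least 1.54 in absolute value,
  -- so the ratio is below 2. This makes the chosen `ρ` continuous.
  have hlip (b c : ℝ) (hb : b ∈ Icc (1.6 : ℝ) 1.9) (hc : c ∈ Icc (1.6 : ℝ) 1.9) (hbc : b ≤ c) :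
      |ρ b - ρ c| ≤ 2 * (c - b) := by
    have h1 := abs_le.1 (h.fst b c (by linarith [hb.1]) hbc (by linarith [hc.2]))
    have e1 : (c ^ 2 - b ^ 2) / 2 ≤ 1.9 * (c - b) := by nlinarith [hb.1, hb.2, hc.1, hc.2]
    have e2 : 0 ≤ (c ^ 2 - b ^ 2) / 2 - (c - b) / 100 := by nlinarith [hb.1, hb.2, hc.1, hc.2]
    have hb' := hρ b hb
    have hc' := hρ c hc
    rw [← hxρ b hb, ← hxρ c hc] at h1
    rcases le_total (ρ b) (ρ c) with hle | hle
    · have h2 := abs_le.1 (h.fst (ρ b) (ρ c) (by linarith [hb'.1]) hle (by linarith [hc'.2]))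
      have : (ρ c ^ 2 - ρ b ^ 2) / 2 ≤ -1.55 * (ρ c - ρ b) := by nlinarith [hb'.2, hc'.2]
      rw [abs_sub_comm, abs_of_nonneg (by linarith)]
      linarith
    · have h2 := abs_le.1 (h.fst (ρ c) (ρ b) (by linarith [hc'.1]) hle (by linarith [hb'.2]))
      have : (ρ b ^ 2 - ρ c ^ 2) / 2 ≤ -1.55 * (ρ b - ρ c) := by nlinarith [hb'.2, hc'.2]
      rw [abs_of_nonneg (by linarith)]
      linarith
  have hρc : ContinuousOn ρ (Icc (1.6 : ℝ) 1.9) := by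
    refine (LipschitzOnWith.of_dist_le_mul (K := 2) fun b hb c hc => ?_).continuousOn
    rw [Real.dist_eq, Real.dist_eq]
    rcases le_total b c with hbc | hbc
    · rw [abs_sub_comm b c, abs_of_nonneg (sub_nonneg.2 hbc)]
      exact hlip b c hb hc hbc
    · rw [abs_sub_comm, abs_of_nonneg (sub_nonneg.2 hbc)]
      exact hlip c b hc hb hbc
  have hΦ : ContinuousOn (fun b => y b - y (ρ b)) (Icc (1.6 : ℝ) 1.9) :=
    (h.continuousOn.2.mono (Icc_subset_Icc (by norm_num) (by norm_num))).sub
      (h.continuousOn.2.comp hρc fun b hb =>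
        ⟨by linarith [(hρ b hb).1], by linarith [(hρ b hb).2]⟩)
  have hest (b : ℝ) (hb : b ∈ Icc (1.6 : ℝ) 1.9) : |ρ b + b| ≤ 1 / 50 ∧
      |y b - y (ρ b) - (b - ρ b) * ((ρ b ^ 2 + ρ b * b + b ^ 2 - 3) / 6)| ≤ (b - ρ b) / 100 := by
    have hb' := hρ b hb
    have h1 := abs_le.1 (h.fst (ρ b) b (by linarith [hb'.1]) (by linarith [hb.1, hb'.2])
      (by linarith [hb.2]))
    have h2 := h.snd (ρ b) b (by linarith [hb'.1]) (by linarith [hb.1, hb'.2]) (by linarith [hb.2])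
    rw [hxρ b hb, sub_self, zero_sub] at h1
    have hd : 0 < b - ρ b := by linarith [hb.1, hb'.2]
    refine ⟨abs_le.2 ⟨?_, ?_⟩, by convert h2 using 3; ring⟩
    · by_contra hc; push Not at hc
      nlinarith [mul_pos hd (sub_pos.2 hc)]
    · by_contra hc; push Not at hc
      nlinarith [mul_pos hd (sub_pos.2 hc)]
  have hlo : y 1.6 - y (ρ 1.6) ≤ 0 := by
    have hb : (1.6 : ℝ) ∈ Icc (1.6 : ℝ) 1.9 := by norm_num
    obtain ⟨h1, h2⟩ := hest _ hb
    obtain ⟨h1, h1'⟩ := abs_le.1 h1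
    have h2 := (abs_le.1 h2).2
    have hq : (ρ 1.6 ^ 2 + ρ 1.6 * 1.6 + 1.6 ^ 2 - 3) / 6 ≤ -(1 / 100) := by nlinarith
    have := mul_le_mul_of_nonneg_left hq (by linarith [(hρ _ hb).2] : 0 ≤ 1.6 - ρ 1.6)
    linarith
  have hhi : 0 ≤ y 1.9 - y (ρ 1.9) := by
    have hb : (1.9 : ℝ) ∈ Icc (1.6 : ℝ) 1.9 := by norm_num
    obtain ⟨h1, h2⟩ := hest _ hb
    obtain ⟨h1, h1'⟩ := abs_le.1 h1
    have h2 := (abs_le.1 h2).1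
    have hq : 1 / 100 ≤ (ρ 1.9 ^ 2 + ρ 1.9 * 1.9 + 1.9 ^ 2 - 3) / 6 := by nlinarith
    have := mul_le_mul_of_nonneg_left hq (by linarith [(hρ _ hb).2] : 0 ≤ 1.9 - ρ 1.9)
    linarith
  obtain ⟨b, hb, hb0⟩ := intermediate_value_Icc (by norm_num) hΦ ⟨hlo, hhi⟩
  have hb' := hρ b hb
  have hy : y (ρ b) = y b := by simp only at hb0; linarith
  obtain ⟨l1, l2⟩ := h.localization (by linarith [hb'.1]) (by linarith [hb.1, hb'.2])
    (by linarith [hb.2]) (hxρ b hb) hy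
  exact ⟨ρ b, b, l1, l2, hxρ b hb, hy⟩

end NearModel

end CongaLoop

namespace CongaLoop

/-! ### Parabolic Taylor estimates -/

lemma hasDerivAt_jet_space {w : ℝ → ℝ} (hw : Tempered w) {j : ℕ} (hj : j < 3) (p : ℝ) {τ : ℝ}
    (hτ : 0 < τ) : HasDerivAt (fun p => jet w j p τ) (jet w (j + 1) p τ) p := by
  have h := (hasFDerivAt_jet hw hj p hτ).comp_hasDerivAt p
    ((hasDerivAt_id p).prodMk (hasDerivAt_const p τ))
  exact h.congr_deriv (by simp)

lemma hasDerivAt_jet_time {w : ℝ → ℝ} (hw : Tempered w) {j : ℕ} (hj : j < 3) (p : ℝ) {τ : ℝ}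
    (hτ : 0 < τ) : HasDerivAt (fun τ => jet w j p τ) (2⁻¹ * jet w (j + 2) p τ) τ := by
  have h := (hasFDerivAt_jet hw hj p hτ).comp_hasDerivAt τ
    ((hasDerivAt_const τ p).prodMk (hasDerivAt_id τ))
  exact h.congr_deriv (by simp)

lemma hasDerivAt_jet_rescaled {w : ℝ → ℝ} (hw : Tempered w) {j : ℕ} (hj : j < 3) (p ε P : ℝ) {τ : ℝ}
    (hτ : 0 < τ) :
    HasDerivAt (fun P => jet w j (p + ε * P) τ) (ε * jet w (j + 1) (p + ε * P) τ) P := by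
  have h1 : HasDerivAt (fun P => p + ε * P) (ε * 1) P := ((hasDerivAt_id P).const_mul ε).const_add p
  rw [mul_one] at h1
  rw [mul_comm]
  exact (hasDerivAt_jet_space hw hj (p + ε * P) hτ).comp P h1

/-- A property of all small nonnegative numbers. -/
lemma exists_forall_lt_of_eventually {q : ℝ → Prop} (h : ∀ᶠ ε in 𝓝[≥] 0, q ε) :
    ∃ ε₀ > 0, ∀ ε, 0 ≤ ε → ε < ε₀ → q ε := by
  obtain ⟨ε₀, h0, h1⟩ := mem_nhdsGE_iff_exists_Ico_subset.1 h
  exact ⟨ε₀, h0, fun ε e0 e1 => h1 ⟨e0, e1⟩⟩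

/-- Time moves by ε² only, so to first order in ε it does not contribute. Including ε = 0 in the
filter lets the estimate be used later at ε = √(τ - t) up to t = τ. -/
lemma parabolic_first_order {g : ℝ × ℝ → ℝ} {p τ α β : ℝ}
    (hg : HasFDerivAt g (α • ContinuousLinearMap.fst ℝ ℝ ℝ + β • ContinuousLinearMap.snd ℝ ℝ ℝ)
      (p, τ)) {R η : ℝ} (hR : 0 ≤ R) (hη : 0 < η) :
    ∀ᶠ ε in 𝓝[≥] (0 : ℝ), ∀ P, |P| ≤ R →
      |g (p + ε * P, τ - ε ^ 2) - g (p, τ) - α * (ε * P)| ≤ η * ε := by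
  -- Half of η pays for the differentiability error, the displacement being at most ε(R + 1) once ε
  -- < 1; the other half pays for the time term β ε².
  have hc : 0 < η / (2 * (R + 1)) := by positivity
  have h1 := (hg.isLittleO.def hc)
  obtain ⟨r, hr, h1⟩ := Metric.eventually_nhds_iff.1 h1
  have e1 : ∀ᶠ ε in 𝓝[≥] (0 : ℝ), ε * (R + 1) < r := by
    have : Tendsto (fun ε : ℝ => ε * (R + 1)) (𝓝[≥] 0) (𝓝 (0 * (R + 1))) :=
      ((continuous_id.mul continuous_const).tendsto 0).mono_left nhdsWithin_le_nhds
    rw [zero_mul] at this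
    exact this.eventually_lt_const hr
  have e2 : ∀ᶠ ε in 𝓝[≥] (0 : ℝ), |β| * ε < η / 2 := by
    have : Tendsto (fun ε : ℝ => |β| * ε) (𝓝[≥] 0) (𝓝 (|β| * 0)) :=
      ((continuous_const.mul continuous_id).tendsto 0).mono_left nhdsWithin_le_nhds
    rw [mul_zero] at this
    exact this.eventually_lt_const (by positivity)
  have e3 : ∀ᶠ ε in 𝓝[≥] (0 : ℝ), ε < 1 :=
    (tendsto_id.mono_left nhdsWithin_le_nhds : Tendsto id (𝓝[≥] (0 : ℝ)) (𝓝 0)).eventually_lt_const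
      one_pos
  filter_upwards [e1, e2, e3, self_mem_nhdsWithin] with ε h2 h3 h4 h5 P hP
  replace h5 : 0 ≤ ε := h5
  have hn : ‖(p + ε * P, τ - ε ^ 2) - (p, τ)‖ ≤ ε * (R + 1) := by
    rw [Prod.mk_sub_mk, add_sub_cancel_left, sub_sub_cancel_left]
    refine max_le ?_ ?_
    · rw [Real.norm_eq_abs, abs_mul, abs_of_nonneg h5]; gcongr; linarith
    · rw [norm_neg, Real.norm_eq_abs, abs_of_nonneg (by positivity), sq]; gcongr; linarith
  have h6 := h1 (y := (p + ε * P, τ - ε ^ 2)) (by rw [dist_eq_norm]; linarith)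
  have h7 : η / (2 * (R + 1)) * ‖(p + ε * P, τ - ε ^ 2) - (p, τ)‖ ≤ η / 2 * ε := by
    calc _ ≤ η / (2 * (R + 1)) * (ε * (R + 1)) := by gcongr
      _ = _ := by field_simp
  have h8 := abs_le.1 ((Real.norm_eq_abs _ ▸ h6).trans h7)
  simp at h8
  have h9 : |β * ε ^ 2| ≤ η / 2 * ε := by
    rw [abs_mul, abs_of_nonneg (by positivity : 0 ≤ ε ^ 2), sq, ← mul_assoc]; gcongr
  have h10 := abs_le.1 h9
  exact abs_le.2 ⟨by linarith, by linarith⟩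

lemma parabolic_time {w : ℝ → ℝ} (hw : Tempered w) {j : ℕ} (hj : j < 3) (p : ℝ) {τ η : ℝ}
    (hτ : 0 < τ) (hη : 0 < η) : ∀ᶠ ε in 𝓝[≥] (0 : ℝ),
      |jet w j p (τ - ε ^ 2) - jet w j p τ + 2⁻¹ * jet w (j + 2) p τ * ε ^ 2| ≤ η * ε ^ 2 := by
  have h1 := (hasDerivAt_jet_time hw hj p hτ).isLittleO.def hη
  have h2 : Tendsto (fun ε : ℝ => τ - ε ^ 2) (𝓝[≥] 0) (𝓝 τ) := by
    have : Continuous fun ε : ℝ => τ - ε ^ 2 := by fun_prop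
    simpa using (this.tendsto 0).mono_left nhdsWithin_le_nhds
  filter_upwards [h2.eventually h1] with ε h3
  simp only [sub_sub_cancel_left, Real.norm_eq_abs, abs_neg, smul_eq_mul,
    abs_of_nonneg (sq_nonneg ε)] at h3
  refine le_trans (le_of_eq ?_) h3
  congr 1; ring

lemma abs_sub_le_of_deriv_le {k k' : ℝ → ℝ} {R C : ℝ}
    (hk : ∀ P, |P| ≤ R → HasDerivAt k (k' P) P) (hC : ∀ P, |P| ≤ R → |k' P| ≤ C) {a b : ℝ}
    (ha : |a| ≤ R) (hb : |b| ≤ R) : |k b - k a| ≤ C * |b - a| :=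
  (convex_Icc (-R) R).norm_image_sub_le_of_norm_hasDerivWithin_le
    (fun P hP => (hk P (abs_le.2 hP)).hasDerivWithinAt) (fun P hP => hC P (abs_le.2 hP))
    (abs_le.1 ha) (abs_le.1 hb)

lemma eventually_sq_lt {τ : ℝ} (hτ : 0 < τ) : ∀ᶠ ε in 𝓝[≥] (0 : ℝ), 0 < τ - ε ^ 2 := by
  have : Continuous fun ε : ℝ => τ - ε ^ 2 := by fun_prop
  have h : Tendsto (fun ε : ℝ => τ - ε ^ 2) (𝓝[≥] 0) (𝓝 τ) := by
    simpa using (this.tendsto 0).mono_left nhdsWithin_le_nhds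
  exact h.eventually_const_lt hτ

lemma parabolic_first_order_jet {w : ℝ → ℝ} (hw : Tempered w) {j : ℕ} (hj : j < 3) {p τ : ℝ}
    (hτ : 0 < τ) (h0 : jet w j p τ = 0) {R η : ℝ} (hR : 0 ≤ R) (hη : 0 < η) :
    ∀ᶠ ε in 𝓝[≥] (0 : ℝ), ∀ P, |P| ≤ R →
      |jet w j (p + ε * P) (τ - ε ^ 2) - jet w (j + 1) p τ * (ε * P)| ≤ η * ε := by
  simpa [h0] using parabolic_first_order (hasFDerivAt_jet hw hj p hτ) hR hη

/-- Integrating the first-order estimate of the next jet in P gives the P² term; the heat equation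
at P = 0 gives the -1. -/
lemma parabolic_second_order_jet {w : ℝ → ℝ} (hw : Tempered w) {j : ℕ} (hj : j + 1 < 3) {p τ : ℝ}
    (hτ : 0 < τ) (h0 : jet w (j + 1) p τ = 0) {R η : ℝ} (hR : 0 ≤ R) (hη : 0 < η) :
    ∀ᶠ ε in 𝓝[≥] (0 : ℝ), ∀ P, |P| ≤ R →
      |jet w j (p + ε * P) (τ - ε ^ 2) - jet w j p τ -
        2⁻¹ * jet w (j + 2) p τ * ε ^ 2 * (P ^ 2 - 1)| ≤ η * ε ^ 2 := by
  -- The error budget: integration over |P| ≤ R costs R shares, the time step one more.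
  have hη' : 0 < η / (R + 1) := by positivity
  filter_upwards [parabolic_first_order_jet hw hj hτ h0 hR hη',
    parabolic_time hw (by omega : j < 3) p hτ hη', eventually_sq_lt hτ, self_mem_nhdsWithin]
    with ε h1 h2 h3 h4 P hP
  replace h4 : 0 ≤ ε := h4
  set A := jet w (j + 2) p τ
  have h5 := abs_sub_le_of_deriv_le (R := R) (C := η / (R + 1) * ε ^ 2)
    (k := fun P => jet w j (p + ε * P) (τ - ε ^ 2) - 2⁻¹ * A * ε ^ 2 * P ^ 2)
    (k' := fun P => ε * jet w (j + 1) (p + ε * P) (τ - ε ^ 2) - 2⁻¹ * A * ε ^ 2 * (2 * P))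
    (fun P _ => (hasDerivAt_jet_rescaled hw (by omega) p ε P h3).sub (by
      simpa using ((hasDerivAt_id P).pow 2).const_mul (2⁻¹ * A * ε ^ 2)))
    (fun P hP => by
      have e : ε * jet w (j + 1) (p + ε * P) (τ - ε ^ 2) - 2⁻¹ * A * ε ^ 2 * (2 * P) =
        ε * (jet w (j + 1) (p + ε * P) (τ - ε ^ 2) - A * (ε * P)) := by ring
      rw [e, abs_mul, abs_of_nonneg h4]
      calc _ ≤ ε * (η / (R + 1) * ε) := by gcongr; exact h1 P hP
        _ = _ := by ring) (a := 0) (b := P) (by simpa using hR) hP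
  have h6 : η / (R + 1) * ε ^ 2 * |P - 0| ≤ η / (R + 1) * ε ^ 2 * R := by
    rw [sub_zero]; gcongr
  have h7 : η / (R + 1) * ε ^ 2 * R + η / (R + 1) * ε ^ 2 = η * ε ^ 2 := by field_simp
  have h8 := abs_le.1 (h5.trans h6)
  have h9 := abs_le.1 h2
  simp only [mul_zero, add_zero] at h8
  exact abs_le.2 ⟨by linarith, by linarith⟩

/-- The second-order estimate of the first jet is integrated in P. The value at P = 0 contributes
only o(ε³), since the time derivative is half the second jet, which vanishes at (p, τ). -/
lemma parabolic_third_order_jet {w : ℝ → ℝ} (hw : Tempered w) {p τ : ℝ} (hτ : 0 < τ)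
    (h0 : jet w 1 p τ = 0) (h0' : jet w 2 p τ = 0) {R η : ℝ} (hR : 0 ≤ R) (hη : 0 < η) :
    ∀ᶠ ε in 𝓝[≥] (0 : ℝ), ∀ P, |P| ≤ R →
      |jet w 0 (p + ε * P) (τ - ε ^ 2) - jet w 0 p τ -
        jet w 3 p τ * ε ^ 3 * ((P ^ 3 - 3 * P) / 6)| ≤ η * ε ^ 3 := by
  have hη' : 0 < η / (R + 1) := by positivity
  -- The bound on the second jet is needed at all scales up to ε at once, because the time interval
  -- below meets every √(τ - t) ≤ ε.
  obtain ⟨ε₀, hε₀, hsmall⟩ := exists_forall_lt_of_eventually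
    (parabolic_first_order_jet hw (by norm_num : 2 < 3) hτ h0' le_rfl hη')
  have hlt : ∀ᶠ ε in 𝓝[≥] (0 : ℝ), ε < ε₀ :=
    (tendsto_id.mono_left nhdsWithin_le_nhds : Tendsto id (𝓝[≥] (0 : ℝ)) (𝓝 0)).eventually_lt_const
      hε₀
  filter_upwards [parabolic_second_order_jet hw (by norm_num : 1 + 1 < 3) hτ h0' hR hη',
    hlt, eventually_sq_lt hτ, self_mem_nhdsWithin] with ε h1 h2 h3 h4 P hP
  replace h4 : 0 ≤ ε := h4
  rw [h0] at h1
  set A := jet w 3 p τ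
  have h5 := abs_sub_le_of_deriv_le (R := R) (C := η / (R + 1) * ε ^ 3)
    (k := fun P => jet w 0 (p + ε * P) (τ - ε ^ 2) - A * ε ^ 3 * ((P ^ 3 - 3 * P) / 6))
    (k' := fun P => ε * jet w 1 (p + ε * P) (τ - ε ^ 2) - A * ε ^ 3 * ((3 * P ^ 2 - 3) / 6))
    (fun P _ => (hasDerivAt_jet_rescaled hw (by omega) p ε P h3).sub (by
      simpa using ((((hasDerivAt_id P).pow 3).sub
        ((hasDerivAt_id P).const_mul 3)).div_const 6).const_mul (A * ε ^ 3)))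
    (fun P hP => by
      have e : ε * jet w 1 (p + ε * P) (τ - ε ^ 2) - A * ε ^ 3 * ((3 * P ^ 2 - 3) / 6) =
        ε * (jet w 1 (p + ε * P) (τ - ε ^ 2) - 0 - 2⁻¹ * A * ε ^ 2 * (P ^ 2 - 1)) := by ring
      rw [e, abs_mul, abs_of_nonneg h4]
      calc _ ≤ ε * (η / (R + 1) * ε ^ 2) := by gcongr; exact h1 P hP
        _ = _ := by ring) (a := 0) (b := P) (by simpa using hR) hP
  have h6 : η / (R + 1) * ε ^ 3 * |P - 0| ≤ η / (R + 1) * ε ^ 3 * R := by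
    rw [sub_zero]; gcongr
  have h7 : η / (R + 1) * ε ^ 3 * R + η / (R + 1) * ε ^ 3 = η * ε ^ 3 := by field_simp
  have h8 := abs_le.1 (h5.trans h6)
  have h9 : |jet w 0 p (τ - ε ^ 2) - jet w 0 p τ| ≤ η / (R + 1) * ε ^ 3 := by
    have key := (convex_Icc (τ - ε ^ 2) τ).norm_image_sub_le_of_norm_hasDerivWithin_le
      (f := fun t => jet w 0 p t) (f' := fun t => 2⁻¹ * jet w 2 p t) (C := η / (R + 1) * ε)
      (fun t ht => (hasDerivAt_jet_time hw (by norm_num) p (by linarith [ht.1])).hasDerivWithinAt)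
      (fun t ht => by
        have ht0 : 0 ≤ τ - t := by linarith [ht.2]
        have hle : √(τ - t) ≤ ε := Real.sqrt_le_iff.2 ⟨h4, by linarith [ht.1]⟩
        have := hsmall √(τ - t) (Real.sqrt_nonneg _) (hle.trans_lt h2) 0 (by simp)
        rw [Real.sq_sqrt ht0] at this
        simp only [mul_zero, add_zero, sub_zero, sub_sub_cancel] at this
        rw [Real.norm_eq_abs, abs_mul, abs_of_pos (by norm_num : (0 : ℝ) < 2⁻¹)]
        have : |jet w 2 p t| ≤ η / (R + 1) * ε := this.trans (by gcongr)
        linarith [abs_nonneg (jet w 2 p t)])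
      (right_mem_Icc.2 (by linarith [sq_nonneg ε])) (left_mem_Icc.2 (by linarith [sq_nonneg ε]))
    rw [Real.norm_eq_abs, sub_sub_cancel_left, norm_neg, Real.norm_of_nonneg (sq_nonneg ε)] at key
    refine key.trans (le_of_eq (by ring))
  have h9 := abs_le.1 h9
  norm_num at h8
  exact abs_le.2 ⟨by linarith, by linarith⟩

/-- `NearModel` sees increments in P only, so closeness of P-derivatives suffices: a first-order
estimate of u' and a second-order estimate of v', both divided by the leading coefficient. -/
lemma eventually_nearModel {u v : ℝ → ℝ} (hu : Tempered u) (hv : Tempered v) {p τ : ℝ} (hτ : 0 < τ)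
    (hu₁ : jet u 1 p τ = 0) (hu₂ : jet u 2 p τ ≠ 0) (hv₂ : jet v 2 p τ = 0) (hv₁ : jet v 1 p τ = 0)
    (hv₃ : jet v 3 p τ ≠ 0) : ∀ᶠ ε in 𝓝[>] (0 : ℝ),
      NearModel (fun P => jet u 0 (p + ε * P) (τ - ε ^ 2) / (jet u 2 p τ * ε ^ 2))
        (fun P => jet v 0 (p + ε * P) (τ - ε ^ 2) / (jet v 3 p τ * ε ^ 3)) := by
  have hle : 𝓝[>] (0 : ℝ) ≤ 𝓝[≥] 0 := nhdsWithin_mono _ Ioi_subset_Ici_self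
  have hbd (k k' m m' : ℝ → ℝ) (A : ℝ) (hA : A ≠ 0) (hk : ∀ P, HasDerivAt k (k' P) P)
      (hm : ∀ P, HasDerivAt m (m' P) P)
      (hkm : ∀ P, |P| ≤ 2 → |k' P - A * m' P| ≤ |A| / 100) (a b : ℝ) (ha : -2 ≤ a) (hab : a ≤ b)
      (hb : b ≤ 2) : |k b / A - k a / A - (m b - m a)| ≤ (b - a) / 100 := by
    have h := abs_sub_le_of_deriv_le (R := 2) (fun P _ => (hk P).sub ((hm P).const_mul A)) hkm
      (abs_le.2 ⟨ha, by linarith⟩) (abs_le.2 ⟨by linarith, hb⟩)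
    rw [abs_of_nonneg (sub_nonneg.2 hab)] at h
    have e : k b / A - k a / A - (m b - m a) =
        A⁻¹ * ((k - fun y => A * m y) b - (k - fun y => A * m y) a) := by
      simp only [Pi.sub_apply]; field_simp; ring
    rw [e, abs_mul, abs_inv]
    calc _ ≤ |A|⁻¹ * (|A| / 100 * (b - a)) := by gcongr
      _ = _ := by field_simp
  have ηu : 0 < |jet u 2 p τ| / 100 := by positivity
  have ηv : 0 < |jet v 3 p τ| / 100 := by positivity
  filter_upwards [hle (parabolic_first_order_jet hu (by norm_num) hτ hu₁ zero_le_two ηu),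
    hle (parabolic_second_order_jet hv (by norm_num : 1 + 1 < 3) hτ hv₂ zero_le_two ηv),
    hle (eventually_sq_lt hτ), self_mem_nhdsWithin] with ε h1 h2 h3 h4
  replace h4 : 0 < ε := h4
  rw [hv₁] at h2
  constructor
  · intro a b ha hab hb
    have := hbd (fun P => jet u 0 (p + ε * P) (τ - ε ^ 2)) _ (fun P => P ^ 2 / 2) (fun P => P)
      (jet u 2 p τ * ε ^ 2) (by positivity)
      (fun P => hasDerivAt_jet_rescaled hu (by norm_num) p ε P h3)
      (fun P => by simpa using ((hasDerivAt_id P).pow 2).div_const 2)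
      (fun P hP => by
        have e : ε * jet u (0 + 1) (p + ε * P) (τ - ε ^ 2) - jet u 2 p τ * ε ^ 2 * P =
          ε * (jet u 1 (p + ε * P) (τ - ε ^ 2) - jet u (1 + 1) p τ * (ε * P)) := by
            norm_num; ring
        rw [e, abs_mul, abs_of_pos h4, abs_mul, abs_of_pos (by positivity : 0 < ε ^ 2)]
        calc _ ≤ ε * (|jet u 2 p τ| / 100 * ε) := by gcongr; exact h1 P hP
          _ = _ := by ring) a b ha hab hb
    rwa [sub_div]
  · intro a b ha hab hb
    have := hbd (fun P => jet v 0 (p + ε * P) (τ - ε ^ 2)) _ (fun P => (P ^ 3 - 3 * P) / 6)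
      (fun P => (3 * P ^ 2 - 3) / 6)
      (jet v 3 p τ * ε ^ 3) (by positivity)
      (fun P => hasDerivAt_jet_rescaled hv (by norm_num) p ε P h3)
      (fun P => by simpa using
        (((hasDerivAt_id P).pow 3).sub ((hasDerivAt_id P).const_mul 3)).div_const 6)
      (fun P hP => by
        have e : ε * jet v (0 + 1) (p + ε * P) (τ - ε ^ 2) -
            jet v 3 p τ * ε ^ 3 * ((3 * P ^ 2 - 3) / 6) =
          ε * (jet v 1 (p + ε * P) (τ - ε ^ 2) - 0 -
            2⁻¹ * jet v (1 + 2) p τ * ε ^ 2 * (P ^ 2 - 1)) := by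
            norm_num; ring
        rw [e, abs_mul, abs_of_pos h4, abs_mul, abs_of_pos (by positivity : 0 < ε ^ 3)]
        calc _ ≤ ε * (|jet v 3 p τ| / 100 * ε ^ 2) := by gcongr; exact h2 P hP
          _ = _ := by ring) a b ha hab hb
    rwa [sub_div]

lemma convergesTo_rescaled {f : ℝ → ℝ → ℂ} {c : ℂ} {u v : ℝ → ℝ} (hu : Tempered u)
    (hv : Tempered v) (hf : ∀ p τ, 0 < τ → c * f p τ = ⟨jet u 0 p τ, jet v 0 p τ⟩) {p τ : ℝ}
    (hτ : 0 < τ) (hu₁ : jet u 1 p τ = 0) (hv₁ : jet v 1 p τ = 0) (hv₂ : jet v 2 p τ = 0) :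
    ConvergesTo (rescaled f c p τ) (𝓝[>] 0) (limitCurve (jet u 2 p τ / 2) (jet v 3 p τ / 6)) := by
  refine ⟨continuous_limitCurve _ _, fun x => ?_⟩
  have hsqrt : Tendsto Real.sqrt (𝓝[>] 0) (𝓝[≥] 0) := by
    refine tendsto_nhdsWithin_iff.2 ⟨?_, Eventually.of_forall fun s => Real.sqrt_nonneg s⟩
    simpa using (Real.continuous_sqrt.tendsto 0).mono_left nhdsWithin_le_nhds
  have hdiff : Tendsto (fun z : ℝ × ℝ => rescaled f c p τ z.1 z.2 -
      limitCurve (jet u 2 p τ / 2) (jet v 3 p τ / 6) z.2) (𝓝[>] 0 ×ˢ 𝓝 x) (𝓝 0) := by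
    rw [Metric.tendsto_nhds]
    intro η hη
    have hη3 : 0 < η / 3 := by positivity
    have hR : 0 ≤ |x| + 1 := by positivity
    have hP : ∀ᶠ z : ℝ × ℝ in 𝓝[>] 0 ×ˢ 𝓝 x, |z.2| ≤ |x| + 1 :=
      tendsto_snd.eventually <| (continuous_abs.tendsto x).eventually (eventually_le_nhds (by linarith))
    filter_upwards [hP,
      tendsto_fst.eventually (hsqrt.eventually (parabolic_second_order_jet hu (j := 0)
        (by norm_num) hτ hu₁ hR hη3)),
      tendsto_fst.eventually (hsqrt.eventually (parabolic_third_order_jet hv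
        hτ hv₁ hv₂ hR hη3)),
      tendsto_fst.eventually (hsqrt.eventually (eventually_sq_lt hτ)),
      tendsto_fst.eventually (self_mem_nhdsWithin : Ioi (0 : ℝ) ∈ 𝓝[>] 0)] with ⟨s, P⟩ h1 h2 h3 h4 h5
    replace h5 : 0 < s := h5
    have h6 := h2 P h1
    have h7 := h3 P h1
    simp only [Real.sq_sqrt h5.le] at h4 h6 h7
    have e0 : 0 < √s := Real.sqrt_pos.2 h5
    have e3 : s ^ (-(3 / 2) : ℝ) = (√s ^ 3)⁻¹ := by
      rw [Real.rpow_neg h5.le, Real.sqrt_eq_rpow, ← Real.rpow_natCast, ← Real.rpow_mul h5.le]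
      norm_num
    have hz : c * (f (p + √s * P) (τ - s) - f p τ) =
        ⟨jet u 0 (p + √s * P) (τ - s) - jet u 0 p τ, jet v 0 (p + √s * P) (τ - s) - jet v 0 p τ⟩ := by
      rw [mul_sub, hf _ _ h4, hf _ _ hτ]; rfl
    rw [dist_zero_right]
    refine (Complex.norm_le_abs_re_add_abs_im _).trans_lt ?_
    simp only [rescaled, hz, limitCurve, Complex.sub_re, Complex.sub_im, e3]
    have i1 : |s⁻¹ * (jet u 0 (p + √s * P) (τ - s) - jet u 0 p τ) -
        jet u 2 p τ / 2 * (P ^ 2 - 1)| ≤ η / 3 := by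
      have e : s⁻¹ * (jet u 0 (p + √s * P) (τ - s) - jet u 0 p τ) - jet u 2 p τ / 2 * (P ^ 2 - 1) =
        s⁻¹ * (jet u 0 (p + √s * P) (τ - s) - jet u 0 p τ -
          2⁻¹ * jet u (0 + 2) p τ * s * (P ^ 2 - 1)) := by field_simp
      rw [e, abs_mul, abs_of_pos (by positivity : 0 < s⁻¹)]
      calc _ ≤ s⁻¹ * (η / 3 * s) := by gcongr
        _ = _ := by field_simp
    have i2 : |(√s ^ 3)⁻¹ * (jet v 0 (p + √s * P) (τ - s) - jet v 0 p τ) -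
        jet v 3 p τ / 6 * (P ^ 3 - 3 * P)| ≤ η / 3 := by
      have e : (√s ^ 3)⁻¹ * (jet v 0 (p + √s * P) (τ - s) - jet v 0 p τ) -
          jet v 3 p τ / 6 * (P ^ 3 - 3 * P) =
        (√s ^ 3)⁻¹ * (jet v 0 (p + √s * P) (τ - s) - jet v 0 p τ -
          jet v 3 p τ * √s ^ 3 * ((P ^ 3 - 3 * P) / 6)) := by field_simp
      rw [e, abs_mul, abs_of_pos (by positivity : 0 < (√s ^ 3)⁻¹)]
      calc _ ≤ (√s ^ 3)⁻¹ * (η / 3 * √s ^ 3) := by gcongr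
        _ = _ := by field_simp
    linarith
  have hlim := ((continuous_limitCurve (jet u 2 p τ / 2) (jet v 3 p τ / 6)).tendsto x).comp
    (tendsto_snd (f := 𝓝[>] (0 : ℝ)) (g := 𝓝 x))
  simpa using hdiff.add hlim

end CongaLoop

namespace CongaLoop

/-! ### Uniqueness of double points under changes of coordinates -/

lemma IsUniqueDouble.congr {γ γ' : ℝ → ℂ} {S : Set ℝ} {a b : ℝ} (h : IsUniqueDouble γ S a b)
    (hγ : ∀ x y, γ' x = γ' y ↔ γ x = γ y) : IsUniqueDouble γ' S a b :=
  ⟨h.lt, (hγ a b).2 h.eq, h.subset, fun a' b' h1 h2 h3 => h.unique a' b' h1 h2 ((hγ a' b').1 h3)⟩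

lemma IsUniqueDouble.affine {γ : ℝ → ℂ} {p ε R a b : ℝ} (hε : 0 < ε)
    (h : IsUniqueDouble (fun P => γ (p + ε * P)) (Icc (-R) R) a b) :
    IsUniqueDouble γ (Icc (p - R * ε) (p + R * ε)) (p + ε * a) (p + ε * b) := by
  have ha := h.subset (left_mem_Icc.2 h.lt.le)
  have hb := h.subset (right_mem_Icc.2 h.lt.le)
  refine ⟨by nlinarith [h.lt], h.eq, Icc_subset_Icc (by nlinarith [ha.1]) (by nlinarith [hb.2]),
    fun a' b' hab hS he => ?_⟩
  have hl := hS (left_mem_Icc.2 hab.le)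
  have hr := hS (right_mem_Icc.2 hab.le)
  have e (x : ℝ) : p + ε * ((x - p) / ε) = x := by field_simp; ring
  obtain ⟨h1, h2⟩ := h.unique ((a' - p) / ε) ((b' - p) / ε) (by gcongr)
    (Icc_subset_Icc (by rw [le_div_iff₀ hε]; linarith [hl.1])
      (by rw [div_le_iff₀ hε]; linarith [hr.2])) (by simpa only [e] using he)
  exact ⟨by rw [← h1, e], by rw [← h2, e]⟩

/-! ### Death of a loop -/

/-- An evolution `L'` with the same start that outlives T agrees with L on a clopen subset of [T₁,
T): agreement is closed, and by uniqueness it is equivalent to the open condition of lying strictly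
inside (l, r). So `L'` equals L up to T and by continuity has length 0 at T, which no `Curve` has.
-/
lemma vanishesAfter_of_unique {f : ℝ → ℝ → ℂ} {T₁ T : ℝ} {L : ℝ → Curve} {l r : ℝ → ℝ} (hT : T₁ < T)
    (hL : IsLoopEvolution f T₁ T L)
    (hu : ∀ t ∈ Ico T₁ T, IsUniqueLoopIn (fun p => f p t) (Icc (l t) (r t)) (L t))
    (hl : ContinuousOn l (Ico T₁ T)) (hr : ContinuousOn r (Ico T₁ T))
    (hlL : ∀ t ∈ Ico T₁ T, l t < (L t).left ∧ (L t).right < r t)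
    (hlen : Tendsto (fun t => (L t).right - (L t).left) (𝓝[<] T) (𝓝 0)) :
    VanishesAfter f T₁ (L T₁) T := by
  refine ⟨?_, fun T' hT' => hT' ⟨hT, L, hL, rfl⟩⟩
  rintro T₂ ⟨-, L', hL', hinit⟩
  by_contra! hlt
  have hsub : Ico T₁ T ⊆ Ico T₁ T₂ := Ico_subset_Ico_right hlt.le
  have hc : ContinuousOn L' (Ico T₁ T) := hL'.continuousOn.mono hsub
  have heq (t) (ht : t ∈ Ico T₁ T) : L' t = L t ↔ l t < (L' t).left ∧ (L' t).right < r t := by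
    refine ⟨fun h => h ▸ hlL t ht, fun h => (hu t ht).unique _ (hL'.isLoop t (hsub ht))
      (Icc_subset_Icc h.1.le h.2.le)⟩
  -- `Curve` carries only a pseudometric, so closedness of the agreement set is read off the end
  -- points.
  have heq' (t) (ht : t ∈ Ico T₁ T) : L' t = L t ↔
      (L' t).left = (L t).left ∧ (L' t).right = (L t).right := by
    refine ⟨fun h => by rw [h]; exact ⟨rfl, rfl⟩, fun h => Curve.ext_of_restriction (γ := fun p => f p t) h.1 h.2
      (hL'.isLoop t (hsub ht)).restriction (hL.isLoop t ht).restriction⟩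
  have : PreconnectedSpace (Ico T₁ T) := Subtype.preconnectedSpace isPreconnected_Ico
  have c1 : Continuous fun t : Ico T₁ T => L' t := hc.domRestrict
  have c2 : Continuous fun t : Ico T₁ T => L t := hL.continuousOn.domRestrict
  have c3 : Continuous fun t : Ico T₁ T => l t := hl.domRestrict
  have c4 : Continuous fun t : Ico T₁ T => r t := hr.domRestrict
  have hclopen : IsClopen {t : Ico T₁ T | L' t = L t} := by
    constructor
    · have : {t : Ico T₁ T | L' t = L t} = {t : Ico T₁ T | (L' t).left = (L t).left} ∩
          {t : Ico T₁ T | (L' t).right = (L t).right} := by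
        ext t; exact heq' t t.2
      rw [this]
      exact (isClosed_eq (Curve.continuous_left.comp c1) (Curve.continuous_left.comp c2)).inter
        (isClosed_eq (Curve.continuous_right.comp c1) (Curve.continuous_right.comp c2))
    · have : {t : Ico T₁ T | L' t = L t} = {t : Ico T₁ T | l t < (L' t).left} ∩
          {t : Ico T₁ T | (L' t).right < r t} := by
        ext t; exact heq t t.2
      rw [this]
      exact (isOpen_lt c3 (Curve.continuous_left.comp c1)).inter
        (isOpen_lt (Curve.continuous_right.comp c1) c4)
  have hall : ∀ t ∈ Ico T₁ T, L' t = L t := fun t ht => by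
    have := hclopen.eq_univ ⟨⟨T₁, left_mem_Ico.2 hT⟩, hinit⟩
    have hm : (⟨t, ht⟩ : Ico T₁ T) ∈ {t : Ico T₁ T | L' t = L t} := by rw [this]; trivial
    exact hm
  have hTc : Tendsto L' (𝓝[<] T) (𝓝 (L' T)) := by
    rw [← nhdsWithin_Ico_eq_nhdsLT hT]
    exact (hL'.continuousOn T ⟨hT.le, hlt⟩).mono hsub
  have hlen' := ((Curve.continuous_right.tendsto _).comp hTc).sub
    ((Curve.continuous_left.tendsto _).comp hTc)
  have h0 : (L' T).right - (L' T).left = 0 := by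
    refine tendsto_nhds_unique (hlen'.congr' ?_) hlen
    rw [← nhdsWithin_Ico_eq_nhdsLT hT]
    filter_upwards [self_mem_nhdsWithin] with t ht
    simp [hall t ht]
  linarith [(L' T).left_lt_right]

/-! ### Taylor coefficients and natural frames -/

lemma deriv_jet {w : ℝ → ℝ} (hw : Tempered w) {j : ℕ} (hj : j < 3) {τ : ℝ} (hτ : 0 < τ) :
    deriv (fun p => jet w j p τ) = fun p => jet w (j + 1) p τ :=
  funext fun p => (hasDerivAt_jet_space hw hj p hτ).deriv

lemma exists_taylor {w : ℝ → ℝ} (hw : Tempered w) (p : ℝ) {τ : ℝ} (hτ : 0 < τ) :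
    ∃ A : ℕ → ℝ, A 0 = 0 ∧ A 1 = jet w 1 p τ ∧ A 2 = jet w 2 p τ / 2 ∧ A 3 = jet w 3 p τ / 6 ∧
      HasFPowerSeriesAt (fun q => jet w 0 q τ - jet w 0 p τ)
        (FormalMultilinearSeries.ofScalars ℝ A) p := by
  set G : ℝ → ℝ := fun q => jet w 0 q τ - jet w 0 p τ
  have h1 : deriv G = fun q => jet w 1 q τ := by
    rw [← deriv_jet hw (by norm_num) hτ]; ext q; simp [G]
  have h2 : deriv (deriv G) = fun q => jet w 2 q τ := by rw [h1, deriv_jet hw (by norm_num) hτ]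
  have h3 : deriv (deriv (deriv G)) = fun q => jet w 3 q τ := by
    rw [h2, deriv_jet hw (by norm_num) hτ]
  refine ⟨fun n => iteratedDeriv n G p / n.factorial, ?_, ?_, ?_, ?_,
    ((analyticAt_jet_zero hw hτ p).sub analyticAt_const).hasFPowerSeriesAt⟩
  · simp [G]
  · simp [iteratedDeriv_one, h1]
  · simp [iteratedDeriv_succ, iteratedDeriv_zero, h2]
  · simp [iteratedDeriv_succ, iteratedDeriv_zero, h3, Nat.factorial]

lemma hasFPowerSeriesAt_ofScalars_iff {G : ℝ → ℝ} {A : ℕ → ℝ} {p : ℝ} :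
    HasFPowerSeriesAt G (FormalMultilinearSeries.ofScalars ℝ A) p ↔
      ∃ r > 0, ∀ t, |t - p| ≤ r → HasSum (fun i => A i * (t - p) ^ i) (G t) := by
  rw [hasFPowerSeriesAt_iff, Metric.eventually_nhds_iff]
  simp only [FormalMultilinearSeries.coeff_ofScalars, smul_eq_mul, dist_zero_right, Real.norm_eq_abs,
    mul_comm]
  constructor
  · rintro ⟨r, hr, h⟩
    refine ⟨r / 2, by positivity, fun t ht => ?_⟩
    simpa using h (y := t - p) (by linarith)
  · rintro ⟨r, hr, h⟩
    refine ⟨r, hr, fun t ht => ?_⟩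
    simpa using h (p + t) (by simpa using ht.le)

/-- The paths `w₁`, `w₂` give the coordinates of `f`. -/
structure IsHeatFlow (f : ℝ → ℝ → ℂ) (w₁ w₂ : ℝ → ℝ) : Prop where
  fst : Tempered w₁
  snd : Tempered w₂
  eq : ∀ p τ, 0 < τ → f p τ = ⟨jet w₁ 0 p τ, jet w₂ 0 p τ⟩

namespace IsHeatFlow

variable {f : ℝ → ℝ → ℂ} {w₁ w₂ : ℝ → ℝ} {p₀ τ₀ : ℝ}

/-- Rotating the curve amounts to rotating the driving paths, so the results on jets apply in every
coordinate frame. -/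
lemma mul_left (h : IsHeatFlow f w₁ w₂) (c : ℂ) : IsHeatFlow (fun p τ => c * f p τ)
    (fun t => c.re * w₁ t + -c.im * w₂ t) (fun t => c.im * w₁ t + c.re * w₂ t) := by
  refine ⟨(h.fst.const_mul _).add (h.snd.const_mul _), (h.fst.const_mul _).add (h.snd.const_mul _),
    fun p τ hτ => ?_⟩
  rw [h.eq p τ hτ, jet_add (h.fst.const_mul _) (h.snd.const_mul _) _ _ hτ,
    jet_add (h.fst.const_mul _) (h.snd.const_mul _) _ _ hτ]
  simp only [jet_const_mul]
  apply Complex.ext <;> simp <;> ring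

lemma continuousAt (h : IsHeatFlow f w₁ w₂) (p : ℝ) {τ : ℝ} (hτ : 0 < τ) :
    ContinuousAt (fun x : ℝ × ℝ => f x.1 x.2) (p, τ) := by
  have h1 := (differentiableAt_jet h.fst (Nat.zero_le 3) p hτ).continuousAt
  have h2 := (differentiableAt_jet h.snd (Nat.zero_le 3) p hτ).continuousAt
  have h3 : ContinuousAt (fun x : ℝ × ℝ => Complex.equivRealProdCLM.symm
      (jet w₁ 0 x.1 x.2, jet w₂ 0 x.1 x.2)) (p, τ) :=
    Complex.equivRealProdCLM.symm.continuous.continuousAt.comp (h1.prodMk h2)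
  refine h3.congr ?_
  have : ∀ᶠ x : ℝ × ℝ in 𝓝 (p, τ), 0 < x.2 := (continuous_snd.tendsto _).eventually_const_lt hτ
  filter_upwards [this] with x hx
  rw [h.eq _ _ hx]; rfl

lemma continuous_slice (h : IsHeatFlow f w₁ w₂) {τ : ℝ} (hτ : 0 < τ) :
    Continuous fun p => f p τ :=
  continuous_iff_continuousAt.2 fun p =>
    (h.continuousAt p hτ).comp (f := fun p => (p, τ)) (by fun_prop)

lemma jet_one_eq_zero (h : IsHeatFlow f w₁ w₂) (hτ : 0 < τ₀)
    (hs : IsSingularity (fun p => f p τ₀) p₀) : jet w₁ 1 p₀ τ₀ = 0 ∧ jet w₂ 1 p₀ τ₀ = 0 := by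
  have h1 := Complex.reCLM.hasFDerivAt.comp_hasDerivAt p₀ hs
  have h2 := Complex.imCLM.hasFDerivAt.comp_hasDerivAt p₀ hs
  have e1 : (Complex.reCLM ∘ fun p => f p τ₀) = fun p => jet w₁ 0 p τ₀ := by
    ext p; simp [h.eq p τ₀ hτ]
  have e2 : (Complex.imCLM ∘ fun p => f p τ₀) = fun p => jet w₂ 0 p τ₀ := by
    ext p; simp [h.eq p τ₀ hτ]
  rw [e1, map_zero] at h1
  rw [e2, map_zero] at h2
  exact ⟨(hasDerivAt_jet_space h.fst (by norm_num) p₀ hτ).unique h1,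
    (hasDerivAt_jet_space h.snd (by norm_num) p₀ hτ).unique h2⟩

lemma analyticAt (h : IsHeatFlow f w₁ w₂) (hτ : 0 < τ₀) : AnalyticAt ℝ (fun p => f p τ₀) p₀ := by
  have e : (fun p => f p τ₀) = fun p => Complex.equivRealProdCLM.symm
      (jet w₁ 0 p τ₀, jet w₂ 0 p τ₀) := by
    ext p; rw [h.eq p τ₀ hτ]; rfl
  rw [e]
  exact (ContinuousLinearMap.analyticAt (Complex.equivRealProdCLM.symm : ℝ × ℝ →L[ℝ] ℂ) _).comp
    ((analyticAt_jet_zero h.fst hτ p₀).prod (analyticAt_jet_zero h.snd hτ p₀))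

/-- The frame `c` straightens the singularity of `f` at `(p, τ)`: the coordinates `u`, `v` of `c * f`
have vanishing derivatives of the appropriate orders. -/
structure Straight (u v : ℝ → ℝ) (p τ : ℝ) : Prop where
  u_one : jet u 1 p τ = 0
  u_two : jet u 2 p τ ≠ 0
  v_one : jet v 1 p τ = 0
  v_two : jet v 2 p τ = 0
  v_three : jet v 3 p τ ≠ 0

lemma exists_isNaturalFrame {c : ℂ} {u v : ℝ → ℝ} (h : IsHeatFlow (fun p τ => c * f p τ) u v)
    (hc : ‖c‖ = 1) (hτ : 0 < τ₀) (hs : Straight u v p₀ τ₀) :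
    ∃ a b, IsNaturalFrame (fun p => f p τ₀) p₀ c a b := by
  obtain ⟨A, A0, A1, A2, -, hA⟩ := exists_taylor h.fst p₀ hτ
  obtain ⟨B, B0, B1, B2, B3, hB⟩ := exists_taylor h.snd p₀ hτ
  obtain ⟨r, hr, hA⟩ := hasFPowerSeriesAt_ofScalars_iff.1 hA
  obtain ⟨r', hr', hB⟩ := hasFPowerSeriesAt_ofScalars_iff.1 hB
  refine ⟨A, B, hc, fun i hi => ?_, fun i hi => ?_, ?_, ?_, min r r', lt_min hr hr', fun t ht => ?_⟩
  · interval_cases i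
    · exact A0
    · rw [A1, hs.u_one]
  · interval_cases i
    · exact B0
    · rw [B1, hs.v_one]
    · rw [B2, hs.v_two, zero_div]
  · rw [A2]; exact div_ne_zero hs.u_two two_ne_zero
  · rw [B3]; exact div_ne_zero hs.v_three (by norm_num)
  · have e := h.eq t τ₀ hτ
    have e' := h.eq p₀ τ₀ hτ
    simp only [mul_sub, e, e']
    exact ⟨hA t (ht.trans (min_le_left _ _)), hB t (ht.trans (min_le_right _ _))⟩

/-- Uniqueness of power series identifies the coefficients of an arbitrary natural frame with the
jets. -/
lemma straight_of_isNaturalFrame {c : ℂ} {u v : ℝ → ℝ} {a b : ℕ → ℝ}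
    (h : IsHeatFlow (fun p τ => c * f p τ) u v)
    (hτ : 0 < τ₀) (hF : IsNaturalFrame (fun p => f p τ₀) p₀ c a b) :
    Straight u v p₀ τ₀ ∧ a 2 = jet u 2 p₀ τ₀ / 2 ∧ b 3 = jet v 3 p₀ τ₀ / 6 := by
  obtain ⟨A, A0, A1, A2, -, hA⟩ := exists_taylor h.fst p₀ hτ
  obtain ⟨B, B0, B1, B2, B3, hB⟩ := exists_taylor h.snd p₀ hτ
  obtain ⟨r, hr, hab⟩ := hF.expansion
  have e' := h.eq p₀ τ₀ hτ
  have hA' : HasFPowerSeriesAt (fun q => jet u 0 q τ₀ - jet u 0 p₀ τ₀)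
      (FormalMultilinearSeries.ofScalars ℝ a) p₀ :=
    hasFPowerSeriesAt_ofScalars_iff.2 ⟨r, hr, fun t ht => by
      have := (hab t ht).1
      have e := h.eq t τ₀ hτ
      simp only [mul_sub, e, e'] at this
      exact this⟩
  have hB' : HasFPowerSeriesAt (fun q => jet v 0 q τ₀ - jet v 0 p₀ τ₀)
      (FormalMultilinearSeries.ofScalars ℝ b) p₀ :=
    hasFPowerSeriesAt_ofScalars_iff.2 ⟨r, hr, fun t ht => by
      have := (hab t ht).2
      have e := h.eq t τ₀ hτ
      simp only [mul_sub, e, e'] at this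
      exact this⟩
  have ea : a = A := FormalMultilinearSeries.ofScalars_series_injective ℝ ℝ
    (hA'.eq_formalMultilinearSeries hA)
  have eb : b = B := FormalMultilinearSeries.ofScalars_series_injective ℝ ℝ
    (hB'.eq_formalMultilinearSeries hB)
  subst ea eb
  have a1 := hF.a_low 1 (by norm_num)
  have b1 := hF.b_low 1 (by norm_num)
  have b2 := hF.b_low 2 (by norm_num)
  have a2 := hF.a_two
  have b3 := hF.b_three
  refine ⟨⟨by rw [← A1, a1], fun h0 => a2 (by rw [A2, h0, zero_div]), by rw [← B1, b1], ?_,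
    fun h0 => b3 (by rw [B3, h0, zero_div])⟩, A2, B3⟩
  rw [B2] at b2
  linarith

/-- The rotation is c = conj(f'')/|f''|: then c f'' = |f''| is real and Im(c f''') is the
determinant divided by |f''|. -/
lemma exists_straight (h : IsHeatFlow f w₁ w₂) (hτ : 0 < τ₀)
    (h1 : jet w₁ 1 p₀ τ₀ = 0) (h2 : jet w₂ 1 p₀ τ₀ = 0)
    (hdet : jet w₁ 2 p₀ τ₀ * jet w₂ 3 p₀ τ₀ - jet w₂ 2 p₀ τ₀ * jet w₁ 3 p₀ τ₀ ≠ 0) :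
    ∃ c : ℂ, ‖c‖ = 1 ∧ Straight (fun t => c.re * w₁ t + -c.im * w₂ t)
      (fun t => c.im * w₁ t + c.re * w₂ t) p₀ τ₀ := by
  set α := jet w₁ 2 p₀ τ₀ with hα
  set β := jet w₂ 2 p₀ τ₀ with hβ
  have hz : (⟨α, -β⟩ : ℂ) ≠ 0 := fun h0 => by
    have e1 : α = 0 := congrArg Complex.re h0
    have e2 : β = 0 := by simpa using congrArg Complex.im h0
    exact hdet (by rw [e1, e2]; ring)
  set N := ‖(⟨α, -β⟩ : ℂ)‖ with hN
  have hN0 : 0 < N := norm_pos_iff.2 hz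
  have hN2 : N ^ 2 = α ^ 2 + β ^ 2 := by
    rw [hN, ← Complex.normSq_eq_norm_sq, Complex.normSq_mk]; ring
  have hj (a b : ℝ) (j : ℕ) : jet (fun t => a * w₁ t + b * w₂ t) j p₀ τ₀ =
      a * jet w₁ j p₀ τ₀ + b * jet w₂ j p₀ τ₀ := by
    rw [jet_add (h.fst.const_mul _) (h.snd.const_mul _) _ _ hτ, jet_const_mul, jet_const_mul]
  have hre : ((N : ℂ)⁻¹ * ⟨α, -β⟩).re = N⁻¹ * α := by
    rw [← Complex.ofReal_inv, Complex.re_ofReal_mul]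
  have him : ((N : ℂ)⁻¹ * ⟨α, -β⟩).im = N⁻¹ * -β := by
    rw [← Complex.ofReal_inv, Complex.im_ofReal_mul]
  refine ⟨(N : ℂ)⁻¹ * ⟨α, -β⟩, ?_, ?_⟩
  · rw [norm_mul, norm_inv, Complex.norm_real, Real.norm_of_nonneg hN0.le, ← hN,
      inv_mul_cancel₀ hN0.ne']
  · rw [hre, him]
    constructor
    · rw [hj, h1, h2]; ring
    · rw [hj, ← hα, ← hβ]
      have : N⁻¹ * α * α + -(N⁻¹ * -β) * β = N := by
        field_simp; linarith
      rw [this]; exact hN0.ne'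
    · rw [hj, h1, h2]; ring
    · rw [hj, ← hα, ← hβ]; ring
    · rw [hj]
      have : N⁻¹ * -β * jet w₁ 3 p₀ τ₀ + N⁻¹ * α * jet w₂ 3 p₀ τ₀ =
        N⁻¹ * (α * jet w₂ 3 p₀ τ₀ - β * jet w₁ 3 p₀ τ₀) := by ring
      rw [this]
      exact mul_ne_zero (inv_ne_zero hN0.ne') hdet

end IsHeatFlow

end CongaLoop

namespace CongaLoop

/-! ### Formation of cusps -/

section Cusp

variable {f : ℝ → ℝ → ℂ} {w₁ w₂ : ℝ → ℝ} {p₀ τ₀ : ℝ}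

lemma rescaled_eq_iff {c : ℂ} (hc : c ≠ 0) {s : ℝ} (hs : 0 < s) (x y : ℝ) :
    rescaled f c p₀ τ₀ s x = rescaled f c p₀ τ₀ s y ↔
      f (p₀ + √s * x) (τ₀ - s) = f (p₀ + √s * y) (τ₀ - s) := by
  refine ⟨fun h => ?_, fun h => by simp only [rescaled, h]⟩
  have h1 := mul_left_cancel₀ (inv_ne_zero hs.ne') (congrArg Complex.re h)
  have h2 := mul_left_cancel₀ (Real.rpow_pos_of_pos hs _).ne' (congrArg Complex.im h)
  have h3 := mul_left_cancel₀ hc (Complex.ext h1 h2)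
  exact sub_left_injective h3

/-- The pair of functions `A`, `B` describes, for `0 < s ≤ δ`, the only double point of the curve
`P ↦ f (p₀ + √s P) (τ₀ - s)` in `[-2, 2]`. -/
structure IsDoubleBranch (f : ℝ → ℝ → ℂ) (p₀ τ₀ δ : ℝ) (A B : ℝ → ℝ) : Prop where
  left_mem : ∀ s ∈ Ioc 0 δ, A s ∈ Icc (-1.8) (-1.6)
  right_mem : ∀ s ∈ Ioc 0 δ, B s ∈ Icc 1.6 1.8
  double : ∀ s ∈ Ioc 0 δ, IsUniqueDouble (fun P => f (p₀ + √s * P) (τ₀ - s)) (Icc (-2) 2) (A s) (B s)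

/-- Dividing u and v by nonzero constants does not affect double points, so those of the normalised
curve near the model are those of `f`. -/
lemma IsHeatFlow.exists_isDoubleBranch {c : ℂ} {u v : ℝ → ℝ} (hc : c ≠ 0)
    (h : IsHeatFlow (fun p τ => c * f p τ) u v) (hp : 0 < p₀) (hτ : 0 < τ₀)
    (hs : IsHeatFlow.Straight u v p₀ τ₀) :
    ∃ δ A B, 0 < δ ∧ δ < τ₀ ∧ 2 * √δ < p₀ ∧ IsDoubleBranch f p₀ τ₀ δ A B := by
  obtain ⟨ε₀, hε₀, hmodel⟩ := mem_nhdsGT_iff_exists_Ioo_subset.1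
    (eventually_nearModel h.fst h.snd hτ hs.u_one hs.u_two hs.v_two hs.v_one hs.v_three)
  replace hε₀ : 0 < ε₀ := hε₀
  -- The three bounds keep the scale in the range of `NearModel`, the interval of half-width 2ε
  -- inside (0, ∞), and the time positive; δ will be ε².
  set ε := min (ε₀ / 2) (min (p₀ / 3) (√τ₀ / 2)) with hε
  have hτ' : 0 < √τ₀ := Real.sqrt_pos.2 hτ
  have e0 : 0 < ε := by positivity
  have e1 : ε < ε₀ := (min_le_left _ _).trans_lt (by linarith)
  have e2 : 2 * ε < p₀ := by
    have : ε ≤ p₀ / 3 := (min_le_right _ _).trans (min_le_left _ _)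
    linarith
  have e3 : ε < √τ₀ := by
    have : ε ≤ √τ₀ / 2 := (min_le_right _ _).trans (min_le_right _ _)
    linarith
  have e4 : ε ^ 2 < τ₀ := (Real.lt_sqrt e0.le).1 e3
  have key (s : ℝ) (hs' : s ∈ Ioc 0 (ε ^ 2)) : ∃ a b, a ∈ Icc (-1.8 : ℝ) (-1.6) ∧
      b ∈ Icc (1.6 : ℝ) 1.8 ∧
      IsUniqueDouble (fun P => f (p₀ + √s * P) (τ₀ - s)) (Icc (-2) 2) a b := by
    have s0 : 0 < √s := Real.sqrt_pos.2 hs'.1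
    have s1 : √s ≤ ε := Real.sqrt_le_iff.2 ⟨e0.le, hs'.2⟩
    have hm := hmodel ⟨s0, s1.trans_lt e1⟩
    simp only [mem_ofPred_eq, Real.sq_sqrt hs'.1.le] at hm
    have ht : 0 < τ₀ - s := by linarith [hs'.2]
    have hiff (x y : ℝ) : f (p₀ + √s * x) (τ₀ - s) = f (p₀ + √s * y) (τ₀ - s) ↔
        jet u 0 (p₀ + √s * x) (τ₀ - s) / (jet u 2 p₀ τ₀ * s) =
          jet u 0 (p₀ + √s * y) (τ₀ - s) / (jet u 2 p₀ τ₀ * s) ∧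
        jet v 0 (p₀ + √s * x) (τ₀ - s) / (jet v 3 p₀ τ₀ * √s ^ 3) =
          jet v 0 (p₀ + √s * y) (τ₀ - s) / (jet v 3 p₀ τ₀ * √s ^ 3) := by
      have n1 : jet u 2 p₀ τ₀ * s ≠ 0 := mul_ne_zero hs.u_two hs'.1.ne'
      have n2 : jet v 3 p₀ τ₀ * √s ^ 3 ≠ 0 := mul_ne_zero hs.v_three (by positivity)
      rw [div_left_inj' n1, div_left_inj' n2, ← mul_right_inj' hc, h.eq _ _ ht, h.eq _ _ ht,
        Complex.mk.injEq]
    obtain ⟨a, b, ha, hb, hx, hy⟩ := hm.exists_double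
    refine ⟨a, b, ha, hb, by linarith [ha.2, hb.1], (hiff a b).2 ⟨hx, hy⟩,
      Icc_subset_Icc (by linarith [ha.1]) (by linarith [hb.2]), fun a' b' hab' hS he => ?_⟩
    obtain ⟨hx', hy'⟩ := (hiff a' b').1 he
    exact hm.eq_of_double (by linarith [ha.1]) (by linarith [ha.2, hb.1]) (by linarith [hb.2]) hx hy
      (hS (left_mem_Icc.2 hab'.le)).1 hab' (hS (right_mem_Icc.2 hab'.le)).2 hx' hy'
  choose! A B hA hB hAB using key
  exact ⟨ε ^ 2, A, B, by positivity, e4, by rwa [Real.sqrt_sq e0.le], hA, hB, hAB⟩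

namespace IsDoubleBranch

variable {δ : ℝ} {A B : ℝ → ℝ}

/-- A and B are merely chosen pointwise; uniqueness of the double point in a compact box makes them
continuous. -/
lemma continuousOn (h : IsDoubleBranch f p₀ τ₀ δ A B) (hf : IsHeatFlow f w₁ w₂) (hδ : δ < τ₀) :
    ContinuousOn (fun s => (A s, B s)) (Ioc 0 δ) := by
  intro s hs
  have hc : ConvergesTo (fun s P => f (p₀ + √s * P) (τ₀ - s)) (𝓝 s)
      (fun P => f (p₀ + √s * P) (τ₀ - s)) := by
    have ht : 0 < τ₀ - s := by linarith [hs.2]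
    refine ⟨(hf.continuous_slice ht).comp (by fun_prop), fun x => ?_⟩
    rw [← nhds_prod_eq]
    exact (hf.continuousAt (p₀ + √s * x) ht).comp
      (f := fun z : ℝ × ℝ => (p₀ + √z.1 * z.2, τ₀ - z.1)) (x := (s, x)) (by fun_prop)
  have hc' : ConvergesTo (fun s P => f (p₀ + √s * P) (τ₀ - s)) (𝓝[Ioc 0 δ] s)
      (fun P => f (p₀ + √s * P) (τ₀ - s)) :=
    ⟨hc.continuous, fun x => (hc.tendsto x).mono_left
      (Filter.prod_mono nhdsWithin_le_nhds le_rfl)⟩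
  refine hc'.tendsto_double (isCompact_Icc.prod isCompact_Icc) ?_
    (K := Icc (-1.8) (-1.6) ×ˢ Icc 1.6 1.8) (fun y hy he => ?_)
  · filter_upwards [self_mem_nhdsWithin] with t ht
    exact ⟨⟨h.left_mem t ht, h.right_mem t ht⟩, (h.double t ht).eq⟩
  · obtain ⟨⟨h1, h2⟩, h3, h4⟩ := hy
    have := (h.double s hs).unique y.1 y.2 (by linarith)
      (Icc_subset_Icc (by linarith) (by linarith)) he
    exact Prod.ext this.1 this.2

lemma double_unscaled (h : IsDoubleBranch f p₀ τ₀ δ A B) {τ : ℝ} (hτ : τ ∈ Ico (τ₀ - δ) τ₀) :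
    IsUniqueDouble (fun p => f p τ) (Icc (p₀ - 2 * √(τ₀ - τ)) (p₀ + 2 * √(τ₀ - τ)))
      (p₀ + √(τ₀ - τ) * A (τ₀ - τ)) (p₀ + √(τ₀ - τ) * B (τ₀ - τ)) := by
  have hs : τ₀ - τ ∈ Ioc 0 δ := ⟨by linarith [hτ.2], by linarith [hτ.1]⟩
  have hd := h.double _ hs
  rw [sub_sub_cancel] at hd
  exact hd.affine (γ := fun p => f p τ) (Real.sqrt_pos.2 hs.1)

end IsDoubleBranch

/-- The loop of `f` at time `τ` given by a branch of double points. -/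
noncomputable def branchLoop (f : ℝ → ℝ → ℂ) (p₀ τ₀ : ℝ) (A B : ℝ → ℝ) (τ : ℝ) : Curve :=
  arc (fun p => f p τ) (p₀ + √(τ₀ - τ) * A (τ₀ - τ)) (p₀ + √(τ₀ - τ) * B (τ₀ - τ))

namespace IsDoubleBranch

variable {δ : ℝ} {A B : ℝ → ℝ}

lemma isUniqueLoopIn (h : IsDoubleBranch f p₀ τ₀ δ A B) (hf : IsHeatFlow f w₁ w₂) (hδ : δ < τ₀)
    {τ : ℝ} (hτ : τ ∈ Ico (τ₀ - δ) τ₀) :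
    IsUniqueLoopIn (fun p => f p τ) (Icc (p₀ - 2 * √(τ₀ - τ)) (p₀ + 2 * √(τ₀ - τ)))
      (branchLoop f p₀ τ₀ A B τ) :=
  (h.double_unscaled hτ).isUniqueLoopIn_arc
    (hf.continuous_slice (by linarith [hτ.1])).continuousOn

lemma branchLoop_left (h : IsDoubleBranch f p₀ τ₀ δ A B) (hf : IsHeatFlow f w₁ w₂) (hδ : δ < τ₀)
    {τ : ℝ} (hτ : τ ∈ Ico (τ₀ - δ) τ₀) :
    (branchLoop f p₀ τ₀ A B τ).left = p₀ + √(τ₀ - τ) * A (τ₀ - τ) :=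
  arc_left (h.double_unscaled hτ).lt (hf.continuous_slice (by linarith [hτ.1])).continuousOn

lemma branchLoop_right (h : IsDoubleBranch f p₀ τ₀ δ A B) (hf : IsHeatFlow f w₁ w₂) (hδ : δ < τ₀)
    {τ : ℝ} (hτ : τ ∈ Ico (τ₀ - δ) τ₀) :
    (branchLoop f p₀ τ₀ A B τ).right = p₀ + √(τ₀ - τ) * B (τ₀ - τ) :=
  arc_right (h.double_unscaled hτ).lt (hf.continuous_slice (by linarith [hτ.1])).continuousOn

lemma isLoopEvolution (h : IsDoubleBranch f p₀ τ₀ δ A B) (hf : IsHeatFlow f w₁ w₂) (hδ : δ < τ₀) :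
    IsLoopEvolution f (τ₀ - δ) τ₀ (branchLoop f p₀ τ₀ A B) := by
  refine ⟨fun τ hτ => ?_, fun τ hτ => (h.isUniqueLoopIn hf hδ hτ).isLoop⟩
  have ht : 0 < τ := by linarith [hτ.1]
  have hc : ConvergesTo (fun τ p => f p τ) (𝓝[Ico (τ₀ - δ) τ₀] τ) (fun p => f p τ) := by
    refine ⟨hf.continuous_slice ht, fun x => ?_⟩
    have : Tendsto (fun z : ℝ × ℝ => f z.2 z.1) (𝓝 τ ×ˢ 𝓝 x) (𝓝 (f x τ)) := by
      rw [← nhds_prod_eq]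
      exact (hf.continuousAt x ht).comp
        (f := fun z : ℝ × ℝ => (z.2, z.1)) (x := (τ, x)) (by fun_prop)
    exact this.mono_left (Filter.prod_mono nhdsWithin_le_nhds le_rfl)
  have hcont : ContinuousOn (fun τ => (A (τ₀ - τ), B (τ₀ - τ))) (Ico (τ₀ - δ) τ₀) :=
    (h.continuousOn hf hδ).comp (f := fun τ => τ₀ - τ) (by fun_prop)
      fun τ hτ => ⟨by linarith [hτ.2], by linarith [hτ.1]⟩
  have hend (C : ℝ → ℝ) (hC : ContinuousOn (fun τ => C (τ₀ - τ)) (Ico (τ₀ - δ) τ₀)) :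
      ContinuousOn (fun τ => p₀ + √(τ₀ - τ) * C (τ₀ - τ)) (Ico (τ₀ - δ) τ₀) :=
    continuousOn_const.add (ContinuousOn.mul (by fun_prop) hC)
  refine hc.tendsto_curve ?_ (h.isUniqueLoopIn hf hδ hτ).isLoop.restriction ?_ ?_
  · filter_upwards [self_mem_nhdsWithin] with t ht using (h.isUniqueLoopIn hf hδ ht).isLoop.restriction
  · rw [h.branchLoop_left hf hδ hτ]
    refine (hend A hcont.fst τ hτ).congr' ?_
    filter_upwards [self_mem_nhdsWithin] with t ht using (h.branchLoop_left hf hδ ht).symm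
  · rw [h.branchLoop_right hf hδ hτ]
    refine (hend B hcont.snd τ hτ).congr' ?_
    filter_upwards [self_mem_nhdsWithin] with t ht using (h.branchLoop_right hf hδ ht).symm

lemma tendsto_sqrt_sub (τ₀ : ℝ) : Tendsto (fun τ => √(τ₀ - τ)) (𝓝[<] τ₀) (𝓝 0) := by
  have : Continuous fun τ => √(τ₀ - τ) := by fun_prop
  simpa using (this.tendsto τ₀).mono_left nhdsWithin_le_nhds

lemma diesAt (h : IsDoubleBranch f p₀ τ₀ δ A B) (hf : IsHeatFlow f w₁ w₂) (hδ0 : 0 < δ)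
    (hδ : δ < τ₀) : DiesAt f (τ₀ - δ) (branchLoop f p₀ τ₀ A B) p₀ τ₀ := by
  have hlt : τ₀ - δ < τ₀ := by linarith
  have hmem : ∀ᶠ τ in 𝓝[<] τ₀, τ ∈ Ico (τ₀ - δ) τ₀ := by
    rw [← nhdsWithin_Ico_eq_nhdsLT hlt]; exact self_mem_nhdsWithin
  have hs (τ : ℝ) (hτ : τ ∈ Ico (τ₀ - δ) τ₀) : τ₀ - τ ∈ Ioc 0 δ :=
    ⟨by linarith [hτ.2], by linarith [hτ.1]⟩
  have hleft : Tendsto (fun τ => (branchLoop f p₀ τ₀ A B τ).left) (𝓝[<] τ₀) (𝓝 p₀) := by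
    have h1 : Tendsto (fun τ => p₀ - 2 * √(τ₀ - τ)) (𝓝[<] τ₀) (𝓝 p₀) := by
      simpa using ((tendsto_sqrt_sub τ₀).const_mul 2).const_sub p₀
    refine tendsto_of_tendsto_of_tendsto_of_le_of_le' h1 tendsto_const_nhds ?_ ?_
    · filter_upwards [hmem] with τ hτ
      rw [h.branchLoop_left hf hδ hτ]
      nlinarith [Real.sqrt_nonneg (τ₀ - τ), (h.left_mem _ (hs τ hτ)).1]
    · filter_upwards [hmem] with τ hτ
      rw [h.branchLoop_left hf hδ hτ]
      nlinarith [Real.sqrt_nonneg (τ₀ - τ), (h.left_mem _ (hs τ hτ)).2]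
  have hlen : Tendsto (fun τ => (branchLoop f p₀ τ₀ A B τ).right -
      (branchLoop f p₀ τ₀ A B τ).left) (𝓝[<] τ₀) (𝓝 0) := by
    have h1 : Tendsto (fun τ => 4 * √(τ₀ - τ)) (𝓝[<] τ₀) (𝓝 0) := by
      simpa using (tendsto_sqrt_sub τ₀).const_mul 4
    refine squeeze_zero' ?_ ?_ h1
    · filter_upwards with τ using sub_nonneg.2 (branchLoop f p₀ τ₀ A B τ).left_lt_right.le
    · filter_upwards [hmem] with τ hτ
      rw [h.branchLoop_left hf hδ hτ, h.branchLoop_right hf hδ hτ]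
      nlinarith [Real.sqrt_nonneg (τ₀ - τ), (h.left_mem _ (hs τ hτ)).1,
        (h.right_mem _ (hs τ hτ)).2]
  refine ⟨h.isLoopEvolution hf hδ, ?_, hleft, hlen⟩
  refine vanishesAfter_of_unique hlt (h.isLoopEvolution hf hδ)
    (fun τ hτ => h.isUniqueLoopIn hf hδ hτ) (by fun_prop) (by fun_prop) (fun τ hτ => ?_) hlen
  have h0 : 0 < √(τ₀ - τ) := Real.sqrt_pos.2 (hs τ hτ).1
  rw [h.branchLoop_left hf hδ hτ, h.branchLoop_right hf hδ hτ]
  constructor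
  · nlinarith [(h.left_mem _ (hs τ hτ)).1]
  · nlinarith [(h.right_mem _ (hs τ hτ)).2]

/-- The branch comes from one frame, but double points do not depend on c, so the same A, B and δ
serve all natural frames. -/
lemma rescaled_isUniqueLoopIn (h : IsDoubleBranch f p₀ τ₀ δ A B) (hf : IsHeatFlow f w₁ w₂)
    (hδ : δ < τ₀) {c : ℂ} (hc : c ≠ 0) {s : ℝ} (hs : s ∈ Ioc 0 δ) :
    IsUniqueLoopIn (rescaled f c p₀ τ₀ s) (Icc (-2) 2)
      (arc (rescaled f c p₀ τ₀ s) (A s) (B s)) ∧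
    (arc (rescaled f c p₀ τ₀ s) (A s) (B s)).left = A s ∧
    (arc (rescaled f c p₀ τ₀ s) (A s) (B s)).right = B s := by
  have hd := (h.double s hs).congr (rescaled_eq_iff (p₀ := p₀) (τ₀ := τ₀) hc hs.1)
  have hcont : Continuous (rescaled f c p₀ τ₀ s) := by
    have h1 : Continuous fun P => f (p₀ + √s * P) (τ₀ - s) :=
      (hf.continuous_slice (by linarith [hs.2])).comp (by fun_prop)
    have h2 : Continuous fun P => c * (f (p₀ + √s * P) (τ₀ - s) - f p₀ τ₀) :=
      continuous_const.mul (h1.sub continuous_const)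
    exact Complex.equivRealProdCLM.symm.continuous.comp
      ((continuous_const.mul (Complex.continuous_re.comp h2)).prodMk
        (continuous_const.mul (Complex.continuous_im.comp h2)))
  exact ⟨hd.isUniqueLoopIn_arc hcont.continuousOn, arc_left hd.lt hcont.continuousOn,
    arc_right hd.lt hcont.continuousOn⟩

end IsDoubleBranch

lemma isUniqueLoopIn_limitLoop {a b : ℝ} (ha : a ≠ 0) (hb : b ≠ 0) :
    IsUniqueLoopIn (limitCurve a b) univ (limitLoop a b) :=
  (isUniqueDouble_limitCurve ha hb).isUniqueLoopIn rfl rfl fun _ => rfl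

lemma IsDoubleBranch.tendsto_rescaled {δ : ℝ} {A B : ℝ → ℝ} (h : IsDoubleBranch f p₀ τ₀ δ A B)
    (hf : IsHeatFlow f w₁ w₂) (hδ0 : 0 < δ) (hδ : δ < τ₀) {c : ℂ} (hc : c ≠ 0) {a b : ℝ}
    (ha : a ≠ 0) (hb : b ≠ 0)
    (hlim : ConvergesTo (rescaled f c p₀ τ₀) (𝓝[>] 0) (limitCurve a b)) :
    Tendsto (fun s => arc (rescaled f c p₀ τ₀ s) (A s) (B s)) (𝓝[>] 0) (𝓝 (limitLoop a b)) := by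
  have hmem : ∀ᶠ s in 𝓝[>] (0 : ℝ), s ∈ Ioc 0 δ := Ioc_mem_nhdsGT hδ0
  have hd := isUniqueDouble_limitCurve ha hb
  have hend : Tendsto (fun s => (A s, B s)) (𝓝[>] 0) (𝓝 (-√3, √3)) := by
    refine hlim.tendsto_double (K := Icc (-1.8) (-1.6) ×ˢ Icc 1.6 1.8)
      (isCompact_Icc.prod isCompact_Icc) ?_ (fun y hy he => ?_)
    · filter_upwards [hmem] with s hs
      exact ⟨⟨h.left_mem s hs, h.right_mem s hs⟩, (rescaled_eq_iff hc hs.1 _ _).2 (h.double s hs).eq⟩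
    · obtain ⟨⟨h1, h2⟩, h3, h4⟩ := hy
      have := hd.unique y.1 y.2 (by linarith) (subset_univ _) he
      exact Prod.ext this.1 this.2
  refine hlim.tendsto_curve ?_ (fun _ => rfl) ?_ ?_
  · filter_upwards [hmem] with s hs using
      (h.rescaled_isUniqueLoopIn hf hδ hc hs).1.isLoop.restriction
  · refine (((continuous_fst.tendsto _).comp hend)).congr' ?_
    filter_upwards [hmem] with s hs using (h.rescaled_isUniqueLoopIn hf hδ hc hs).2.1.symm
  · refine (((continuous_snd.tendsto _).comp hend)).congr' ?_
    filter_upwards [hmem] with s hs using (h.rescaled_isUniqueLoopIn hf hδ hc hs).2.2.symm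

theorem IsHeatFlow.cusp_formation (hf : IsHeatFlow f w₁ w₂) (hp : 0 < p₀) (hτ : 0 < τ₀)
    (hsing : IsSingularity (fun p => f p τ₀) p₀)
    (hdet : jet w₁ 2 p₀ τ₀ * jet w₂ 3 p₀ τ₀ - jet w₂ 2 p₀ τ₀ * jet w₁ 3 p₀ τ₀ ≠ 0) :
    IsCuspSingularity (fun p => f p τ₀) p₀ ∧
      ∃ δ : ℝ, 0 < δ ∧ δ < τ₀ ∧
        (∃ (l r : ℝ → ℝ) (L : ℝ → Curve),
          (∀ τ ∈ Ico (τ₀ - δ) τ₀, 0 < l τ ∧ p₀ ∈ Ioo (l τ) (r τ) ∧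
            IsUniqueLoopIn (fun p => f p τ) (Icc (l τ) (r τ)) (L τ)) ∧
          MonotoneOn l (Ico (τ₀ - δ) τ₀) ∧ AntitoneOn r (Ico (τ₀ - δ) τ₀) ∧
          Tendsto l (𝓝[<] τ₀) (𝓝 p₀) ∧ Tendsto r (𝓝[<] τ₀) (𝓝 p₀) ∧
          DiesAt f (τ₀ - δ) L p₀ τ₀) ∧
        ∀ (c : ℂ) (a b : ℕ → ℝ), IsNaturalFrame (fun p => f p τ₀) p₀ c a b →
          IsUniqueLoopIn (limitCurve (a 2) (b 3)) univ (limitLoop (a 2) (b 3)) ∧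
          ∃ Lhat : ℝ → Curve,
            (∀ s ∈ Ioc 0 δ, IsUniqueLoopIn (rescaled f c p₀ τ₀ s) (Icc (-2) 2) (Lhat s)) ∧
            Tendsto Lhat (𝓝[>] 0) (𝓝 (limitLoop (a 2) (b 3))) := by
  obtain ⟨h1, h2⟩ := hf.jet_one_eq_zero hτ hsing
  obtain ⟨c, hc, hstr⟩ := hf.exists_straight hτ h1 h2 hdet
  have hc0 : c ≠ 0 := norm_ne_zero_iff.1 (by rw [hc]; norm_num)
  obtain ⟨a, b, hab⟩ := exists_isNaturalFrame (hf.mul_left c) hc hτ hstr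
  obtain ⟨δ, A, B, hδ0, hδ, hδp, hbr⟩ := (hf.mul_left c).exists_isDoubleBranch hc0 hp hτ hstr
  refine ⟨⟨hsing, hf.analyticAt hτ, c, a, b, hab⟩, δ, hδ0, hδ, ⟨fun τ => p₀ - 2 * √(τ₀ - τ),
    fun τ => p₀ + 2 * √(τ₀ - τ), branchLoop f p₀ τ₀ A B, fun τ hτ' => ⟨?_, ⟨?_, ?_⟩,
      hbr.isUniqueLoopIn hf hδ hτ'⟩, ?_, ?_, ?_, ?_, hbr.diesAt hf hδ0 hδ⟩, ?_⟩
  · have : √(τ₀ - τ) ≤ √δ := Real.sqrt_le_sqrt (by linarith [hτ'.1])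
    simp only; linarith
  · have : 0 < √(τ₀ - τ) := Real.sqrt_pos.2 (by linarith [hτ'.2])
    simp only; linarith
  · have : 0 < √(τ₀ - τ) := Real.sqrt_pos.2 (by linarith [hτ'.2])
    simp only; linarith
  · intro s _ t _ hst
    have : √(τ₀ - t) ≤ √(τ₀ - s) := Real.sqrt_le_sqrt (by linarith)
    simp only; linarith
  · intro s _ t _ hst
    have : √(τ₀ - t) ≤ √(τ₀ - s) := Real.sqrt_le_sqrt (by linarith)
    simp only; linarith
  · simpa using ((IsDoubleBranch.tendsto_sqrt_sub τ₀).const_mul 2).const_sub p₀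
  · simpa using ((IsDoubleBranch.tendsto_sqrt_sub τ₀).const_mul 2).const_add p₀
  · intro c' a' b' hF
    have hc0' : c' ≠ 0 := norm_ne_zero_iff.1 (by rw [hF.norm_eq_one]; norm_num)
    have hfc := hf.mul_left c'
    obtain ⟨hstr', ha, hb⟩ := straight_of_isNaturalFrame hfc hτ hF
    refine ⟨isUniqueLoopIn_limitLoop hF.a_two hF.b_three,
      fun s => arc (rescaled f c' p₀ τ₀ s) (A s) (B s),
      fun s hs => (hbr.rescaled_isUniqueLoopIn hf hδ hc0' hs).1,
      hbr.tendsto_rescaled hf hδ0 hδ hc0' hF.a_two hF.b_three ?_⟩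
    rw [ha, hb]
    exact convergesTo_rescaled hfc.fst hfc.snd hfc.eq hτ hstr'.u_one hstr'.v_one hstr'.v_two

end Cusp

end CongaLoop

namespace CongaLoop

/-! ### Nondegeneracy of the jets of ramp functions -/

/-- The derivatives in `p` of the unnormalised heat kernel. -/
noncomputable def jetKernel : ℕ → ℝ → ℝ → ℝ → ℝ
  | 0, p, τ, t => momentKernel 0 p τ t
  | 1, p, τ, t => -τ⁻¹ * momentKernel 1 p τ t
  | 2, p, τ, t => τ⁻¹ ^ 2 * momentKernel 2 p τ t - τ⁻¹ * momentKernel 0 p τ t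
  | 3, p, τ, t => -τ⁻¹ ^ 3 * momentKernel 3 p τ t + 3 * τ⁻¹ ^ 2 * momentKernel 1 p τ t
  | _, _, _, _ => 0

lemma jet_eq_integral {w : ℝ → ℝ} (hw : Tempered w) {j : ℕ} (hj : j ≤ 3) (p : ℝ) {τ : ℝ}
    (hτ : 0 < τ) : jet w j p τ = heatNorm τ * ∫ t, jetKernel j p τ t * w t := by
  have hi (n : ℕ) (c : ℝ) := (hw.integrable_moment n p hτ).const_mul c
  interval_cases j
  · rfl
  · simp only [jet, jetKernel, moment, mul_assoc, integral_const_mul]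
  · simp only [jet, jetKernel, moment, sub_mul, mul_assoc]
    rw [integral_sub (hi _ _) (hi _ _), integral_const_mul, integral_const_mul]
  · simp only [jet, jetKernel, moment, add_mul, mul_assoc]
    rw [integral_add (hi _ _) ((hi _ _).const_mul _), integral_const_mul, integral_const_mul,
      integral_const_mul]

lemma hasDerivAt_momentKernel (n : ℕ) (p τ t : ℝ) :
    HasDerivAt (momentKernel n p τ)
      (τ⁻¹ * momentKernel (n + 1) p τ t - n * momentKernel (n - 1) p τ t) t := by
  unfold momentKernel
  have h1 : HasDerivAt (fun t => p - t) (-1) t := by simpa using (hasDerivAt_id t).const_sub p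
  have h2 := (h1.pow n).mul (((h1.pow 2).neg.div_const (2 * τ)).exp)
  refine h2.congr_deriv ?_
  simp
  rcases eq_or_ne τ 0 with rfl | hτ
  · simp
  · field_simp; ring

/-- The kernel depends on p - t only, so differentiating in t is minus differentiating in p. -/
lemma hasDerivAt_jetKernel {j : ℕ} (hj : j < 3) (p τ t : ℝ) :
    HasDerivAt (jetKernel j p τ) (-jetKernel (j + 1) p τ t) t := by
  have h (n) := hasDerivAt_momentKernel n p τ t
  interval_cases j
  · refine (h 0).congr_deriv ?_
    simp [jetKernel]
  · refine ((h 1).const_mul (-τ⁻¹)).congr_deriv ?_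
    simp [jetKernel]; ring
  · refine (((h 2).const_mul (τ⁻¹ ^ 2)).sub ((h 0).const_mul τ⁻¹)).congr_deriv ?_
    simp [jetKernel]; ring

lemma abs_jetKernel_le {j : ℕ} (hj : j ≤ 3) (p : ℝ) {τ : ℝ} (hτ : 0 < τ) :
    ∃ C, ∀ t, |jetKernel j p τ t| ≤ C * Real.exp (-|t|) := by
  have h (n : ℕ) : ∃ C, ∀ t, |momentKernel n p τ t| ≤ C * Real.exp (-|t|) :=
    ⟨_, abs_momentKernel_le n le_rfl hτ le_rfl⟩
  have hlin (a b : ℝ) (m n : ℕ) : ∃ C, ∀ t,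
      |a * momentKernel m p τ t + b * momentKernel n p τ t| ≤ C * Real.exp (-|t|) := by
    obtain ⟨C, hC⟩ := h m
    obtain ⟨D, hD⟩ := h n
    refine ⟨|a| * C + |b| * D, fun t => (abs_add_le _ _).trans ?_⟩
    rw [abs_mul, abs_mul, add_mul, mul_assoc, mul_assoc]
    exact add_le_add (mul_le_mul_of_nonneg_left (hC t) (abs_nonneg _))
      (mul_le_mul_of_nonneg_left (hD t) (abs_nonneg _))
  interval_cases j
  · exact h 0
  · simpa [jetKernel] using hlin (-τ⁻¹) 0 1 0
  · simpa only [jetKernel, sub_eq_add_neg, neg_mul] using hlin (τ⁻¹ ^ 2) (-τ⁻¹) 2 0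
  · exact hlin (-τ⁻¹ ^ 3) (3 * τ⁻¹ ^ 2) 3 1

lemma continuous_jetKernel {j : ℕ} (hj : j ≤ 3) (p τ : ℝ) : Continuous (jetKernel j p τ) := by
  have h := fun n => continuous_momentKernel n p τ
  interval_cases j <;> unfold jetKernel <;> fun_prop

/-- The function that vanishes up to time `k` and grows linearly to `1` on `[k, k + 1]`. -/
noncomputable def ramp (k t : ℝ) : ℝ := max 0 (min 1 (t - k))

lemma continuous_ramp (k : ℝ) : Continuous (ramp k) := by unfold ramp; fun_prop

lemma integrable_exp_neg_mul_abs {b : ℝ} (hb : 0 < b) :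
    Integrable fun t : ℝ => Real.exp (-b * |t|) := by
  have h1 : IntegrableOn (fun t : ℝ => Real.exp (-b * |t|)) (Ioi 0) :=
    (exp_neg_integrableOn_Ioi 0 hb).congr_fun (fun t ht => by rw [abs_of_pos ht]) measurableSet_Ioi
  have h2 : IntegrableOn (fun t : ℝ => Real.exp (-b * |t|)) (Ici (-0)) := by
    rw [neg_zero]; exact (integrableOn_Ici_iff_integrableOn_Ioi (by simp)).2 h1
  have h3 := h2.comp_neg_Iic
  simp only [abs_neg] at h3
  rw [← integrableOn_univ, ← Iic_union_Ioi (a := (0 : ℝ))]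
  exact h3.union h1

lemma integrable_exp_neg_abs : Integrable fun t : ℝ => Real.exp (-|t|) := by
  simpa using integrable_exp_neg_mul_abs one_pos

lemma tempered_ramp (k : ℝ) : Tempered (ramp k) := by
  have := continuous_ramp k
  refine integrable_exp_neg_abs.mono' (Continuous.aestronglyMeasurable (by fun_prop)) ?_
  filter_upwards with t
  rw [norm_mul, Real.norm_eq_abs, Real.abs_exp, Real.norm_eq_abs]
  refine mul_le_of_le_one_right (by positivity) (abs_le.2 ⟨?_, ?_⟩)
  · linarith [le_max_left 0 (min 1 (t - k)), show ramp k t = max 0 (min 1 (t - k)) from rfl]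
  · exact max_le zero_le_one (min_le_left _ _)

/-- Integration by parts against a ramp. -/
lemma jet_ramp {j : ℕ} (hj : j < 3) (k p : ℝ) {τ : ℝ} (hτ : 0 < τ) :
    jet (ramp k) (j + 1) p τ = heatNorm τ * ∫ t in k..(k + 1), jetKernel j p τ t := by
  rw [jet_eq_integral (tempered_ramp k) (by omega) p hτ]
  congr 1
  set Ψ := jetKernel j p τ
  set K := jetKernel (j + 1) p τ
  have hΨc : Continuous Ψ := continuous_jetKernel (by omega) p τ
  have hKc : Continuous K := continuous_jetKernel (by omega) p τ
  obtain ⟨C, hC⟩ := abs_jetKernel_le (by omega : j ≤ 3) p hτ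
  obtain ⟨D, hD⟩ := abs_jetKernel_le (by omega : j + 1 ≤ 3) p hτ
  have hd (t) : HasDerivAt Ψ (-K t) t := hasDerivAt_jetKernel hj p τ t
  have hKi : Integrable K := (integrable_exp_neg_abs.const_mul D).mono' hKc.aestronglyMeasurable
    (Eventually.of_forall hD)
  have hint : Integrable fun t => K t * ramp k t := (tempered_ramp k).integrable_of_le hKc hD
  have hΨ0 : Tendsto Ψ atTop (𝓝 0) := by
    refine squeeze_zero_norm hC ?_
    have : Tendsto (fun t : ℝ => Real.exp (-|t|)) atTop (𝓝 0) :=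
      Real.tendsto_exp_atBot.comp (tendsto_neg_atTop_atBot.comp tendsto_abs_atTop_atTop)
    simpa using this.const_mul C
  have s1 : ∫ t, K t * ramp k t = ∫ t in Ioi k, K t * ramp k t := by
    refine (setIntegral_eq_integral_of_forall_compl_eq_zero fun t ht => ?_).symm
    have : t ≤ k := not_lt.1 ht
    rw [ramp, max_eq_left ((min_le_right _ _).trans (by linarith)), mul_zero]
  have s2 : ∫ t in Ioi k, K t * ramp k t =
      (∫ t in k..(k + 1), K t * (t - k)) + ∫ t in Ioi (k + 1), K t := by
    rw [← Ioc_union_Ioi_eq_Ioi (by linarith : k ≤ k + 1), setIntegral_union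
      (Ioc_disjoint_Ioi le_rfl) measurableSet_Ioi hint.integrableOn hint.integrableOn,
      intervalIntegral.integral_of_le (by linarith)]
    congr 1
    · refine setIntegral_congr_fun measurableSet_Ioc fun t ht => ?_
      simp only [ramp]
      rw [min_eq_right (by linarith [ht.2]), max_eq_right (by linarith [ht.1])]
    · refine setIntegral_congr_fun measurableSet_Ioi fun t ht => ?_
      simp only [ramp]
      rw [min_eq_left (by linarith [mem_Ioi.1 ht]), max_eq_right zero_le_one, mul_one]
  have s3 : ∫ t in Ioi (k + 1), K t = Ψ (k + 1) := by
    have := integral_Ioi_of_hasDerivAt_of_tendsto' (a := k + 1) (f := fun t => -Ψ t) (f' := K)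
      (m := 0) (fun t _ => (hd t).neg.congr_deriv (neg_neg _)) hKi.integrableOn (by simpa using hΨ0.neg)
    simpa using this
  -- The primitive -(Ψ t)(t - k) performs the integration by parts; its boundary value cancels the
  -- tail `s3`.
  have s4 : ∫ t in k..(k + 1), (K t * (t - k) - Ψ t) = -Ψ (k + 1) := by
    have := intervalIntegral.integral_eq_sub_of_hasDerivAt (a := k) (b := k + 1)
      (f := fun t => -(Ψ t * (t - k))) (f' := fun t => K t * (t - k) - Ψ t)
      (fun t _ => (((hd t).mul ((hasDerivAt_id t).sub_const k)).neg).congr_deriv (by simp; ring))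
      (Continuous.intervalIntegrable (by fun_prop) _ _)
    simpa using this
  rw [intervalIntegral.integral_sub (Continuous.intervalIntegrable (by fun_prop) _ _)
    (hΨc.intervalIntegrable _ _)] at s4
  rw [s1, s2, s3]
  linarith

/-- Rolle's theorem for the primitive. -/
lemma exists_zero_of_intervalIntegral_eq_zero {Ψ : ℝ → ℝ} (hΨ : Continuous Ψ) {a b : ℝ} (hab : a < b)
    (h : ∫ t in a..b, Ψ t = 0) : ∃ t ∈ Ioo a b, Ψ t = 0 := by
  have hd (x : ℝ) : HasDerivAt (fun x => ∫ t in a..x, Ψ t) (Ψ x) x :=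
    (hΨ.integral_hasStrictDerivAt a x).hasDerivAt
  exact exists_hasDerivAt_eq_zero hab (fun x _ => (hd x).continuousAt.continuousWithinAt)
    (by simp [h]) fun x _ => hd x

/-- The matrix of the first three space derivatives of the heat extensions of three ramps. -/
noncomputable def rampMatrix (p τ : ℝ) : Matrix (Fin 3) (Fin 3) ℝ :=
  .of fun j k => jet (ramp (k : ℕ)) (j + 1) p τ

/-- A linear relation α between the rows, after integration by parts, says that a Gaussian times a
fixed polynomial of degree at most two in p - t integrates to zero over [0, 1], [1, 2] and [2, 3].
The polynomial then has a zero in each open interval, so it vanishes identically and α = 0. -/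
lemma det_rampMatrix_ne_zero (p : ℝ) {τ : ℝ} (hτ : 0 < τ) : (rampMatrix p τ).det ≠ 0 := by
  intro hdet
  obtain ⟨α, hα, h0⟩ := Matrix.exists_vecMul_eq_zero_iff.2 hdet
  have hN : heatNorm τ ≠ 0 := inv_ne_zero (Real.sqrt_pos.2 (by positivity)).ne'
  have hz (k : Fin 3) : ∃ x, p - x ∈ Ioo ((k : ℕ) : ℝ) ((k : ℕ) + 1) ∧
      (α 0 - α 2 * τ⁻¹) + (-α 1 * τ⁻¹) * x + (α 2 * τ⁻¹ ^ 2) * x ^ 2 = 0 := by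
    have hk := congrFun h0 k
    have hi (j : ℕ) (hj : j ≤ 3) : IntervalIntegrable (jetKernel j p τ) volume
        ((k : ℕ) : ℝ) ((k : ℕ) + 1) := (continuous_jetKernel hj p τ).intervalIntegrable _ _
    have hsum : ∫ t in ((k : ℕ) : ℝ)..((k : ℕ) + 1), (α 0 * jetKernel 0 p τ t +
        α 1 * jetKernel 1 p τ t + α 2 * jetKernel 2 p τ t) = 0 := by
      rw [intervalIntegral.integral_add (((hi 0 (by norm_num)).const_mul _).add
        ((hi 1 (by norm_num)).const_mul _)) ((hi 2 (by norm_num)).const_mul _),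
        intervalIntegral.integral_add ((hi 0 (by norm_num)).const_mul _)
          ((hi 1 (by norm_num)).const_mul _), intervalIntegral.integral_const_mul,
        intervalIntegral.integral_const_mul, intervalIntegral.integral_const_mul]
      simp only [Matrix.vecMul, dotProduct, Fin.sum_univ_three, rampMatrix, Matrix.of_apply,
        Fin.val_zero, Fin.val_one, Fin.val_two, Pi.zero_apply] at hk
      rw [jet_ramp (by norm_num) _ _ hτ, jet_ramp (by norm_num) _ _ hτ,
        jet_ramp (by norm_num) _ _ hτ] at hk
      refine (mul_eq_zero.1 (?_ : heatNorm τ * _ = 0)).resolve_left hN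
      rw [← hk]; ring
    have hc0 := continuous_jetKernel (by norm_num : 0 ≤ 3) p τ
    have hc1 := continuous_jetKernel (by norm_num : 1 ≤ 3) p τ
    have hc2 := continuous_jetKernel (by norm_num : 2 ≤ 3) p τ
    obtain ⟨t, ht, h⟩ := exists_zero_of_intervalIntegral_eq_zero (by fun_prop) (by linarith) hsum
    refine ⟨p - t, by simpa using ht, ?_⟩
    refine (mul_eq_zero.1 (?_ : _ * Real.exp (-(p - t) ^ 2 / (2 * τ)) = 0)).resolve_right
      (Real.exp_pos _).ne'
    rw [← h]
    simp only [jetKernel, momentKernel]; ring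
  obtain ⟨x, hx, ex⟩ := hz 0
  obtain ⟨y, hy, ey⟩ := hz 1
  obtain ⟨z, hz, ez⟩ := hz 2
  have i0 : x ≠ y := by
    have h1 := hx.2; have h2 := hy.1; norm_num at h1 h2; intro h; linarith
  have i1 : y ≠ z := by
    have h1 := hy.2; have h2 := hz.1; norm_num at h1 h2; intro h; linarith
  have i2 : x ≠ z := by
    have h1 := hx.2; have h2 := hz.1; norm_num at h1 h2; intro h; linarith
  generalize hA : α 2 * τ⁻¹ ^ 2 = A at ex ey ez
  generalize hB : -α 1 * τ⁻¹ = B at ex ey ez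
  generalize hC : α 0 - α 2 * τ⁻¹ = C at ex ey ez
  have j1 : B + A * (x + y) = 0 :=
    (mul_eq_zero.1 (by linear_combination ex - ey : (x - y) * (B + A * (x + y)) = 0)).resolve_left
      (sub_ne_zero.2 i0)
  have j2 : B + A * (x + z) = 0 :=
    (mul_eq_zero.1 (by linear_combination ex - ez : (x - z) * (B + A * (x + z)) = 0)).resolve_left
      (sub_ne_zero.2 i2)
  have A0 : A = 0 :=
    (mul_eq_zero.1 (by linear_combination j1 - j2 : (y - z) * A = 0)).resolve_left
      (sub_ne_zero.2 i1)
  have B0 : B = 0 := by simpa [A0] using j1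
  have C0 : C = 0 := by simpa [A0, B0] using ex
  have hτi : τ⁻¹ ≠ 0 := inv_ne_zero hτ.ne'
  have a2 : α 2 = 0 := (mul_eq_zero.1 (hA.trans A0)).resolve_right (pow_ne_zero 2 hτi)
  have a1 : α 1 = 0 := neg_eq_zero.1 ((mul_eq_zero.1 (hB.trans B0)).resolve_right hτi)
  have a0 : α 0 = 0 := by rw [a2, C0] at hC; simpa using hC
  refine hα (funext fun i => ?_)
  fin_cases i
  exacts [a0, a1, a2]

/-! ### Degenerate perturbations form a null set -/

lemma differentiableAt_det {E : Type*} [NormedAddCommGroup E] [NormedSpace ℝ E] {n : ℕ}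
    {M : E → Matrix (Fin n) (Fin n) ℝ} {x : E}
    (hM : ∀ i j, DifferentiableAt ℝ (fun x => M x i j) x) :
    DifferentiableAt ℝ (fun x => (M x).det) x := by
  simp only [Matrix.det_apply, Units.smul_def, zsmul_eq_mul]
  refine DifferentiableAt.fun_sum fun s _ => DifferentiableAt.const_mul ?_ _
  have := (HasFDerivAt.finsetProd (u := Finset.univ) fun i _ =>
    (hM (s i) i).hasFDerivAt).differentiableAt
  convert this using 1

/-- The path `v` perturbed by a combination of ramps. -/
noncomputable def perturb (v : ℝ → ℝ) (g : Fin 3 → ℝ) (t : ℝ) : ℝ :=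
  v t + ∑ k, g k * ramp (k : ℕ) t

lemma Tempered.perturb {v : ℝ → ℝ} (hv : Tempered v) (g : Fin 3 → ℝ) :
    Tempered (perturb v g) := by
  have := hv.add ((((tempered_ramp 0).const_mul (g 0)).add
    ((tempered_ramp 1).const_mul (g 1))).add ((tempered_ramp 2).const_mul (g 2)))
  have e : CongaLoop.perturb v g =
      fun t => v t + (g 0 * ramp 0 t + g 1 * ramp 1 t + g 2 * ramp 2 t) := by
    ext t; simp [CongaLoop.perturb, Fin.sum_univ_three]
  rwa [e]

lemma jet_perturb {v : ℝ → ℝ} (hv : Tempered v) (g : Fin 3 → ℝ) (j : ℕ) (p : ℝ) {τ : ℝ}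
    (hτ : 0 < τ) :
    jet (perturb v g) j p τ = jet v j p τ + ∑ k, g k * jet (ramp (k : ℕ)) j p τ := by
  have e : perturb v g = fun t => v t + (g 0 * ramp 0 t + g 1 * ramp 1 t + g 2 * ramp 2 t) := by
    ext t; simp [perturb, Fin.sum_univ_three]
  have h0 := (tempered_ramp 0).const_mul (g 0)
  have h1 := (tempered_ramp 1).const_mul (g 1)
  have h2 := (tempered_ramp 2).const_mul (g 2)
  rw [e, jet_add hv ((h0.add h1).add h2) _ _ hτ, jet_add (h0.add h1) h2 _ _ hτ,
    jet_add h0 h1 _ _ hτ]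
  simp [jet_const_mul, Fin.sum_univ_three]

/-- The paths `w₁`, `w₂` have a singularity that is not a cusp, at the place `p` and time `τ`. -/
def IsDegenerate (w₁ w₂ : ℝ → ℝ) (p τ : ℝ) : Prop :=
  jet w₁ 1 p τ = 0 ∧ jet w₂ 1 p τ = 0 ∧
    jet w₁ 2 p τ * jet w₂ 3 p τ - jet w₂ 2 p τ * jet w₁ 3 p τ = 0

/-- Cramer's solution of `rampMatrix p τ *ᵥ g = b - jet v`. -/
noncomputable def solvePerturb (v : ℝ → ℝ) (p τ : ℝ) (b : Fin 3 → ℝ) (i : Fin 3) : ℝ :=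
  (rampMatrix p τ).det⁻¹ *
    ((rampMatrix p τ).updateCol i fun j => b j - jet v (j + 1) p τ).det

/-- The ramp weights can be recovered from (p, τ) and the first three derivatives of the perturbed
path there. This bounds the dimension of the set of weights producing prescribed derivatives. -/
lemma solvePerturb_eq {v : ℝ → ℝ} (hv : Tempered v) (g : Fin 3 → ℝ) (p : ℝ) {τ : ℝ} (hτ : 0 < τ) :
    solvePerturb v p τ (fun j => jet (perturb v g) (j + 1) p τ) = g := by
  have hdet := det_rampMatrix_ne_zero p hτ
  have e : (fun j : Fin 3 => jet (perturb v g) (j + 1) p τ - jet v (j + 1) p τ) =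
      (rampMatrix p τ).mulVec g := by
    ext j
    rw [jet_perturb hv _ _ _ hτ, add_sub_cancel_left]
    simp [Matrix.mulVec, dotProduct, rampMatrix, mul_comm]
  ext i
  rw [solvePerturb, e, ← Matrix.cramer_apply, Matrix.cramer_eq_adjugate_mulVec, Matrix.mulVec_mulVec,
    Matrix.adjugate_mul, Matrix.smul_mulVec, Matrix.one_mulVec, Pi.smul_apply, smul_eq_mul,
    inv_mul_cancel_left₀ hdet]

lemma differentiableAt_solvePerturb {E : Type*} [NormedAddCommGroup E] [NormedSpace ℝ E]
    {v : ℝ → ℝ} (hv : Tempered v) {p τ : E → ℝ} {b : Fin 3 → E → ℝ} {x : E}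
    (hp : DifferentiableAt ℝ p x) (hτ : DifferentiableAt ℝ τ x)
    (hb : ∀ j, DifferentiableAt ℝ (b j) x) (hτ0 : 0 < τ x) (i : Fin 3) :
    DifferentiableAt ℝ (fun x => solvePerturb v (p x) (τ x) (fun j => b j x) i) x := by
  have hj {w : ℝ → ℝ} (hw : Tempered w) (j : Fin 3) :
      DifferentiableAt ℝ (fun x => jet w (j + 1) (p x) (τ x)) x :=
    (differentiableAt_jet hw (by omega) (p x) hτ0).comp x (f := fun x => (p x, τ x)) (hp.prodMk hτ)
  have hM (j k : Fin 3) : DifferentiableAt ℝ (fun x => rampMatrix (p x) (τ x) j k) x :=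
    hj (tempered_ramp _) j
  refine ((differentiableAt_det hM).inv (det_rampMatrix_ne_zero _ hτ0)).mul
    (differentiableAt_det fun j k => ?_)
  simp only [Matrix.updateCol_apply]
  split_ifs
  · exact (hb j).sub (hj hv j)
  · exact hM j k

/-- Coefficients of ramps for two paths. -/
abbrev RampCoeff := (Fin 3 → ℝ) × (Fin 3 → ℝ)

/-- A differentiable map sends null sets to null sets in the same dimension. The five parameters of
a degenerate singularity are therefore padded with a sixth coordinate equal to 0, and S is a null
subset of ℝ⁶. -/
lemma volume_degenerate_eq_zero {v₁ v₂ : ℝ → ℝ} (h₁ : Tempered v₁) (h₂ : Tempered v₂) :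
    ((volume : Measure (Fin 3 → ℝ)).prod (volume : Measure (Fin 3 → ℝ)))
      {g : RampCoeff | ∃ p τ, 0 < τ ∧ IsDegenerate (perturb v₁ g.1) (perturb v₂ g.2) p τ} = 0 := by
  set μ : Measure RampCoeff := (volume : Measure (Fin 3 → ℝ)).prod (volume : Measure (Fin 3 → ℝ))
    with hμ
  have : μ.IsAddHaarMeasure := Measure.prod.instIsAddHaarMeasure _ _
  set S : Set RampCoeff := {x | 0 < x.1 1 ∧ x.2 2 = 0} with hS
  have hS0 : μ S = 0 := by
    set F : Submodule ℝ RampCoeff := LinearMap.ker (LinearMap.proj (2 : Fin 3) ∘ₗ LinearMap.snd ℝ (Fin 3 → ℝ) (Fin 3 → ℝ))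
    have hF : F ≠ ⊤ := fun h => by
      have : ((0, 1) : RampCoeff) ∈ F := h ▸ Submodule.mem_top
      simp [F] at this
    refine measure_mono_null (fun x hx => ?_) (Measure.addHaar_submodule μ F hF)
    exact hx.2
  -- The coordinates of x are (p, τ, c₁) and (c₂, s, 0). The second and third derivatives of path i
  -- are prescribed as c_i (r, s), the general form of a matrix of rank at most one; r = 0 and r = 1
  -- cover all cases.
  set Θ : ℝ → RampCoeff → RampCoeff := fun r x =>
    (solvePerturb v₁ (x.1 0) (x.1 1) fun j => (![0, r * x.1 2, x.2 1 * x.1 2] : Fin 3 → ℝ) j,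
      solvePerturb v₂ (x.1 0) (x.1 1) fun j => (![0, r * x.2 0, x.2 1 * x.2 0] : Fin 3 → ℝ) j) with hΘ
  have hdiff (r : ℝ) : DifferentiableOn ℝ (Θ r) S := fun x hx => by
    refine DifferentiableAt.differentiableWithinAt ?_
    refine DifferentiableAt.prodMk (differentiableAt_pi.2 fun i => ?_)
      (differentiableAt_pi.2 fun i => ?_)
    · refine differentiableAt_solvePerturb h₁ (p := fun x : RampCoeff => x.1 0)
        (τ := fun x : RampCoeff => x.1 1) (by fun_prop) (by fun_prop) (fun j => ?_) hx.1 i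
      fin_cases j <;> simp <;> fun_prop
    · refine differentiableAt_solvePerturb h₂ (p := fun x : RampCoeff => x.1 0)
        (τ := fun x : RampCoeff => x.1 1) (by fun_prop) (by fun_prop) (fun j => ?_) hx.1 i
      fin_cases j <;> simp <;> fun_prop
  have hnull (r : ℝ) : μ (Θ r '' S) = 0 :=
    addHaar_image_eq_zero_of_differentiableOn_of_addHaar_eq_zero μ (hdiff r) hS0
  refine measure_mono_null (fun g hg => ?_) (measure_union_null (hnull 0) (hnull 1))
  obtain ⟨p, τ, hτ, d1, d2, d3⟩ := hg
  have key (r c₁ c₂ s : ℝ) (e1 : jet (perturb v₁ g.1) 2 p τ = r * c₁)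
      (e2 : jet (perturb v₁ g.1) 3 p τ = s * c₁) (e3 : jet (perturb v₂ g.2) 2 p τ = r * c₂)
      (e4 : jet (perturb v₂ g.2) 3 p τ = s * c₂) : g ∈ Θ r '' S := by
    refine ⟨(![p, τ, c₁], ![c₂, s, 0]), ⟨by simpa using hτ, by simp⟩, ?_⟩
    refine Prod.ext ?_ ?_
    · rw [← solvePerturb_eq h₁ g.1 p hτ]
      simp only [hΘ]
      congr 1; ext j
      fin_cases j <;> simp [d1, e1, e2]
    · rw [← solvePerturb_eq h₂ g.2 p hτ]
      simp only [hΘ]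
      congr 1; ext j
      fin_cases j <;> simp [d2, e3, e4]
  by_cases h1 : jet (perturb v₁ g.1) 2 p τ = 0
  · by_cases h2 : jet (perturb v₂ g.2) 2 p τ = 0
    -- Both second derivatives vanish: direction (0, 1), with the third derivatives as multipliers.
    · exact Or.inl (key 0 (jet (perturb v₁ g.1) 3 p τ) (jet (perturb v₂ g.2) 3 p τ) 1
        (by simp [h1]) (by simp) (by simp [h2]) (by simp))
    · refine Or.inr (key 1 _ _ (jet (perturb v₂ g.2) 3 p τ / jet (perturb v₂ g.2) 2 p τ)
        (one_mul _).symm ?_ (one_mul _).symm (by field_simp))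
      rw [h1] at d3 ⊢
      simpa [h2] using d3
  · refine Or.inr (key 1 _ _ (jet (perturb v₁ g.1) 3 p τ / jet (perturb v₁ g.1) 2 p τ)
      (one_mul _).symm (by field_simp) (one_mul _).symm ?_)
    field_simp
    linarith

end CongaLoop

namespace CongaLoop

/-! ### Random paths -/

/-- The given process is continuous only almost surely and measurable only almost everywhere.
Setting it to 0 off a measurable event of full measure repairs continuity; measurability holds at a
dense sequence of times and passes to limits. -/
lemma exists_continuous_version {Ω : Type*} [MeasurableSpace Ω] {P : Measure Ω}
    {W : ℝ≥0 → Ω → ℝ} (hW : IsBrownianReal W P) :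
    ∃ W' : ℝ≥0 → Ω → ℝ, (∀ t, Measurable (W' t)) ∧ (∀ ω, Continuous (W' · ω)) ∧
      ∀ᵐ ω ∂P, ∀ t, W t ω = W' t ω := by
  set D := TopologicalSpace.denseSeq ℝ≥0
  have hm (t) : AEMeasurable (W t) P := hW.aemeasurable t
  have h : ∀ᵐ ω ∂P, Continuous (W · ω) ∧ ∀ n, W (D n) ω = (hm (D n)).mk _ ω :=
    hW.cont.and (ae_all_iff.2 fun n => (hm (D n)).ae_eq_mk)
  obtain ⟨S, hS, hSm, hSs⟩ := h.exists_measurable_mem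
  have hc (ω) : Continuous fun t => S.indicator (W t) ω := by
    by_cases hω : ω ∈ S
    · simpa [hω] using (hSs ω hω).1
    · simpa [hω] using continuous_const
  have hD (n) : Measurable (S.indicator (W (D n))) := by
    have : S.indicator (W (D n)) = S.indicator ((hm (D n)).mk _) :=
      indicator_congr fun ω hω => (hSs ω hω).2 n
    rw [this]
    exact (hm (D n)).measurable_mk.indicator hSm
  refine ⟨fun t => S.indicator (W t), fun t => ?_, hc, ?_⟩
  · obtain ⟨u, hu, hut⟩ := mem_closure_iff_seq_limit.1
      ((TopologicalSpace.denseRange_denseSeq ℝ≥0).closure_range ▸ mem_univ t)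
    choose n hn using hu
    refine measurable_of_tendsto_metrizable (f := fun k => S.indicator (W (u k)))
      (fun k => ?_) (tendsto_pi_nhds.2 fun ω => ((hc ω).tendsto t).comp hut)
    rw [← hn k]
    exact hD (n k)
  · filter_upwards [hS] with ω hω t
    simp [hω]

lemma measurable_uncurry_realPath {Ω : Type*} [MeasurableSpace Ω] {V : ℝ≥0 → Ω → ℝ}
    (hm : ∀ t, Measurable (V t)) (hc : ∀ ω, Continuous (V · ω)) :
    Measurable fun x : Ω × ℝ => realPath (V · x.1) x.2 := by
  have h1 : Measurable (Function.uncurry V) :=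
    measurable_uncurry_of_continuous_of_measurable hc hm
  exact Measurable.ite (measurableSet_lt measurable_const measurable_snd)
    (h1.comp ((measurable_real_toNNReal.comp measurable_snd).prodMk measurable_fst))
    measurable_const

lemma measurable_jet {Ω : Type*} [MeasurableSpace Ω] {V : ℝ≥0 → Ω → ℝ}
    (hm : ∀ t, Measurable (V t)) (hc : ∀ ω, Continuous (V · ω)) (j : ℕ) (p τ : ℝ) :
    Measurable fun ω => jet (realPath (V · ω)) j p τ := by
  have h (n) : Measurable fun ω => moment (realPath (V · ω)) n p τ := by
    have : StronglyMeasurable fun x : Ω × ℝ => momentKernel n p τ x.2 * realPath (V · x.1) x.2 :=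
      (((continuous_momentKernel n p τ).measurable.comp measurable_snd).mul
        (measurable_uncurry_realPath hm hc)).stronglyMeasurable
    exact this.integral_prod_right.measurable
  unfold jet
  split <;> fun_prop

lemma integral_abs_le_one_add {Ω : Type*} [MeasurableSpace Ω] {P : Measure Ω}
    [IsProbabilityMeasure P] {W : ℝ≥0 → Ω → ℝ} (hW : IsPreBrownianReal W P) (t : ℝ≥0) :
    ∫ ω, |W t ω| ∂P ≤ 1 + t := by
  have hL : MemLp (W t) 2 P := (hW.isGaussianProcess.hasGaussianLaw_eval t).memLp_two
  have h2 : ∫ ω, W t ω ^ 2 ∂P = t := by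
    have := hW.covariance_eval t t
    rw [covariance_self (hW.aemeasurable t), variance_of_integral_eq_zero (hW.aemeasurable t)
      (hW.integral_eval t)] at this
    simpa using this
  calc ∫ ω, |W t ω| ∂P ≤ ∫ ω, (1 + W t ω ^ 2) ∂P := by
        refine integral_mono (hW.integrable_eval t).abs
          ((integrable_const _).add hL.integrable_sq) fun ω => ?_
        have := sq_nonneg (|W t ω| - 1)
        have := sq_abs (W t ω)
        have := abs_nonneg (W t ω)
        simp only
        nlinarith
    _ = 1 + t := by
        rw [integral_add (integrable_const _) hL.integrable_sq, h2]; simp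

/-- Since E|W_t| ≤ 1 + t, the expectation of the integral of exp(-|t|)|W_t| is finite, so the
integral is finite almost surely. -/
lemma ae_tempered {Ω : Type*} [MeasurableSpace Ω] {P : Measure Ω} [IsProbabilityMeasure P]
    {W : ℝ≥0 → Ω → ℝ} (hW : IsPreBrownianReal W P) (hm : ∀ t, Measurable (W t))
    (hc : ∀ ω, Continuous (W · ω)) : ∀ᵐ ω ∂P, Tempered (realPath (W · ω)) := by
  have hmeas : AEStronglyMeasurable
      (fun x : Ω × ℝ => Real.exp (-|x.2|) * realPath (W · x.1) x.2) (P.prod volume) :=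
    ((Measurable.mul (by fun_prop) (measurable_uncurry_realPath hm hc))).aestronglyMeasurable
  refine Integrable.prod_right_ae ((integrable_prod_iff' hmeas).2 ⟨.of_forall fun t => ?_, ?_⟩)
  · have : Integrable (fun ω => realPath (W · ω) t) P := by
      unfold realPath
      split_ifs
      · exact hW.integrable_eval _
      · exact integrable_const _
    exact this.const_mul (Real.exp (-|t|))
  · refine ((integrable_exp_neg_mul_abs (b := 1 / 2) (by norm_num)).const_mul 2).mono'
      hmeas.norm.prod_swap.integral_prod_right' (.of_forall fun t => ?_)
    have hle : ∫ ω, |realPath (W · ω) t| ∂P ≤ 1 + |t| := by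
      unfold realPath
      split_ifs with ht
      · simpa [ht.le, abs_of_pos ht] using integral_abs_le_one_add hW t.toNNReal
      · simp; positivity
    rw [Real.norm_of_nonneg (integral_nonneg fun _ => norm_nonneg _)]
    simp only [norm_mul, Real.norm_eq_abs, Real.abs_exp, integral_const_mul]
    have h3 : (1 + |t|) ≤ 2 * Real.exp (1 / 2 * |t|) := by
      have := Real.add_one_le_exp (1 / 2 * |t|); linarith
    calc Real.exp (-|t|) * ∫ ω, |realPath (W · ω) t| ∂P
        ≤ Real.exp (-|t|) * (2 * Real.exp (1 / 2 * |t|)) := by gcongr; exact hle.trans h3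
      _ = 2 * Real.exp (-(1 / 2) * |t|) := by
        rw [mul_left_comm, ← Real.exp_add]; ring_nf

end CongaLoop

namespace CongaLoop

/-! ### Splitting off three increments -/

/-- The increments of a process over `[0, 1]`, `[1, 2]` and `[2, 3]`. -/
def increments {Ω : Type*} (W : ℝ≥0 → Ω → ℝ) (ω : Ω) (k : Fin 3) : ℝ :=
  W ((k : ℕ) + 1) ω - W (k : ℕ) ω

/-- What remains of a process after its increments have been interpolated linearly. -/
noncomputable def remainder {Ω : Type*} (W : ℝ≥0 → Ω → ℝ) (t : ℝ≥0) (ω : Ω) : ℝ :=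
  W t ω - ∑ k : Fin 3, ramp (k : ℕ) t * increments W ω k

section

variable {Ω : Type*} {W : ℝ≥0 → Ω → ℝ}

lemma measurable_increments [MeasurableSpace Ω] (hm : ∀ t, Measurable (W t)) :
    Measurable (increments W) :=
  measurable_pi_lambda _ fun _ => (hm _).sub (hm _)

lemma measurable_remainder [MeasurableSpace Ω] (hm : ∀ t, Measurable (W t)) (t : ℝ≥0) :
    Measurable (remainder W t) := by
  have hk (k : Fin 3) : Measurable fun ω => increments W ω k :=
    (measurable_pi_apply k).comp (measurable_increments hm)
  unfold remainder
  fun_prop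

lemma continuous_remainder (hc : ∀ ω, Continuous (W · ω)) (ω : Ω) :
    Continuous (remainder W · ω) :=
  (hc ω).sub (continuous_finsetSum _ fun _ _ =>
    ((continuous_ramp _).comp NNReal.continuous_coe).mul continuous_const)

lemma perturb_remainder (ω : Ω) :
    perturb (realPath (remainder W · ω)) (increments W ω) = realPath (W · ω) := by
  ext t
  unfold perturb realPath
  split_ifs with ht
  · simp [remainder, ht.le, mul_comm]
  · have (k : Fin 3) : ramp (k : ℕ) t = 0 := by
      have : (0 : ℝ) ≤ (k : ℕ) := by positivity
      push Not at ht
      exact max_eq_left ((min_le_right _ _).trans (by linarith))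
    simp [this]

variable [MeasurableSpace Ω] {P : Measure Ω}

/-- The covariance of W_s with the k-th increment is min(s, k + 1) - min(s, k), which is exactly the
ramp at s, and the increments are orthonormal. The remainder is thus uncorrelated with them, and
joint Gaussianity gives independence. -/
lemma indepFun_remainder_increments (hW : IsPreBrownianReal W P) :
    IndepFun (fun ω t => remainder W t ω) (increments W) P := by
  have hP := hW.isGaussianProcess.isProbabilityMeasure
  have mW (t) : AEMeasurable (W t) P := hW.aemeasurable t
  have hL (t) : MemLp (fun ω => W t ω) 2 P :=
    (hW.isGaussianProcess.hasGaussianLaw_eval t).memLp_two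
  have hG (k) : MemLp (fun ω => increments W ω k) 2 P := (hL _).sub (hL _)
  have hcov (s : ℝ≥0) (k : Fin 3) :
      cov[fun ω => W s ω, fun ω => increments W ω k; P] = ramp (k : ℕ) s := by
    unfold increments ramp
    rw [covariance_fun_sub_right (hL _) (hL _) (hL _), hW.covariance_fun_eval,
      hW.covariance_fun_eval]
    push_cast
    grind
  have hcov' (l k : Fin 3) : cov[fun ω => increments W ω l, fun ω => increments W ω k; P] =
      if l = k then 1 else 0 := by
    have e : (fun ω => increments W ω l) = fun ω => W ((l : ℕ) + 1) ω - W (l : ℕ) ω := rfl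
    rw [e, covariance_fun_sub_left (hL _) (hL _) (hG _), hcov, hcov]
    fin_cases l <;> fin_cases k <;> norm_num [ramp]
  refine IsGaussianProcess.indepFun_of_covariance_eq_zero (X := remainder W)
    (Y := fun k ω => increments W ω k) ?_ (fun s => ?_) (fun k => (hG k).aemeasurable) ?_
  · refine hW.isGaussianProcess.of_isGaussianProcess ?_
    rintro (t | k)
    · refine ⟨{t, 0, 1, 2, 3}, ContinuousLinearMap.proj ⟨t, by simp⟩ -
        (ramp 0 t • (ContinuousLinearMap.proj ⟨1, by simp⟩ - ContinuousLinearMap.proj ⟨0, by simp⟩)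
        + ramp 1 t • (ContinuousLinearMap.proj ⟨2, by simp⟩ - ContinuousLinearMap.proj ⟨1, by simp⟩)
        + ramp 2 t •
          (ContinuousLinearMap.proj ⟨3, by simp⟩ - ContinuousLinearMap.proj ⟨2, by simp⟩)),
        fun ω => ?_⟩
      norm_num [remainder, increments, Fin.sum_univ_three]
    · exact ⟨{((k : ℕ) : ℝ≥0) + 1, ((k : ℕ) : ℝ≥0)}, ContinuousLinearMap.proj ⟨((k : ℕ) : ℝ≥0) + 1, by simp⟩ -
        ContinuousLinearMap.proj ⟨((k : ℕ) : ℝ≥0), by simp⟩, fun ω => by simp [increments]⟩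
  · have hk (k : Fin 3) : AEMeasurable (fun ω => increments W ω k) P := (hG k).aemeasurable
    unfold remainder
    fun_prop
  · intro s k
    have e : remainder W s = fun ω => W s ω - ∑ l : Fin 3, ramp (l : ℕ) s * increments W ω l := rfl
    rw [e, covariance_fun_sub_left (hL _) (memLp_finsetSum _ fun l _ => (hG l).const_mul _) (hG _),
      covariance_fun_sum_left (fun l => (hG l).const_mul _) (hG _), hcov]
    simp [covariance_const_mul_left, hcov']

lemma absolutelyContinuous_pi {n : ℕ} {μ ν : Fin n → Measure ℝ} [∀ i, SigmaFinite (μ i)]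
    [∀ i, SigmaFinite (ν i)] (h : ∀ i, μ i ≪ ν i) : Measure.pi μ ≪ Measure.pi ν := by
  induction n with
  | zero => rw [Measure.pi_of_empty, Measure.pi_of_empty]
  | succ n ih =>
    have e (μ : Fin (n + 1) → Measure ℝ) [∀ i, SigmaFinite (μ i)] :=
      (measurePreserving_piFinSuccAbove μ 0).symm.map_eq
    rw [← e μ, ← e ν]
    exact ((h 0).prod (ih fun i => h _)).map (MeasurableEquiv.measurable _)

lemma map_increments_absolutelyContinuous (hW : IsPreBrownianReal W P) :
    P.map (increments W) ≪ volume := by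
  have hP := hW.isGaussianProcess.isProbabilityMeasure
  have hind := hW.hasIndepIncrements 3 (fun i => ((i : ℕ) : ℝ≥0))
    (fun i j h => by simpa using h)
  have hm (i : Fin 3) : AEMeasurable (fun ω => increments W ω i) P :=
    (hW.aemeasurable _).sub (hW.aemeasurable _)
  have hind' : iIndepFun (fun (i : Fin 3) ω => increments W ω i) P := by
    simpa [increments] using hind
  have hmap := (iIndepFun_iff_map_fun_eq_pi_map hm).1 hind'
  have (i : Fin 3) : IsProbabilityMeasure (P.map fun ω => increments W ω i) :=
    Measure.isProbabilityMeasure_map (hm i)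
  change P.map (fun ω i => increments W ω i) ≪ _
  rw [hmap, volume_pi]
  refine absolutelyContinuous_pi fun i => ?_
  have hl := (hW.hasLaw_sub (((i : ℕ) : ℝ≥0) + 1) ((i : ℕ) : ℝ≥0)).map_eq
  have e : (W (((i : ℕ) : ℝ≥0) + 1) - W ((i : ℕ) : ℝ≥0)) = fun ω => increments W ω i := rfl
  rw [e] at hl
  rw [hl]
  refine gaussianReal_absolutelyContinuous _ ?_
  rw [← NNReal.coe_ne_zero, coe_nndist, Real.dist_eq]
  simp

end

/-! ### Independence of pairs -/

/-- All four variables are independent; what remains is to regroup the product measure by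
associativity and a swap of the middle factors. -/
lemma IndepFun.prodMk_prodMk {Ω α₁ α₂ β₁ β₂ : Type*} [MeasurableSpace Ω] [MeasurableSpace α₁]
    [MeasurableSpace α₂] [MeasurableSpace β₁] [MeasurableSpace β₂] {P : Measure Ω}
    [IsProbabilityMeasure P] {X₁ : Ω → α₁} {X₂ : Ω → α₂} {Y₁ : Ω → β₁} {Y₂ : Ω → β₂}
    (hX₁ : Measurable X₁) (hX₂ : Measurable X₂) (hY₁ : Measurable Y₁) (hY₂ : Measurable Y₂)
    (h₁ : IndepFun X₁ Y₁ P) (h₂ : IndepFun X₂ Y₂ P)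
    (h : IndepFun (fun ω => (X₁ ω, Y₁ ω)) (fun ω => (X₂ ω, Y₂ ω)) P) :
    P.map (fun ω => ((X₁ ω, X₂ ω), (Y₁ ω, Y₂ ω))) =
      ((P.map X₁).prod (P.map X₂)).prod ((P.map Y₁).prod (P.map Y₂)) := by
  have := Measure.isProbabilityMeasure_map (μ := P) hX₁.aemeasurable
  have := Measure.isProbabilityMeasure_map (μ := P) hX₂.aemeasurable
  have := Measure.isProbabilityMeasure_map (μ := P) hY₁.aemeasurable
  have := Measure.isProbabilityMeasure_map (μ := P) hY₂.aemeasurable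
  set μ₁ := P.map X₁
  set μ₂ := P.map X₂
  set ν₁ := P.map Y₁
  set ν₂ := P.map Y₂
  have e := (indepFun_iff_map_prod_eq_prod_map_map (hX₁.prodMk hY₁).aemeasurable
    (hX₂.prodMk hY₂).aemeasurable).1 h
  rw [(indepFun_iff_map_prod_eq_prod_map_map hX₁.aemeasurable hY₁.aemeasurable).1 h₁,
    (indepFun_iff_map_prod_eq_prod_map_map hX₂.aemeasurable hY₂.aemeasurable).1 h₂] at e
  have a₁ := measurePreserving_prodAssoc μ₁ ν₁ (μ₂.prod ν₂)
  have a₂ := (MeasurePreserving.id μ₁).prod (measurePreserving_prodAssoc ν₁ μ₂ ν₂).symm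
  have a₃ := (MeasurePreserving.id μ₁).prod
    ((Measure.measurePreserving_swap (μ := ν₁) (ν := μ₂)).prod (MeasurePreserving.id ν₂))
  have a₄ := (MeasurePreserving.id μ₁).prod (measurePreserving_prodAssoc μ₂ ν₁ ν₂)
  have a₅ := (measurePreserving_prodAssoc μ₁ μ₂ (ν₁.prod ν₂)).symm
  have a := a₅.comp (a₄.comp (a₃.comp (a₂.comp a₁)))
  rw [← a.map_eq, ← e, Measure.map_map a.measurable (by fun_prop)]
  rfl

end CongaLoop

namespace CongaLoop

/-! ### Almost surely, there is no degenerate singularity -/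

/-- Measures how far first, second and third derivatives are from those at a degenerate
singularity. -/
def defect (y₁ y₂ : Fin 3 → ℝ) : ℝ := |y₁ 0| + |y₂ 0| + |y₁ 1 * y₂ 2 - y₂ 1 * y₁ 2|

/-- The derivatives of order one to three of the heat extension of `v` along a sequence of points. -/
noncomputable def jetSamples (q : ℕ → ℝ × ℝ) (v : ℝ → ℝ) (n : ℕ) (j : Fin 3) : ℝ :=
  jet v (j + 1) (q n).1 (q n).2

/-- Pairs of sequences whose defect is not bounded away from zero. -/
def degenerateSamples : Set ((ℕ → Fin 3 → ℝ) × (ℕ → Fin 3 → ℝ)) :=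
  {d | ∀ m : ℕ, ∃ n, defect (d.1 n) (d.2 n) < 1 / (m + 1)}

/-- The effect of a perturbation by ramps on the samples of a path. -/
noncomputable def perturbSamples (q : ℕ → ℝ × ℝ) (d : ℕ → Fin 3 → ℝ) (g : Fin 3 → ℝ) :
    ℕ → Fin 3 → ℝ :=
  fun n j => d n j + ∑ k, g k * jet (ramp (k : ℕ)) (j + 1) (q n).1 (q n).2

lemma measurableSet_degenerateSamples : MeasurableSet degenerateSamples := by
  have : degenerateSamples = ⋂ m : ℕ, ⋃ n : ℕ,
      {d | defect (d.1 n) (d.2 n) < 1 / ((m : ℝ) + 1)} := by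
    ext; simp [degenerateSamples]
  rw [this]
  refine .iInter fun m => .iUnion fun n => measurableSet_lt ?_ measurable_const
  have h1 (j : Fin 3) : Measurable fun d : (ℕ → Fin 3 → ℝ) × (ℕ → Fin 3 → ℝ) => d.1 n j := by
    fun_prop
  have h2 (j : Fin 3) : Measurable fun d : (ℕ → Fin 3 → ℝ) × (ℕ → Fin 3 → ℝ) => d.2 n j := by
    fun_prop
  have habs {F : (ℕ → Fin 3 → ℝ) × (ℕ → Fin 3 → ℝ) → ℝ} (hF : Measurable F) :
      Measurable fun d => |F d| := continuous_abs.measurable.comp hF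
  exact ((habs (h1 0)).add (habs (h2 0))).add (habs (((h1 1).mul (h2 2)).sub ((h2 1).mul (h1 2))))

lemma jetSamples_perturb {v : ℝ → ℝ} (hv : Tempered v) (g : Fin 3 → ℝ) {q : ℕ → ℝ × ℝ}
    (hq : ∀ n, 0 < (q n).2) :
    jetSamples q (perturb v g) = perturbSamples q (jetSamples q v) g := by
  ext n j
  exact jet_perturb hv g _ _ (hq n)

/-- The event involves uncountably many (p, τ), but the defect is continuous on a compact set: it
vanishes somewhere iff its infimum over a dense sequence is 0. This makes the event measurable in
countably many samples. -/
lemma mem_degenerateSamples_iff {w₁ w₂ : ℝ → ℝ} (h₁ : Tempered w₁) (h₂ : Tempered w₂)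
    {K : Set (ℝ × ℝ)} (hK : IsCompact K) (hpos : ∀ x ∈ K, 0 < x.2) {q : ℕ → K}
    (hq : DenseRange q) :
    (jetSamples (fun n => q n) w₁, jetSamples (fun n => q n) w₂) ∈ degenerateSamples ↔
      ∃ x ∈ K, IsDegenerate w₁ w₂ x.1 x.2 := by
  have : CompactSpace K := isCompact_iff_compactSpace.1 hK
  have : Nonempty K := ⟨q 0⟩
  set F : K → ℝ := fun x => defect (fun j => jet w₁ (j + 1) x.1.1 x.1.2)
    (fun j => jet w₂ (j + 1) x.1.1 x.1.2) with hF
  have hjet {w : ℝ → ℝ} (hw : Tempered w) (j : Fin 3) :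
      Continuous fun x : K => jet w (j + 1) x.1.1 x.1.2 :=
    continuous_iff_continuousAt.2 fun x =>
      ContinuousAt.comp (f := Subtype.val) (x := x)
        (differentiableAt_jet hw (by omega) _ (hpos x x.2)).continuousAt
        continuous_subtype_val.continuousAt
  have hFc : Continuous F :=
    ((hjet h₁ 0).abs.add (hjet h₂ 0).abs).add
      (((hjet h₁ 1).mul (hjet h₂ 2)).sub ((hjet h₂ 1).mul (hjet h₁ 2))).abs
  have hF0 (x : K) : 0 ≤ F x := by simp only [hF, defect]; positivity
  have hdeg (x : K) : F x = 0 ↔ IsDegenerate w₁ w₂ x.1.1 x.1.2 := by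
    simp only [hF, defect, IsDegenerate]
    rw [add_eq_zero_iff_of_nonneg (by positivity) (by positivity),
      add_eq_zero_iff_of_nonneg (by positivity) (by positivity), abs_eq_zero, abs_eq_zero,
      abs_eq_zero, and_assoc]
    rfl
  have hmem : (jetSamples (fun n => q n) w₁, jetSamples (fun n => q n) w₂) ∈ degenerateSamples ↔
      ∀ m : ℕ, ∃ n, F (q n) < 1 / (m + 1) := Iff.rfl
  rw [hmem]
  constructor
  · intro h
    obtain ⟨x, -, hx⟩ := isCompact_univ.exists_isMinOn univ_nonempty hFc.continuousOn
    refine ⟨x, x.2, (hdeg x).1 (le_antisymm (le_of_forall_pos_le_add fun ε hε => ?_) (hF0 x))⟩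
    obtain ⟨m, hm⟩ := exists_nat_one_div_lt hε
    obtain ⟨n, hn⟩ := h m
    linarith [isMinOn_iff.1 hx (q n) (mem_univ _)]
  · rintro ⟨x, hx, hd⟩ m
    have h0 := (hdeg ⟨x, hx⟩).2 hd
    exact hq.exists_mem_open (isOpen_lt hFc continuous_const) ⟨⟨x, hx⟩, by
      rw [mem_ofPred_eq, h0]; positivity⟩

lemma measurable_jetSamples {Ω : Type*} [MeasurableSpace Ω] {V : ℝ≥0 → Ω → ℝ}
    (hm : ∀ t, Measurable (V t)) (hc : ∀ ω, Continuous (V · ω)) (q : ℕ → ℝ × ℝ) :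
    Measurable fun ω => jetSamples q (realPath (V · ω)) :=
  measurable_pi_lambda _ fun _ => measurable_pi_lambda _ fun _ => measurable_jet hm hc _ _ _

/-- Measurability of the samples uses continuity of the paths, which the product σ-algebra on all
functions does not see. Hence measurability is required on Ω, for the σ-algebra generated by the
process, and not on path space. -/
lemma IndepFun.of_measurable_comap {Ω α β α' β' : Type*} [MeasurableSpace Ω]
    [mα : MeasurableSpace α] [mβ : MeasurableSpace β] [MeasurableSpace α'] [MeasurableSpace β']
    {P : Measure Ω} {f : Ω → α} {g : Ω → β} {f' : Ω → α'} {g' : Ω → β'} (h : IndepFun f g P)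
    (hf : Measurable[mα.comap f] f') (hg : Measurable[mβ.comap g] g') : IndepFun f' g' P :=
  (IndepFun_iff_Indep _ _ _).2 (indep_of_indep_of_le_left
    (indep_of_indep_of_le_right ((IndepFun_iff_Indep _ _ _).1 h) hg.comap_le) hf.comap_le)

lemma tempered_remainder {Ω : Type*} {W : ℝ≥0 → Ω → ℝ} {ω : Ω}
    (h : Tempered (realPath (W · ω))) : Tempered (realPath (remainder W · ω)) := by
  have e : perturb (realPath (W · ω)) (-increments W ω) = realPath (remainder W · ω) := by
    rw [← perturb_remainder]
    ext t
    simp [perturb]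
  exact e ▸ h.perturb _

section

variable {Ω : Type*} [MeasurableSpace Ω] {P : Measure Ω} [IsProbabilityMeasure P]
  {W₁ W₂ : ℝ≥0 → Ω → ℝ}

/-- Fubini over the independent pair (samples of the remainders, ramp weights): for almost every
remainder the bad weights are Lebesgue null, and the law of the weights is absolutely continuous. -/
lemma ae_not_isDegenerate_of_isCompact (hW₁ : IsPreBrownianReal W₁ P)
    (hW₂ : IsPreBrownianReal W₂ P) (m₁ : ∀ t, Measurable (W₁ t)) (m₂ : ∀ t, Measurable (W₂ t))
    (c₁ : ∀ ω, Continuous (W₁ · ω)) (c₂ : ∀ ω, Continuous (W₂ · ω))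
    (hindep : IndepFun (fun ω t => W₁ t ω) (fun ω t => W₂ t ω) P) {K : Set (ℝ × ℝ)}
    (hK : IsCompact K) (hpos : ∀ x ∈ K, 0 < x.2) (hne : K.Nonempty) :
    ∀ᵐ ω ∂P, ¬ ∃ x ∈ K, IsDegenerate (realPath (W₁ · ω)) (realPath (W₂ · ω)) x.1 x.2 := by
  have : Nonempty K := hne.to_subtype
  set q : ℕ → K := TopologicalSpace.denseSeq K
  have hq : DenseRange q := TopologicalSpace.denseRange_denseSeq K
  set D₁ : Ω → ℕ → Fin 3 → ℝ := fun ω => jetSamples (fun n => q n) (realPath (remainder W₁ · ω))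
  set D₂ : Ω → ℕ → Fin 3 → ℝ := fun ω => jetSamples (fun n => q n) (realPath (remainder W₂ · ω))
  have mD₁ : Measurable D₁ :=
    measurable_jetSamples (measurable_remainder m₁) (continuous_remainder c₁) _
  have mD₂ : Measurable D₂ :=
    measurable_jetSamples (measurable_remainder m₂) (continuous_remainder c₂) _
  have mG₁ := measurable_increments m₁
  have mG₂ := measurable_increments m₂
  have hcomap {V : ℝ≥0 → Ω → ℝ} (t : ℝ≥0) :
      Measurable[MeasurableSpace.comap (fun ω t => V t ω) MeasurableSpace.pi] (V t) :=
    (measurable_pi_apply (X := fun _ : ℝ≥0 => ℝ) t).comp (comap_measurable fun ω t => V t ω)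
  have hDG {W : ℝ≥0 → Ω → ℝ} (hW : IsPreBrownianReal W P) (c : ∀ ω, Continuous (W · ω)) :
      IndepFun (fun ω => jetSamples (fun n => q n) (realPath (remainder W · ω)))
        (increments W) P :=
    IndepFun.of_measurable_comap (indepFun_remainder_increments hW)
      (@measurable_jetSamples _ (_) _ hcomap (continuous_remainder c) _) (comap_measurable _)
  have hpair {W : ℝ≥0 → Ω → ℝ} (c : ∀ ω, Continuous (W · ω)) :
      Measurable[MeasurableSpace.comap (fun ω t => W t ω) MeasurableSpace.pi] fun ω =>
        (jetSamples (fun n => q n) (realPath (remainder W · ω)), increments W ω) :=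
    Measurable.prodMk
      (@measurable_jetSamples _ (_) _ (@measurable_remainder _ _ (_) hcomap)
        (continuous_remainder c) _) (@measurable_increments _ _ (_) hcomap)
  have hind := IndepFun.of_measurable_comap hindep (hpair c₁) (hpair c₂)
  have hlaw := IndepFun.prodMk_prodMk mD₁ mD₂ mG₁ mG₂ (hDG hW₁ c₁) (hDG hW₂ c₂) hind
  have hD : P.map (fun ω => (D₁ ω, D₂ ω)) = (P.map D₁).prod (P.map D₂) :=
    (indepFun_iff_map_prod_eq_prod_map_map mD₁.aemeasurable mD₂.aemeasurable).1
      (hind.comp measurable_fst measurable_fst)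
  rw [← hD] at hlaw
  have := Measure.isProbabilityMeasure_map (μ := P) mG₁.aemeasurable
  have := Measure.isProbabilityMeasure_map (μ := P) mG₂.aemeasurable
  set ν := (P.map (increments W₁)).prod (P.map (increments W₂))
  have hν : ν ≪ (volume : Measure (Fin 3 → ℝ)).prod volume :=
    (map_increments_absolutelyContinuous hW₁).prod (map_increments_absolutelyContinuous hW₂)
  set N : Set (((ℕ → Fin 3 → ℝ) × (ℕ → Fin 3 → ℝ)) × RampCoeff) :=
    {z | (perturbSamples (fun n => q n) z.1.1 z.2.1, perturbSamples (fun n => q n) z.1.2 z.2.2) ∈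
      degenerateSamples} with hN
  have mN : MeasurableSet N := by
    refine Measurable.prodMk ?_ ?_ measurableSet_degenerateSamples
    all_goals
      refine measurable_pi_lambda _ fun n => measurable_pi_lambda _ fun j => ?_
      simp only [perturbSamples]
      fun_prop
  have hposq (n : ℕ) : 0 < ((q n : ℝ × ℝ)).2 := hpos _ (q n).2
  have t₁ := ae_tempered hW₁ m₁ c₁
  have t₂ := ae_tempered hW₂ m₂ c₂
  -- For a tempered realisation, a section of `N` consists of weights for which the perturbed
  -- remainders have a degenerate singularity in K.
  have hnull : P.map (fun ω => ((D₁ ω, D₂ ω), (increments W₁ ω, increments W₂ ω))) N = 0 := by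
    rw [hlaw, Measure.measure_prod_null mN]
    refine (ae_map_iff (mD₁.prodMk mD₂).aemeasurable
      (measurable_measure_prodMk_left mN (measurableSet_singleton 0))).2 ?_
    filter_upwards [t₁, t₂] with ω h₁ h₂
    have r₁ := tempered_remainder h₁
    have r₂ := tempered_remainder h₂
    refine hν (measure_mono_null (fun g hg => ?_) (volume_degenerate_eq_zero r₁ r₂))
    have hg' : (jetSamples (fun n => q n) (perturb (realPath (remainder W₁ · ω)) g.1),
        jetSamples (fun n => q n) (perturb (realPath (remainder W₂ · ω)) g.2)) ∈
        degenerateSamples := by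
      rw [jetSamples_perturb r₁ _ hposq, jetSamples_perturb r₂ _ hposq]
      exact hg
    obtain ⟨x, hx, hd⟩ := (mem_degenerateSamples_iff (r₁.perturb _) (r₂.perturb _) hK hpos hq).1 hg'
    exact ⟨x.1, x.2, hpos x hx, hd⟩
  rw [Measure.map_apply ((mD₁.prodMk mD₂).prodMk (mG₁.prodMk mG₂)) mN] at hnull
  filter_upwards [t₁, t₂, measure_eq_zero_iff_ae_notMem.1 hnull] with ω h₁ h₂ hω hex
  refine hω ?_
  have := (mem_degenerateSamples_iff h₁ h₂ hK hpos hq).2 hex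
  rw [← perturb_remainder (W := W₁), ← perturb_remainder (W := W₂),
    jetSamples_perturb (tempered_remainder h₁) _ hposq,
    jetSamples_perturb (tempered_remainder h₂) _ hposq] at this
  exact this

lemma ae_not_isDegenerate (hW₁ : IsPreBrownianReal W₁ P)
    (hW₂ : IsPreBrownianReal W₂ P) (m₁ : ∀ t, Measurable (W₁ t)) (m₂ : ∀ t, Measurable (W₂ t))
    (c₁ : ∀ ω, Continuous (W₁ · ω)) (c₂ : ∀ ω, Continuous (W₂ · ω))
    (hindep : IndepFun (fun ω t => W₁ t ω) (fun ω t => W₂ t ω) P) :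
    ∀ᵐ ω ∂P, ∀ p τ, 0 < τ → ¬ IsDegenerate (realPath (W₁ · ω)) (realPath (W₂ · ω)) p τ := by
  -- Countably many compact boxes exhaust the half-plane τ > 0.
  have h (m : ℕ) := ae_not_isDegenerate_of_isCompact hW₁ hW₂ m₁ m₂ c₁ c₂ hindep
    (K := Icc (-(m + 1 : ℝ)) (m + 1) ×ˢ Icc (1 / (m + 1 : ℝ)) (m + 1))
    (isCompact_Icc.prod isCompact_Icc)
    (fun x hx => lt_of_lt_of_le (by positivity) hx.2.1)
    ⟨(0, 1), ⟨⟨neg_nonpos.2 (by positivity), by positivity⟩,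
      ⟨by rw [div_le_one (by positivity)]; simp, by simp⟩⟩⟩
  filter_upwards [ae_all_iff.2 h] with ω hω p τ hτ hd
  obtain ⟨a, ha⟩ := exists_nat_one_div_lt hτ
  obtain ⟨b, hb⟩ := exists_nat_ge |p|
  obtain ⟨c, hc⟩ := exists_nat_ge τ
  have hp := abs_le.1 hb
  have e : (((a + b + c : ℕ) : ℝ)) = a + b + c := by push_cast; ring
  have a0 : (0 : ℝ) ≤ a := a.cast_nonneg
  have b0 : (0 : ℝ) ≤ b := b.cast_nonneg
  have c0 : (0 : ℝ) ≤ c := c.cast_nonneg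
  refine hω (a + b + c) ⟨(p, τ), ⟨⟨?_, ?_⟩, ⟨?_, ?_⟩⟩, hd⟩ <;> rw [e] <;> simp only
  · linarith
  · linarith
  · exact (one_div_le_one_div_of_le (by positivity) (by linarith)).trans ha.le
  · linarith

end

end CongaLoop
theorem mainTheorem7 {Ω : Type*} [MeasurableSpace Ω] (P : Measure Ω) [IsProbabilityMeasure P]
    (W₁ W₂ : ℝ≥0 → Ω → ℝ) (hW₁ : IsBrownianReal W₁ P) (hW₂ : IsBrownianReal W₂ P)
    (hindep : IndepFun (fun ω t => W₁ t ω) (fun ω t => W₂ t ω) P) :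
    ∃ M : ℝ, 0 < M ∧ ∀ᵐ ω ∂P, ∀ f : ℝ → ℝ → ℂ,
      f = CongaLoop.heatExtension (fun t => W₁ t ω) (fun t => W₂ t ω) →
      ∀ p₀ τ₀ : ℝ, 0 < p₀ → 0 < τ₀ → CongaLoop.IsSingularity (fun p => f p τ₀) p₀ →
      CongaLoop.IsCuspSingularity (fun p => f p τ₀) p₀ ∧
      ∃ δ : ℝ, 0 < δ ∧ δ < τ₀ ∧
        (∃ (l r : ℝ → ℝ) (L : ℝ → CongaLoop.Curve),
          (∀ τ ∈ Ico (τ₀ - δ) τ₀, 0 < l τ ∧ p₀ ∈ Ioo (l τ) (r τ) ∧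
            CongaLoop.IsUniqueLoopIn (fun p => f p τ) (Icc (l τ) (r τ)) (L τ)) ∧
          MonotoneOn l (Ico (τ₀ - δ) τ₀) ∧ AntitoneOn r (Ico (τ₀ - δ) τ₀) ∧
          Tendsto l (𝓝[<] τ₀) (𝓝 p₀) ∧ Tendsto r (𝓝[<] τ₀) (𝓝 p₀) ∧
          CongaLoop.DiesAt f (τ₀ - δ) L p₀ τ₀) ∧
        ∀ (c : ℂ) (a b : ℕ → ℝ), CongaLoop.IsNaturalFrame (fun p => f p τ₀) p₀ c a b →
          CongaLoop.IsUniqueLoopIn (CongaLoop.limitCurve (a 2) (b 3)) univ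
            (CongaLoop.limitLoop (a 2) (b 3)) ∧
          ∃ Lhat : ℝ → CongaLoop.Curve,
            (∀ s ∈ Ioc 0 δ, CongaLoop.IsUniqueLoopIn (CongaLoop.rescaled f c p₀ τ₀ s)
              (Icc (-M) M) (Lhat s)) ∧
            Tendsto Lhat (𝓝[>] 0) (𝓝 (CongaLoop.limitLoop (a 2) (b 3))) := by
  -- Any M > √3 close enough to √3 would be natural; 2 is the window of `NearModel`. It is universal
  -- because natural frames alter the limiting curve only by scaling its coordinates.
  refine ⟨2, two_pos, ?_⟩
  obtain ⟨V₁, m₁, c₁, e₁⟩ := CongaLoop.exists_continuous_version hW₁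
  obtain ⟨V₂, m₂, c₂, e₂⟩ := CongaLoop.exists_continuous_version hW₂
  have hV₁ : IsPreBrownianReal V₁ P :=
    hW₁.toIsPreBrownianReal.congr fun t => e₁.mono fun ω h => h t
  have hV₂ : IsPreBrownianReal V₂ P :=
    hW₂.toIsPreBrownianReal.congr fun t => e₂.mono fun ω h => h t
  have hV : IndepFun (fun ω t => V₁ t ω) (fun ω t => V₂ t ω) P :=
    hindep.congr (e₁.mono fun ω h => funext h) (e₂.mono fun ω h => funext h)
  filter_upwards [e₁, e₂, CongaLoop.ae_tempered hV₁ m₁ c₁, CongaLoop.ae_tempered hV₂ m₂ c₂,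
    CongaLoop.ae_not_isDegenerate hV₁ hV₂ m₁ m₂ c₁ c₂ hV] with ω h₁ h₂ t₁ t₂ hdeg f hf
    p₀ τ₀ hp hτ hsing
  -- On this event the whole paths agree, so `f` is literally the heat extension of the continuous
  -- versions.
  rw [funext h₁, funext h₂] at hf
  have hflow : CongaLoop.IsHeatFlow f (CongaLoop.realPath (V₁ · ω))
      (CongaLoop.realPath (V₂ · ω)) :=
    ⟨t₁, t₂, fun p τ hτ => hf ▸ CongaLoop.heatExtension_eq t₁ t₂ p hτ⟩
  have hjet := hflow.jet_one_eq_zero hτ hsing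
  exact hflow.cusp_formation hp hτ hsing fun h => hdeg p₀ τ₀ hτ ⟨hjet.1, hjet.2, h⟩
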